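/- Let $n\in\mathbb N$, $s\in\mathbb R$. Write $\widehat{\ }$ or $\mathcal F$ for the Fourier transform, on $\mathbb R^n$ (frequency $\xi$) and on $\mathbb R^{1+n}$ with coordinates $(t,x)$ (frequencies $(\tau,\xi)$). For $a\in\mathbb R$ let $\Lambda^a,\Lambda_+^a,\Lambda_-^a$ be the Fourier multipliers with symbols $$(1+|\xi|^2)^{a/2},\qquad (1+\tau^2+|\xi|^2)^{a/2},\qquad \Bigl(1+\frac{(\tau^2-|\xi|^2)^2}{1+\tau^2+|\xi|^2}\Bigr)^{a/2},$$ and put $\square=-\partial_t^2+\Delta$, $\widetilde\square=\Lambda_+\Lambda_-$. Let $\|f\|_{H^s}=\|\Lambda^sf\|_{L^2(\mathbb R^n)}$, $\|u\|_{H^{s,\theta}}=\|\Lambda^s\Lambda_-^\theta u\|_{L^2(\mathbb R^{1+n})}$ and $\|u\|_{\mathcal H^{s,\theta}}=\|u\|_{H^{s,\theta}}+\|\partial_tu\|_{H^{s-1,\theta}}$. Let $\mathcal X^s$ be a (complex) Banach space of tempered distributions on $\mathbb R^{1+n}$; put $\|u\|_{\mathcal X^s}=\infty$ for $u\notin\mathcal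 X^s$. Let $\theta>\frac12$ and $\gamma<2$ be such that (i) $\mathcal X^s$ embeds continuously in $\mathcal H^{s,\theta}$; (ii) if $\widehat u,\widehat v$ are functions and $|\widehat u|\le|\widehat v|$ almost everywhere, then $\|u\|_{\mathcal X^s}\le\|v\|_{\mathcal X^s}$ (in particular $u\in\mathcal X^s$ if $v\in\mathcal X^s$); (iii) there is a constant $B$ such that, for all tempered distributions $u$, $$\|u\|_{\mathcal X^s}\le B\,\bigl\|\mathcal F\Lambda^{s-1}\Lambda_+\Lambda_-^\gamma u(\tau,\xi)\bigr\|_{L^2_\xi(L^\infty_\tau)},$$ where the right-hand side is $\bigl(\int\|\mathcal F\Lambda^{s-1}\Lambda_+\Lambda_-^\gamma u(\cdot,\xi)\|_{L^\infty}^2\,d\xi\bigr)^{1/2}$, and is $\infty$ if $\mathcal F\Lambda^{s-1}\Lambda_+\Lambda_-^\gamma u$ is not a function. Since $\theta>\frac12$, the elements of $\mathcal X^s$ are continuous functions of $t$ with values in $H^s$. For $T>0$ let $\|u\|_{\mathcal X^s_T}$ be the infimum of $\|v\|_{\mathcal X^s}$ over all $v\in\mathcal X^s$ with $v(t)=u(t)$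 for all $t\in[0,T]$ ($\infty$ if there is no such $v$). Then there are a constant $C$ and constants $C_{T,\varepsilon}$ ($0<T<1$, $\varepsilon\ge0$) such that the following holds. (a) For all $\varepsilon\ge0$, all $(f,g)\in H^s\times H^{s-1}$ and all $F\in\widetilde\square\Lambda_-^{-\varepsilon}(\mathcal X^s)$ there is a unique $u\in C(\mathbb R,H^s)\cap C^1(\mathbb R,H^{s-1})$ with $$\square u=F\ \text{ in the sense of distributions on }\mathbb R^{1+n},\qquad u|_{t=0}=f,\qquad \partial_tu|_{t=0}=g,$$ and for all $0<T<1$ it satisfies $$\|u\|_{\mathcal X^s_T}\le C\bigl(\|f\|_{H^s}+\|g\|_{H^{s-1}}\bigr)+C_{T,\varepsilon}\,\bigl\|\widetilde\square^{-1}\Lambda_-^\varepsilon F\bigr\|_{\mathcal X^s};$$ in particular the restriction of $u$ to $[0,T]$ is the restriction of an element of $\mathcal X^s$. (b) If $\varepsilon>0$, then $C_{T,\varepsilon}\to0$ as $T\to0^+$. (c) There is a constant $C'$ such that for all $\varepsilon\ge0$, all $0\le\alpha\le1$ and all $0<T<1$ $$C_{T,\varepsilon}\le C'\,T^{\min\{\alpha\varepsilon,\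 \delta\}},\qquad \delta=2-\gamma-\tfrac{\alpha}{2}+\min\{0,\alpha(\theta+\varepsilon-1)\}.$$ -/

import Mathlib

open MeasureTheory Filter Topology
open scoped SchwartzMap ENNReal NNReal FourierTransform LineDeriv

noncomputable section

namespace WaveEstimate

/-- Physical space `ℝⁿ`. -/
abbrev Space (n : ℕ) : Type := EuclideanSpace ℝ (Fin n)

/-- Space-time `ℝ^{1+n}` with coordinates `(t, x)` and its Euclidean structure. -/
abbrev SpaceTime (n : ℕ) : Type := WithLp 2 (ℝ × Space n)

variable {n : ℕ}

/-- The point `(t, x)` of space-time. -/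
def point (t : ℝ) (x : Space n) : SpaceTime n := WithLp.toLp 2 (t, x)

/-! ### Fourier symbols, as functions of the angular frequencies `(τ, ξ)` -/

/-- The symbol `(1 + |ξ|²)^{a/2}`. -/
def symLam (a : ℝ) (ξ : Space n) : ℝ := (1 + ‖ξ‖ ^ 2) ^ (a / 2)

/-- The symbol `(1 + τ² + |ξ|²)^{a/2}`. -/
def symPlus (a : ℝ) (τ : ℝ) (ξ : Space n) : ℝ := (1 + τ ^ 2 + ‖ξ‖ ^ 2) ^ (a / 2)

/-- The symbol `(1 + (τ² - |ξ|²)² / (1 + τ² + |ξ|²))^{a/2}`. -/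
def symMinus (a : ℝ) (τ : ℝ) (ξ : Space n) : ℝ :=
  (1 + (τ ^ 2 - ‖ξ‖ ^ 2) ^ 2 / (1 + τ ^ 2 + ‖ξ‖ ^ 2)) ^ (a / 2)

/-! ### The Fourier multipliers

The Fourier transform of Mathlib has the kernel `exp (-2πi⟨x, η⟩)`, so that the angular frequency
is `2π η`. -/

/-- `Λ^a` on tempered distributions on `ℝⁿ`. -/
def lam (a : ℝ) : 𝓢'(Space n, ℂ) →L[ℂ] 𝓢'(Space n, ℂ) :=
  TemperedDistribution.fourierMultiplierCLM ℂ
    (fun η ↦ ((symLam a ((2 * Real.pi) • η) : ℝ) : ℂ))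

/-- `Λ^a` on tempered distributions on `ℝ^{1+n}` (acting in `x` only). -/
def lamX (a : ℝ) : 𝓢'(SpaceTime n, ℂ) →L[ℂ] 𝓢'(SpaceTime n, ℂ) :=
  TemperedDistribution.fourierMultiplierCLM ℂ
    (fun ζ ↦ ((symLam a ((2 * Real.pi) • ζ.snd) : ℝ) : ℂ))

/-- `Λ₊^a`. -/
def lamPlus (a : ℝ) : 𝓢'(SpaceTime n, ℂ) →L[ℂ] 𝓢'(SpaceTime n, ℂ) :=
  TemperedDistribution.fourierMultiplierCLM ℂ
    (fun ζ ↦ ((symPlus a (2 * Real.pi * ζ.fst) ((2 * Real.pi) • ζ.snd) : ℝ) : ℂ))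

/-- `Λ₋^a`. -/
def lamMinus (a : ℝ) : 𝓢'(SpaceTime n, ℂ) →L[ℂ] 𝓢'(SpaceTime n, ℂ) :=
  TemperedDistribution.fourierMultiplierCLM ℂ
    (fun ζ ↦ ((symMinus a (2 * Real.pi * ζ.fst) ((2 * Real.pi) • ζ.snd) : ℝ) : ℂ))

/-- `□̃ = Λ₊ Λ₋`. -/
def boxTilde : 𝓢'(SpaceTime n, ℂ) →L[ℂ] 𝓢'(SpaceTime n, ℂ) := lamPlus 1 ∘L lamMinus 1

/-- `□̃⁻¹ = Λ₋⁻¹ Λ₊⁻¹`. -/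
def boxTildeInv : 𝓢'(SpaceTime n, ℂ) →L[ℂ] 𝓢'(SpaceTime n, ℂ) := lamMinus (-1) ∘L lamPlus (-1)

/-! The symbols are smooth with temperate growth, so the multipliers above have their intended
meaning on all tempered distributions. -/

theorem hasTemperateGrowth_symLam (a : ℝ) :
    (fun η : Space n ↦ ((symLam a ((2 * Real.pi) • η) : ℝ) : ℂ)).HasTemperateGrowth := by
  have h1 : (fun η : Space n ↦ (2 * Real.pi) • η).HasTemperateGrowth := by fun_prop
  exact Complex.ofRealCLM.hasTemperateGrowth.comp
    ((Function.hasTemperateGrowth_one_add_norm_sq_rpow (Space n) (a / 2)).comp h1)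

theorem hasTemperateGrowth_fst :
    (fun ζ : SpaceTime n ↦ 2 * Real.pi * ζ.fst).HasTemperateGrowth :=
  ((2 * Real.pi) • WithLp.fstL 2 ℝ ℝ (Space n)).hasTemperateGrowth

theorem hasTemperateGrowth_snd :
    (fun ζ : SpaceTime n ↦ (2 * Real.pi) • ζ.snd).HasTemperateGrowth :=
  ((2 * Real.pi) • WithLp.sndL 2 ℝ ℝ (Space n)).hasTemperateGrowth

theorem hasTemperateGrowth_symLamX (a : ℝ) :
    (fun ζ : SpaceTime n ↦
      ((symLam a ((2 * Real.pi) • ζ.snd) : ℝ) : ℂ)).HasTemperateGrowth :=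
  Complex.ofRealCLM.hasTemperateGrowth.comp
    ((Function.hasTemperateGrowth_one_add_norm_sq_rpow (Space n) (a / 2)).comp
      hasTemperateGrowth_snd)

theorem hasTemperateGrowth_symPlus_real (a : ℝ) :
    (fun ζ : SpaceTime n ↦
      symPlus a (2 * Real.pi * ζ.fst) ((2 * Real.pi) • ζ.snd)).HasTemperateGrowth := by
  have h1 : (fun ζ : SpaceTime n ↦ (2 * Real.pi) • ζ).HasTemperateGrowth := by fun_prop
  have h := (Function.hasTemperateGrowth_one_add_norm_sq_rpow (SpaceTime n) (a / 2)).comp h1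
  refine (funext fun ζ ↦ ?_ : (fun ζ : SpaceTime n ↦
    symPlus a (2 * Real.pi * ζ.fst) ((2 * Real.pi) • ζ.snd)) = _) ▸ h
  simp only [symPlus, Function.comp_apply, WithLp.prod_norm_sq_eq_of_L2, WithLp.smul_fst,
    WithLp.smul_snd, smul_eq_mul, Real.norm_eq_abs, sq_abs]
  ring_nf

theorem hasTemperateGrowth_symPlus (a : ℝ) :
    (fun ζ : SpaceTime n ↦ ((symPlus a (2 * Real.pi * ζ.fst)
      ((2 * Real.pi) • ζ.snd) : ℝ) : ℂ)).HasTemperateGrowth :=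
  Complex.ofRealCLM.hasTemperateGrowth.comp (hasTemperateGrowth_symPlus_real a)

theorem hasTemperateGrowth_symMinus (a : ℝ) :
    (fun ζ : SpaceTime n ↦ ((symMinus a (2 * Real.pi * ζ.fst)
      ((2 * Real.pi) • ζ.snd) : ℝ) : ℂ)).HasTemperateGrowth := by
  set q : SpaceTime n → ℝ := fun ζ ↦
    (2 * Real.pi * ζ.fst) ^ 2 - ‖(2 * Real.pi) • ζ.snd‖ ^ 2 with hq
  have hn : (fun ζ : SpaceTime n ↦ ‖(2 * Real.pi) • ζ.snd‖ ^ 2).HasTemperateGrowth :=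
    (Function.hasTemperateGrowth_norm_sq (H := Space n)).comp hasTemperateGrowth_snd
  have hqt : q.HasTemperateGrowth := (hasTemperateGrowth_fst.pow 2).sub hn
  -- `w = ((τ, ξ), τ² - |ξ|²)`, so that `1 + ‖w‖²` is the numerator of the symbol
  let iL : SpaceTime n →L[ℝ] WithLp 2 (SpaceTime n × ℝ) :=
    (WithLp.prodContinuousLinearEquiv 2 ℝ (SpaceTime n) ℝ).symm.toContinuousLinearMap ∘L
      ContinuousLinearMap.inl ℝ _ _
  let iR : ℝ →L[ℝ] WithLp 2 (SpaceTime n × ℝ) :=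
    (WithLp.prodContinuousLinearEquiv 2 ℝ (SpaceTime n) ℝ).symm.toContinuousLinearMap ∘L
      ContinuousLinearMap.inr ℝ _ _
  have h1 : (fun ζ : SpaceTime n ↦ iL ((2 * Real.pi) • ζ)).HasTemperateGrowth :=
    (iL ∘L ((2 * Real.pi) • ContinuousLinearMap.id ℝ (SpaceTime n))).hasTemperateGrowth
  have hw : (fun ζ : SpaceTime n ↦ iL ((2 * Real.pi) • ζ) + iR (q ζ)).HasTemperateGrowth :=
    h1.add (iR.hasTemperateGrowth.comp hqt)
  have h := (Function.hasTemperateGrowth_one_add_norm_sq_rpow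
    (WithLp 2 (SpaceTime n × ℝ)) (a / 2)).comp hw
  have h2 := h.mul (hasTemperateGrowth_symPlus_real (n := n) (-a))
  refine Complex.ofRealCLM.hasTemperateGrowth.comp
    (f := fun ζ : SpaceTime n ↦ symMinus a (2 * Real.pi * ζ.fst) ((2 * Real.pi) • ζ.snd)) ?_
  refine (funext fun ζ ↦ ?_ : (fun ζ : SpaceTime n ↦
    symMinus a (2 * Real.pi * ζ.fst) ((2 * Real.pi) • ζ.snd)) = _) ▸ h2
  have e1 : ‖iL ((2 * Real.pi) • ζ) + iR (q ζ)‖ ^ 2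
      = (2 * Real.pi * ζ.fst) ^ 2 + ‖(2 * Real.pi) • ζ.snd‖ ^ 2 + (q ζ) ^ 2 := by
    rw [WithLp.prod_norm_sq_eq_of_L2]
    simp only [iL, iR, WithLp.add_fst, WithLp.add_snd, ContinuousLinearMap.comp_apply,
      ContinuousLinearMap.inl_apply, ContinuousLinearMap.inr_apply]
    simp [WithLp.prod_norm_sq_eq_of_L2, mul_pow]
  have hp : 0 < 1 + (2 * Real.pi * ζ.fst) ^ 2 + ‖(2 * Real.pi) • ζ.snd‖ ^ 2 := by positivity
  simp only [Pi.mul_apply, Function.comp_apply, symMinus, symPlus]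
  rw [e1, neg_div, Real.rpow_neg hp.le, ← div_eq_mul_inv, ← Real.div_rpow (by positivity) hp.le]
  congr 1
  rw [hq]
  field_simp
  ring

/-! ### Norms -/

section Norms

variable {E : Type*} [NormedAddCommGroup E] [InnerProductSpace ℝ E] [FiniteDimensional ℝ E]
  [MeasurableSpace E] [BorelSpace E]

/-- The `L²` norm of a tempered distribution (`∞` if it is not an `L²` function). -/
def l2Norm (w : 𝓢'(E, ℂ)) : ℝ≥0∞ :=
  ⨅ (g : Lp ℂ 2 (volume : Measure E)) (_ : (g : 𝓢'(E, ℂ)) = w), ‖g‖ₑ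

/-- The tempered distribution `w` is the measurable function `v`. -/
def IsFunction (w : 𝓢'(E, ℂ)) (v : E → ℂ) : Prop :=
  AEStronglyMeasurable v volume ∧
    ∀ φ : 𝓢(E, ℂ), Integrable (fun x ↦ φ x * v x) volume ∧ w φ = ∫ x, φ x * v x

end Norms

/-- The norm of `H^s(ℝⁿ)`; `H^s` is the set of `f` with finite norm. -/
def sobolevNorm (s : ℝ) (f : 𝓢'(Space n, ℂ)) : ℝ≥0∞ := l2Norm (lam s f)

/-- The norm of the wave-Sobolev space `H^{s,θ}(ℝ^{1+n})`. -/
def waveSobolevNorm (s θ : ℝ) (u : 𝓢'(SpaceTime n, ℂ)) : ℝ≥0∞ := l2Norm (lamX s (lamMinus θ u))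

/-- The norm `‖u‖_{H^{s,θ}} + ‖∂_t u‖_{H^{s-1,θ}}` of `𝓗^{s,θ}`. -/
def calHNorm (s θ : ℝ) (u : 𝓢'(SpaceTime n, ℂ)) : ℝ≥0∞ :=
  waveSobolevNorm s θ u + waveSobolevNorm (s - 1) θ (∂_{point (n := n) 1 0} u)

/-- The norm of `L²_ξ(L^∞_τ)` of a distribution in the frequency variables
(`∞` if it is not a function). -/
def mixedNorm (w : 𝓢'(SpaceTime n, ℂ)) : ℝ≥0∞ :=
  ⨅ (v : SpaceTime n → ℂ) (_ : IsFunction w v),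
    (∫⁻ ξ : Space n, (eLpNorm (fun τ : ℝ ↦ v (point τ ξ)) ∞ volume) ^ 2) ^ (1 / 2 : ℝ)

/-! ### Curves in Sobolev spaces and the Cauchy problem -/

/-- `u ∈ C(ℝ, H^s)`. -/
def ContinuousSobolev (s : ℝ) (u : ℝ → 𝓢'(Space n, ℂ)) : Prop :=
  (∀ t, sobolevNorm s (u t) < ∞) ∧
    ∀ t₀, Tendsto (fun t ↦ sobolevNorm s (u t - u t₀)) (𝓝 t₀) (𝓝 0)

/-- `u'` is the derivative of the curve `u` in the norm of `H^s`. -/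
def HasSobolevDeriv (s : ℝ) (u u' : ℝ → 𝓢'(Space n, ℂ)) : Prop :=
  ∀ t₀, Tendsto (fun t ↦ sobolevNorm s (((t - t₀ : ℝ) : ℂ)⁻¹ • (u t - u t₀) - u' t₀))
    (𝓝[≠] t₀) (𝓝 0)

theorem hasTemperateGrowth_point (t : ℝ) :
    (fun x : Space n ↦ point t x).HasTemperateGrowth := by
  let iR : Space n →L[ℝ] SpaceTime n :=
    (WithLp.prodContinuousLinearEquiv 2 ℝ ℝ (Space n)).symm.toContinuousLinearMap ∘L
      ContinuousLinearMap.inr ℝ _ _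
  have h : (fun x : Space n ↦ point t 0 + iR x).HasTemperateGrowth :=
    (Function.HasTemperateGrowth.const _).add iR.hasTemperateGrowth
  refine (funext fun x ↦ ?_ : (fun x : Space n ↦ point t x) = _) ▸ h
  apply (WithLp.equiv 2 (ℝ × Space n)).injective
  simp [point, iR]

theorem antilipschitz_point (t : ℝ) : AntilipschitzWith 1 (fun x : Space n ↦ point t x) := by
  intro x y
  simp [point, edist_dist, WithLp.prod_dist_eq_of_L2]

/-- The restriction `ψ(t, ·)` of a Schwartz function on space-time to the time `t`. -/
def slice (t : ℝ) : 𝓢(SpaceTime n, ℂ) →L[ℂ] 𝓢(Space n, ℂ) :=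
  SchwartzMap.compCLMOfAntilipschitz ℂ (hasTemperateGrowth_point t) (antilipschitz_point t)

/-- The wave operator `□ = -∂_t² + Δ` on Schwartz functions on space-time. -/
def box (ψ : 𝓢(SpaceTime n, ℂ)) : 𝓢(SpaceTime n, ℂ) :=
  -(∂_{point (n := n) 1 0} (∂_{point (n := n) 1 0} ψ)) +
    ∑ i : Fin n, ∂_{point 0 (EuclideanSpace.single i (1 : ℝ))}
      (∂_{point 0 (EuclideanSpace.single i (1 : ℝ))} ψ)

/-- The curve `u` and the distribution `w` on space-time are the same distribution
on `ℝ^{1+n}`. -/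
def IsCurveOf (w : 𝓢'(SpaceTime n, ℂ)) (u : ℝ → 𝓢'(Space n, ℂ)) : Prop :=
  ∀ ψ : 𝓢(SpaceTime n, ℂ), HasCompactSupport ψ → ∫ t : ℝ, u t (slice t ψ) = w ψ

/-- `□u = F` in the sense of distributions on `ℝ^{1+n}`. -/
def SolvesWave (F : 𝓢'(SpaceTime n, ℂ)) (u : ℝ → 𝓢'(Space n, ℂ)) : Prop :=
  ∀ ψ : 𝓢(SpaceTime n, ℂ), HasCompactSupport ψ → ∫ t : ℝ, u t (slice t (box ψ)) = F ψ

/-- `u ∈ C(ℝ, H^s) ∩ C¹(ℝ, H^{s-1})` solves `□u = F` with `u = f` and `∂_t u = g` at `t = 0`. -/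
def SolvesCauchy (s : ℝ) (f g : 𝓢'(Space n, ℂ)) (F : 𝓢'(SpaceTime n, ℂ))
    (u : ℝ → 𝓢'(Space n, ℂ)) : Prop :=
  ContinuousSobolev s u ∧
    (∃ u' : ℝ → 𝓢'(Space n, ℂ), ContinuousSobolev (s - 1) u' ∧ HasSobolevDeriv (s - 1) u u' ∧
      u' 0 = g) ∧
    u 0 = f ∧ SolvesWave F u

/-! ### Spaces of space-time distributions

A space of tempered distributions on space-time with a norm of its own is given by a normed space
`X` and an injective linear map `ι` into the tempered distributions. -/

section Spaces

variable {X : Type*} [NormedAddCommGroup X] [NormedSpace ℂ X]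

/-- The norm of `X`, as a function on all tempered distributions (`∞` outside `X`). -/
def spaceNorm (ι : X →ₗ[ℂ] 𝓢'(SpaceTime n, ℂ)) (u : 𝓢'(SpaceTime n, ℂ)) : ℝ≥0∞ :=
  ⨅ (x : X) (_ : ι x = u), ‖x‖ₑ

/-- The norm of the restriction of `u` to `[0, T]` in the space of restrictions of elements of `X`:
the infimum of the norms of the elements of `X` that agree with `u` on `[0, T]` as curves in `H^s`
(`∞` if there are none). -/
def restrictionNorm (ι : X →ₗ[ℂ] 𝓢'(SpaceTime n, ℂ)) (s T : ℝ) (u : ℝ → 𝓢'(Space n, ℂ)) : ℝ≥0∞ :=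
  ⨅ (x : X) (_ : ∃ v : ℝ → 𝓢'(Space n, ℂ), ContinuousSobolev s v ∧ IsCurveOf (ι x) v ∧
    ∀ t ∈ Set.Icc 0 T, v t = u t), ‖x‖ₑ

/-- Continuous embedding of `X` in `𝓗^{s,θ}`. -/
def EmbedsInCalH (ι : X →ₗ[ℂ] 𝓢'(SpaceTime n, ℂ)) (s θ : ℝ) : Prop :=
  ∃ A : ℝ≥0, ∀ x : X, calHNorm s θ (ι x) ≤ A * ‖x‖ₑ

/-- `|û| ≤ |ŵ|` implies `‖u‖_X ≤ ‖w‖_X`; in particular `u ∈ X` if `w ∈ X`. -/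
def FourierMonotone (ι : X →ₗ[ℂ] 𝓢'(SpaceTime n, ℂ)) : Prop :=
  ∀ (u w : 𝓢'(SpaceTime n, ℂ)) (a b : SpaceTime n → ℂ), IsFunction (𝓕 u) a → IsFunction (𝓕 w) b →
    (∀ᵐ ζ, ‖a ζ‖ ≤ ‖b ζ‖) → spaceNorm ι u ≤ spaceNorm ι w

/-- `‖u‖_X ≲ ‖𝓕 Λ^{s-1} Λ₊ Λ₋^γ u‖_{L²_ξ(L^∞_τ)}` for all `u`; in particular `u ∈ X` if the
right-hand side is finite. -/
def MixedNormBound (ι : X →ₗ[ℂ] 𝓢'(SpaceTime n, ℂ)) (s γ : ℝ) : Prop :=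
  ∃ B : ℝ≥0, ∀ u : 𝓢'(SpaceTime n, ℂ),
    spaceNorm ι u ≤ B * mixedNorm (𝓕 (lamX (s - 1) (lamPlus 1 (lamMinus γ u))))

end Spaces

/-- The exponent `2 - γ - α/2 + min(0, α(θ + ε - 1))`. -/
def rateExponent (θ γ ε α : ℝ) : ℝ := 2 - γ - α / 2 + min 0 (α * (θ + ε - 1))

end WaveEstimate

end

noncomputable section

namespace WaveEstimate

variable {n : ℕ}

/-! ### Tempered distributions given by functions, and their Fourier transforms -/

section FunctionDistributions

variable {E : Type*} [NormedAddCommGroup E] [InnerProductSpace ℝ E] [FiniteDimensional ℝ E]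
  [MeasurableSpace E] [BorelSpace E]

/-! After the Fourier transform in x the Cauchy problem becomes the family of equations -y'' - r²y =
F̂(t, ξ) with r = |ξ|. Let F = □̃Λ₋^{-ε}w with w in the space, and let a be the space-time Fourier
transform of w, so that F has the transform Λ₊Λ₋^{1-ε}a (`forcing`). For a single time frequency λ
the forcing e^{iλt} with zero data has an explicit response, `duhamel`. The solution is cos(rt) f̂ +
(sin(rt)/r) ĝ plus the superposition of these responses over λ. Since θ > 1/2, Cauchy–Schwarz in τ
bounds the L¹ norm in τ of Λ₊a by the 𝓗^{s,θ} norm (`exists_weightedNorm_fiberMass_le`). The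
response gains ΛΛ₋ and its time derivative gains Λ₋, so the superposition converges in C(H^s) ∩
C¹(H^{s-1}) (`exists_superposition`, `exists_solvesCauchy`).

For uniqueness, a solution v of the homogeneous problem with zero data is paired with test functions
φ of bounded frequency. The pairing satisfies (vφ)'' = v(Δφ) in integrated form, and Δ is bounded on
such φ. Iteration from the trivial bound on vφ gains a factorial, so vφ = 0; these φ determine v
(`eq_zero_of_solvesWave`).

For the estimate, the forcing is split at Λ₋ = 2q with q = T^{-α}, and three pieces of the solution
on [0, T] are extended to all times within the space.

Far from the cone the symbol τ² - |ξ|² is comparable to Λ₊Λ₋. Dividing by it turns the far forcing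
into a function bounded by 2T^{αε}|a|, hence by monotonicity into an element of the space of norm at
most 2T^{αε}‖w‖ (`norm_farPart_le`). Its Cauchy data at t = 0 are removed by changing the data of
the free wave.

The free wave is multiplied by a cutoff in t. Its transform decays like the third power of the
distance to the cone, enough to absorb Λ₊Λ₋^γ in L^∞ in τ because γ ≤ 2 (`exists_localizedFree`).

Near the cone the response is multiplied by a cutoff at scale T. Rescaling to T = 1 shows that the
mixed norm is at most T^{2-γ} times the L¹ norm in τ of the near forcing (`exists_localizedForced`).
For fixed ξ this forcing lives on a set of τ of measure at most a multiple of q, so Cauchy–Schwarz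
costs q^{1/2}, and comparing Λ₋^{1-ε} with Λ₋^θ costs q^{max(0, 1-ε-θ)}
(`weightedNorm_nearPart_le`). Altogether this is T to the power `rateExponent`.

The exponent α is at one's disposal. The constant uses, for each ε, an α maximising min(αε, δ),
which gives the bound for all α at once; since γ < 2, a small positive α already makes this minimum
positive when ε > 0. The rescaling argument needs γ ≥ 0, which follows from the hypotheses
(`nonneg_of_mixedNormBound`). -/

theorem IsFunction.locallyIntegrable {w : 𝓢'(E, ℂ)} {a : E → ℂ} (h : IsFunction w a) :
    LocallyIntegrable a volume := by
  rw [locallyIntegrable_iff]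
  intro K hK
  obtain ⟨R, hR0, hR⟩ := hK.isBounded.subset_closedBall_lt 0 (0 : E)
  -- A test function equal to 1 on the compact set turns integrability against test functions into
  -- integrability there.
  let φ : ContDiffBump (0 : E) := ⟨R, R + 1, hR0, by linarith⟩
  have hc : HasCompactSupport (Complex.ofRealCLM ∘ φ) := φ.hasCompactSupport.comp_left rfl
  have hs : ContDiff ℝ ((⊤ : ℕ∞) : WithTop ℕ∞) (Complex.ofRealCLM ∘ φ) :=
    Complex.ofRealCLM.contDiff.comp φ.contDiff
  have := ((h.2 (hc.toSchwartzMap hs)).1).integrableOn (s := K)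
  refine this.congr_fun (fun x hx ↦ ?_) hK.measurableSet
  simp [φ.one_of_mem_closedBall (hR hx)]

theorem IsFunction.ae_eq {w : 𝓢'(E, ℂ)} {a b : E → ℂ} (ha : IsFunction w a)
    (hb : IsFunction w b) : a =ᵐ[volume] b := by
  refine ae_eq_of_integral_contDiff_smul_eq ha.locallyIntegrable hb.locallyIntegrable ?_
  intro g hg hgc
  have hc : HasCompactSupport (Complex.ofRealCLM ∘ g) := hgc.comp_left rfl
  have hs : ContDiff ℝ ((⊤ : ℕ∞) : WithTop ℕ∞) (Complex.ofRealCLM ∘ g) := Complex.ofRealCLM.contDiff.comp hg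
  have h1 := (ha.2 (hc.toSchwartzMap hs)).2
  have h2 := (hb.2 (hc.toSchwartzMap hs)).2
  rw [h1] at h2
  simpa using h2

theorem IsFunction.ext {w w' : 𝓢'(E, ℂ)} {a : E → ℂ} (h : IsFunction w a)
    (h' : IsFunction w' a) : w = w' := by
  ext φ
  rw [(h.2 φ).2, (h'.2 φ).2]

theorem IsFunction.congr {w : 𝓢'(E, ℂ)} {a b : E → ℂ} (h : IsFunction w a)
    (hab : a =ᵐ[volume] b) : IsFunction w b := by
  refine ⟨h.1.congr hab, fun φ ↦ ?_⟩
  have e : (fun x ↦ φ x * a x) =ᵐ[volume] fun x ↦ φ x * b x := by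
    filter_upwards [hab] with x hx
    rw [hx]
  exact ⟨(h.2 φ).1.congr e, (h.2 φ).2.trans (integral_congr_ae e)⟩

theorem IsFunction.add {w w' : 𝓢'(E, ℂ)} {a b : E → ℂ} (h : IsFunction w a)
    (h' : IsFunction w' b) : IsFunction (w + w') (fun x ↦ a x + b x) := by
  refine ⟨h.1.add h'.1, fun φ ↦ ?_⟩
  have := (h.2 φ).1.add (h'.2 φ).1
  simp only [mul_add]
  refine ⟨this, ?_⟩
  rw [integral_add (h.2 φ).1 (h'.2 φ).1, ← (h.2 φ).2, ← (h'.2 φ).2]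
  rfl

theorem IsFunction.smul {w : 𝓢'(E, ℂ)} {a : E → ℂ} (c : ℂ) (h : IsFunction w a) :
    IsFunction (c • w) (fun x ↦ c * a x) := by
  refine ⟨h.1.const_mul c, fun φ ↦ ?_⟩
  simp only [mul_left_comm _ c]
  refine ⟨(h.2 φ).1.const_mul c, ?_⟩
  rw [integral_const_mul, ← (h.2 φ).2]
  rfl

theorem IsFunction.smulLeft {w : 𝓢'(E, ℂ)} {a m : E → ℂ} (h : IsFunction w a)
    (hm : m.HasTemperateGrowth) :
    IsFunction (TemperedDistribution.smulLeftCLM ℂ m w) (fun x ↦ m x * a x) := by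
  refine ⟨hm.1.continuous.aestronglyMeasurable.mul h.1, fun φ ↦ ?_⟩
  have := h.2 (SchwartzMap.smulLeftCLM ℂ m φ)
  simp only [SchwartzMap.smulLeftCLM_apply_apply hm, smul_eq_mul] at this
  have e : (fun x ↦ φ x * (m x * a x)) = fun x ↦ m x * φ x * a x := by
    ext x; ring
  rw [e, TemperedDistribution.smulLeftCLM_apply_apply]
  exact this

theorem IsFunction.fourierMultiplier {w : 𝓢'(E, ℂ)} {a m : E → ℂ} (h : IsFunction (𝓕 w) a)
    (hm : m.HasTemperateGrowth) :
    IsFunction (𝓕 (TemperedDistribution.fourierMultiplierCLM ℂ m w)) (fun x ↦ m x * a x) := by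
  rw [TemperedDistribution.fourierMultiplierCLM_apply, FourierTransform.fourier_fourierInv_eq]
  exact h.smulLeft hm

theorem IsFunction.fourier_lineDeriv {w : 𝓢'(E, ℂ)} {a : E → ℂ} (h : IsFunction (𝓕 w) a) (m : E) :
    IsFunction (𝓕 (∂_{m} w))
      (fun x ↦ (2 * Real.pi * Complex.I) * (((inner ℝ x m : ℝ) : ℂ) * a x)) := by
  rw [TemperedDistribution.fourier_lineDerivOp_eq]
  exact (h.smulLeft (by fun_prop)).smul _

theorem IsFunction.fourier_add {w w' : 𝓢'(E, ℂ)} {a b : E → ℂ} (h : IsFunction (𝓕 w) a)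
    (h' : IsFunction (𝓕 w') b) : IsFunction (𝓕 (w + w')) (fun x ↦ a x + b x) := by
  rw [FourierTransform.fourier_add]
  exact h.add h'

theorem IsFunction.fourier_smul {w : 𝓢'(E, ℂ)} {a : E → ℂ} (c : ℂ) (h : IsFunction (𝓕 w) a) :
    IsFunction (𝓕 (c • w)) (fun x ↦ c * a x) := by
  rw [FourierTransform.fourier_smul]
  exact h.smul c

theorem IsFunction.fourier_sub {w w' : 𝓢'(E, ℂ)} {a b : E → ℂ} (h : IsFunction (𝓕 w) a)
    (h' : IsFunction (𝓕 w') b) : IsFunction (𝓕 (w - w')) (fun x ↦ a x - b x) := by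
  have := h.fourier_add (h'.fourier_smul (-1))
  simp only [neg_one_mul, ← sub_eq_add_neg] at this
  convert this using 1
  rw [neg_one_smul ℂ w', sub_eq_add_neg]

theorem IsFunction.fourier_ext {w w' : 𝓢'(E, ℂ)} {a b : E → ℂ} (h : IsFunction (𝓕 w) a)
    (h' : IsFunction (𝓕 w') b) (hab : a =ᵐ[volume] b) : w = w' := by
  have := (h.congr hab).ext h'
  have h2 : 𝓕⁻ (𝓕 w) = 𝓕⁻ (𝓕 w') := by rw [this]
  simpa using h2

theorem isFunction_of_Lp (g : Lp ℂ 2 (volume : Measure E)) :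
    IsFunction (g : 𝓢'(E, ℂ)) g := by
  refine ⟨Lp.aestronglyMeasurable g, fun φ ↦ ⟨?_, ?_⟩⟩
  · exact (φ.memLp 2).integrable_mul (Lp.memLp g)
  · simp

theorem isFunction_of_memLp {a : E → ℂ} (ha : MemLp a 2 volume) :
    IsFunction (ha.toLp a : 𝓢'(E, ℂ)) a :=
  (isFunction_of_Lp _).congr ha.coeFn_toLp

/-- A representing function is unique almost everywhere, so the infimum runs over at most one
element of L². If there is none, both sides are infinite. -/
theorem l2Norm_eq_eLpNorm {w : 𝓢'(E, ℂ)} {a : E → ℂ} (h : IsFunction w a) :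
    l2Norm w = eLpNorm a 2 volume := by
  apply le_antisymm
  · by_cases ha : MemLp a 2 volume
    · refine (iInf₂_le (ha.toLp a) ((isFunction_of_memLp ha).ext h)).trans ?_
      rw [Lp.enorm_toLp]
    · have : eLpNorm a 2 volume = ∞ := by
        by_contra hc
        exact ha ⟨h.1, lt_top_iff_ne_top.2 hc⟩
      simp [this]
  · refine le_iInf₂ fun g hg ↦ ?_
    have h1 : IsFunction w g := hg ▸ isFunction_of_Lp g
    rw [eLpNorm_congr_ae (h.ae_eq h1), Lp.enorm_def]

theorem exists_isFunction_of_l2Norm_lt_top {w : 𝓢'(E, ℂ)} (h : l2Norm w < ∞) :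
    ∃ a, IsFunction w a ∧ MemLp a 2 volume := by
  simp only [l2Norm, iInf_lt_iff] at h
  obtain ⟨g, hg, -⟩ := h
  exact ⟨g, hg ▸ isFunction_of_Lp g, Lp.memLp g⟩

theorem l2Norm_fourier (w : 𝓢'(E, ℂ)) : l2Norm (𝓕 w) = l2Norm w := by
  apply le_antisymm
  · refine le_iInf₂ fun g hg ↦ ?_
    refine (iInf₂_le (𝓕 g) (by rw [← Lp.fourier_toTemperedDistribution_eq, hg])).trans ?_
    rw [← ofReal_norm, ← ofReal_norm, Lp.norm_fourier_eq]
  · refine le_iInf₂ fun g hg ↦ ?_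
    refine (iInf₂_le (𝓕⁻ g) (by rw [← Lp.fourierInv_toTemperedDistribution_eq, hg,
      FourierTransform.fourierInv_fourier_eq])).trans ?_
    rw [← ofReal_norm, ← ofReal_norm, ← Lp.norm_fourier_eq (𝓕⁻ g),
      FourierTransform.fourier_fourierInv_eq]

theorem l2Norm_eq_of_fourier {w : 𝓢'(E, ℂ)} {a : E → ℂ} (h : IsFunction (𝓕 w) a) :
    l2Norm w = eLpNorm a 2 volume := by
  rw [← l2Norm_fourier, l2Norm_eq_eLpNorm h]

/-- A function that is in `L²` after multiplication with a weight of temperate growth whose inverse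
has temperate growth is the Fourier transform of a tempered distribution. -/
theorem exists_fourier_isFunction {m m' a : E → ℂ} (hm' : m'.HasTemperateGrowth)
    (hmm : ∀ x, m' x * m x = 1) (ha : MemLp (fun x ↦ m x * a x) 2 volume) :
    ∃ w : 𝓢'(E, ℂ), IsFunction (𝓕 w) a := by
  refine ⟨𝓕⁻ (TemperedDistribution.smulLeftCLM ℂ m' (ha.toLp _ : 𝓢'(E, ℂ))), ?_⟩
  rw [FourierTransform.fourier_fourierInv_eq]
  refine ((isFunction_of_memLp ha).smulLeft hm').congr (ae_of_all _ fun x ↦ ?_)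
  simp only
  rw [← mul_assoc, hmm, one_mul]

/-- The L² function produced by the multiplier is divided by the symbol; the inverse symbol has
temperate growth, so this is legitimate for distributions. Thus elements of all the spaces in
question have functions as Fourier transforms. -/
theorem exists_fourier_isFunction_of_multiplier {m m' : E → ℂ} (hm : m.HasTemperateGrowth)
    (hm' : m'.HasTemperateGrowth)
    (hmm : ∀ x, m' x * m x = 1) {w : 𝓢'(E, ℂ)}
    (h : l2Norm (TemperedDistribution.fourierMultiplierCLM ℂ m w) < ∞) :
    ∃ a, StronglyMeasurable a ∧ IsFunction (𝓕 w) a := by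
  rw [← l2Norm_fourier] at h
  obtain ⟨b, hb, -⟩ := exists_isFunction_of_l2Norm_lt_top h
  rw [TemperedDistribution.fourierMultiplierCLM_apply,
    FourierTransform.fourier_fourierInv_eq] at hb
  have h2 := hb.smulLeft hm'
  rw [TemperedDistribution.smulLeftCLM_smulLeftCLM_apply hm hm',
    show m * m' = fun _ ↦ 1 from funext fun x ↦ by rw [Pi.mul_apply, mul_comm, hmm]] at h2
  simp only [TemperedDistribution.smulLeftCLM_const, one_smul] at h2
  exact ⟨h2.1.mk, h2.1.stronglyMeasurable_mk, h2.congr h2.1.ae_eq_mk⟩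

theorem IsFunction.apply_eq {f : 𝓢'(E, ℂ)} {a : E → ℂ} (h : IsFunction (𝓕 f) a) (φ : 𝓢(E, ℂ)) :
    f φ = ∫ η, (𝓕⁻ φ) η * a η := by
  rw [← (h.2 (𝓕⁻ φ)).2, TemperedDistribution.fourier_apply,
    FourierTransform.fourier_fourierInv_eq]

end FunctionDistributions

/-! ### Elementary inequalities between the symbols -/

section Symbols

theorem symLam_pos (a : ℝ) (ξ : Space n) : 0 < symLam a ξ := by
  unfold symLam; positivity

theorem symPlus_pos (a τ : ℝ) (ξ : Space n) : 0 < symPlus a τ ξ := by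
  unfold symPlus; positivity

theorem symMinus_pos (a τ : ℝ) (ξ : Space n) : 0 < symMinus a τ ξ := by
  unfold symMinus; positivity

theorem symLam_mul (a b : ℝ) (ξ : Space n) : symLam a ξ * symLam b ξ = symLam (a + b) ξ := by
  unfold symLam
  rw [← Real.rpow_add (by positivity), add_div]

theorem symPlus_mul (a b τ : ℝ) (ξ : Space n) :
    symPlus a τ ξ * symPlus b τ ξ = symPlus (a + b) τ ξ := by
  unfold symPlus
  rw [← Real.rpow_add (by positivity), add_div]

theorem symMinus_mul (a b τ : ℝ) (ξ : Space n) :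
    symMinus a τ ξ * symMinus b τ ξ = symMinus (a + b) τ ξ := by
  unfold symMinus
  rw [← Real.rpow_add (by positivity), add_div]

@[simp] theorem symLam_zero (ξ : Space n) : symLam 0 ξ = 1 := by simp [symLam]

@[simp] theorem symPlus_zero (τ : ℝ) (ξ : Space n) : symPlus 0 τ ξ = 1 := by simp [symPlus]

@[simp] theorem symMinus_zero (τ : ℝ) (ξ : Space n) : symMinus 0 τ ξ = 1 := by simp [symMinus]

theorem symLam_two (ξ : Space n) : symLam 2 ξ = 1 + ‖ξ‖ ^ 2 := by simp [symLam]

theorem symPlus_two (τ : ℝ) (ξ : Space n) : symPlus 2 τ ξ = 1 + τ ^ 2 + ‖ξ‖ ^ 2 := by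
  simp [symPlus]

theorem symMinus_two (τ : ℝ) (ξ : Space n) :
    symMinus 2 τ ξ = 1 + (τ ^ 2 - ‖ξ‖ ^ 2) ^ 2 / (1 + τ ^ 2 + ‖ξ‖ ^ 2) := by
  simp [symMinus]

theorem symLam_one_sq (ξ : Space n) : symLam 1 ξ ^ 2 = 1 + ‖ξ‖ ^ 2 := by
  rw [sq, symLam_mul, one_add_one_eq_two, symLam_two]

theorem symPlus_one_sq (τ : ℝ) (ξ : Space n) : symPlus 1 τ ξ ^ 2 = 1 + τ ^ 2 + ‖ξ‖ ^ 2 := by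
  rw [sq, symPlus_mul, one_add_one_eq_two, symPlus_two]

theorem symMinus_one_sq (τ : ℝ) (ξ : Space n) : symMinus 1 τ ξ ^ 2 =
    1 + (τ ^ 2 - ‖ξ‖ ^ 2) ^ 2 / (1 + τ ^ 2 + ‖ξ‖ ^ 2) := by
  rw [sq, symMinus_mul, one_add_one_eq_two, symMinus_two]

theorem symMinus_mono {a b : ℝ} (hab : a ≤ b) (τ : ℝ) (ξ : Space n) :
    symMinus a τ ξ ≤ symMinus b τ ξ := by
  unfold symMinus
  apply Real.rpow_le_rpow_of_exponent_le
  · have : 0 ≤ (τ ^ 2 - ‖ξ‖ ^ 2) ^ 2 / (1 + τ ^ 2 + ‖ξ‖ ^ 2) := by positivity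
    linarith
  · linarith

theorem one_le_symMinus {a : ℝ} (ha : 0 ≤ a) (τ : ℝ) (ξ : Space n) : 1 ≤ symMinus a τ ξ := by
  simpa using symMinus_mono ha τ ξ

theorem symMinus_eq_rpow (a τ : ℝ) (ξ : Space n) : symMinus a τ ξ = symMinus 1 τ ξ ^ a := by
  unfold symMinus
  rw [← Real.rpow_mul (by positivity)]
  ring_nf

theorem one_le_symLam_one (ξ : Space n) : 1 ≤ symLam 1 ξ := by
  have := symLam_one_sq ξ
  nlinarith [symLam_pos 1 ξ, sq_nonneg ‖ξ‖]

theorem norm_le_symLam_one (ξ : Space n) : ‖ξ‖ ≤ symLam 1 ξ := by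
  have := symLam_one_sq ξ
  exact abs_le_of_sq_le_sq' (by linarith) (symLam_pos 1 ξ).le |>.2

theorem symLam_one_le (ξ : Space n) : symLam 1 ξ ≤ 1 + ‖ξ‖ := by
  have := symLam_one_sq ξ
  exact abs_le_of_sq_le_sq' (by nlinarith [norm_nonneg ξ]) (by positivity) |>.2

theorem symLam_one_le_symPlus_one (τ : ℝ) (ξ : Space n) : symLam 1 ξ ≤ symPlus 1 τ ξ := by
  have h1 := symLam_one_sq ξ
  have h2 := symPlus_one_sq τ ξ
  exact abs_le_of_sq_le_sq' (by nlinarith [sq_nonneg τ]) (symPlus_pos 1 τ ξ).le |>.2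

theorem abs_le_symPlus_one (τ : ℝ) (ξ : Space n) : |τ| ≤ symPlus 1 τ ξ := by
  have h2 := symPlus_one_sq τ ξ
  exact abs_le_of_sq_le_sq (by nlinarith [sq_nonneg ‖ξ‖]) (symPlus_pos 1 τ ξ).le

theorem symPlus_one_le_symLam_add (τ : ℝ) (ξ : Space n) :
    symPlus 1 τ ξ ≤ symLam 1 ξ + |τ| := by
  have h1 := symLam_one_sq ξ
  have h2 := symPlus_one_sq τ ξ
  have h3 := symLam_pos 1 ξ
  refine abs_le_of_sq_le_sq' ?_ (by positivity) |>.2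
  nlinarith [abs_nonneg τ, sq_abs τ, mul_nonneg h3.le (abs_nonneg τ)]

theorem symPlus_one_le (τ : ℝ) (ξ : Space n) : symPlus 1 τ ξ ≤ 1 + |τ| + ‖ξ‖ := by
  linarith [symPlus_one_le_symLam_add τ ξ, symLam_one_le ξ]

theorem sq_sub_sq_eq (τ r : ℝ) : (τ ^ 2 - r ^ 2) ^ 2 = (|τ| - r) ^ 2 * (|τ| + r) ^ 2 := by
  rw [← sq_abs τ]; ring

/-- Factor τ² - |ξ|² as (|τ| - |ξ|)(|τ| + |ξ|): the second factor is controlled by Λ₊. Together with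
`sq_sub_le_symMinus_two` this says that Λ₋ has the size of 1 plus the distance to the light cone. -/
theorem symMinus_two_le (τ : ℝ) (ξ : Space n) : symMinus 2 τ ξ ≤ 1 + 2 * (|τ| - ‖ξ‖) ^ 2 := by
  rw [symMinus_two, sq_sub_sq_eq]
  gcongr
  rw [div_le_iff₀ (by positivity)]
  have h : (|τ| + ‖ξ‖) ^ 2 ≤ 2 * (1 + τ ^ 2 + ‖ξ‖ ^ 2) := by
    rw [← sq_abs τ]; nlinarith [sq_nonneg (|τ| - ‖ξ‖)]
  nlinarith [sq_nonneg (|τ| - ‖ξ‖)]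

theorem sq_sub_le_symMinus_two (τ : ℝ) (ξ : Space n) :
    (|τ| - ‖ξ‖) ^ 2 ≤ 2 * symMinus 2 τ ξ := by
  rw [symMinus_two, sq_sub_sq_eq, mul_add, mul_one, ← sub_le_iff_le_add', ← mul_div_assoc,
    le_div_iff₀ (by positivity)]
  set d := (|τ| - ‖ξ‖) ^ 2
  have h1 : τ ^ 2 + ‖ξ‖ ^ 2 ≤ (|τ| + ‖ξ‖) ^ 2 := by
    rw [← sq_abs τ]; nlinarith [abs_nonneg τ, norm_nonneg ξ]
  have h2 : d ≤ τ ^ 2 + ‖ξ‖ ^ 2 := by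
    simp only [d]; rw [← sq_abs τ]; nlinarith [abs_nonneg τ, norm_nonneg ξ]
  have h3 : 0 ≤ d := sq_nonneg _
  nlinarith [mul_le_mul_of_nonneg_left h1 h3]

/-- The constant 3/2 is a rational majorant of √2. -/
theorem abs_sub_le_symMinus_one (τ : ℝ) (ξ : Space n) :
    |(|τ| - ‖ξ‖)| ≤ (3 / 2) * symMinus 1 τ ξ := by
  have h := sq_sub_le_symMinus_two τ ξ
  have h2 : symMinus 2 τ ξ = symMinus 1 τ ξ * symMinus 1 τ ξ := by
    rw [symMinus_mul, one_add_one_eq_two]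
  rw [h2] at h
  exact abs_le_of_sq_le_sq (by nlinarith [symMinus_pos 1 τ ξ]) (by linarith [symMinus_pos 1 τ ξ])

theorem symMinus_neg_le {θ : ℝ} (hθ : 0 ≤ θ) (τ : ℝ) (ξ : Space n) :
    symMinus (-(2 * θ)) τ ξ ≤ 3 ^ θ * (1 + (|τ| - ‖ξ‖) ^ 2) ^ (-θ) := by
  have h : 1 + (|τ| - ‖ξ‖) ^ 2 ≤ 3 * symMinus 2 τ ξ := by
    linarith [sq_sub_le_symMinus_two τ ξ, one_le_symMinus (a := 2) (by norm_num) τ ξ]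
  have h2 : symMinus (-(2 * θ)) τ ξ = (symMinus 2 τ ξ) ^ (-θ) := by
    rw [symMinus_eq_rpow, symMinus_eq_rpow 2, ← Real.rpow_mul (symMinus_pos 1 τ ξ).le]
    ring_nf
  have h3 := symMinus_pos 2 τ ξ
  have h4 : 0 < 1 + (|τ| - ‖ξ‖) ^ 2 := by positivity
  rw [h2, Real.rpow_neg h3.le, Real.rpow_neg h4.le, ← div_eq_mul_inv, inv_eq_one_div,
    div_le_div_iff₀ (by positivity) (by positivity), one_mul, ← Real.mul_rpow (by norm_num) h3.le]
  exact Real.rpow_le_rpow h4.le h hθ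

/-- By definition (τ² - |ξ|²)² = (Λ₋² - 1)Λ₊², and the 1 is harmless once Λ₋ ≥ 2. So □ and □̃ are
comparable away from the cone. -/
theorem mul_le_abs_sq_sub_sq {τ : ℝ} {ξ : Space n} (h : 2 ≤ symMinus 1 τ ξ) :
    symPlus 1 τ ξ * symMinus 1 τ ξ ≤ 2 * |τ ^ 2 - ‖ξ‖ ^ 2| := by
  have h1 := symMinus_one_sq τ ξ
  have h2 := symPlus_one_sq τ ξ
  have hp := symPlus_pos 1 τ ξ
  have h3 : (τ ^ 2 - ‖ξ‖ ^ 2) ^ 2 = (symMinus 1 τ ξ ^ 2 - 1) * symPlus 1 τ ξ ^ 2 := by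
    rw [h1, h2]
    field_simp
    ring
  rw [← abs_of_pos (mul_pos hp (symMinus_pos 1 τ ξ)), ← abs_two, ← abs_mul]
  apply sq_le_sq.1
  rw [mul_pow, mul_pow, h3]
  have : 4 ≤ symMinus 1 τ ξ ^ 2 := by nlinarith
  nlinarith [sq_nonneg (symPlus 1 τ ξ)]

@[fun_prop]
theorem measurable_symLam {α : Type*} [MeasurableSpace α] {f : α → Space n} (hf : Measurable f)
    (a : ℝ) : Measurable (fun x ↦ symLam a (f x)) := by
  unfold symLam
  fun_prop

@[fun_prop]
theorem measurable_symPlus {α : Type*} [MeasurableSpace α] {g : α → ℝ} {f : α → Space n}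
    (hg : Measurable g) (hf : Measurable f) (a : ℝ) :
    Measurable (fun x ↦ symPlus a (g x) (f x)) := by
  unfold symPlus
  fun_prop

@[fun_prop]
theorem measurable_symMinus {α : Type*} [MeasurableSpace α] {g : α → ℝ} {f : α → Space n}
    (hg : Measurable g) (hf : Measurable f) (a : ℝ) :
    Measurable (fun x ↦ symMinus a (g x) (f x)) := by
  unfold symMinus
  fun_prop

/-- Λ₋^{-2θ} is bounded by two translates, centred on the two branches of the cone, of one function
that is integrable because 2θ > 1. Translation invariance makes the bound uniform in ξ. -/
theorem exists_lintegral_symMinus_le {θ : ℝ} (hθ : 1 / 2 < θ) :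
    ∃ C : ℝ≥0, ∀ ξ : Space n,
      ∫⁻ τ : ℝ, ENNReal.ofReal (symMinus (-(2 * θ)) (2 * Real.pi * τ) ξ) ≤ C := by
  have hint : Integrable (fun τ : ℝ ↦ (1 + ‖τ‖ ^ 2) ^ (-(2 * θ) / 2)) :=
    integrable_rpow_neg_one_add_norm_sq (by simp; linarith)
  set I := ∫⁻ τ : ℝ, ENNReal.ofReal ((1 + ‖τ‖ ^ 2) ^ (-(2 * θ) / 2)) with hI
  have hIfin : I ≠ ∞ := hint.lintegral_lt_top.ne
  have hfin : ENNReal.ofReal (3 ^ θ) * (I + I) ≠ ∞ := by finiteness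
  refine ⟨(ENNReal.ofReal (3 ^ θ) * (I + I)).toNNReal, fun ξ ↦ ?_⟩
  rw [ENNReal.coe_toNNReal hfin]
  set ρ := ‖ξ‖ / (2 * Real.pi) with hρ
  have key : ∀ τ : ℝ, ENNReal.ofReal (symMinus (-(2 * θ)) (2 * Real.pi * τ) ξ) ≤
      ENNReal.ofReal (3 ^ θ) * (ENNReal.ofReal ((1 + ‖τ - ρ‖ ^ 2) ^ (-(2 * θ) / 2)) +
        ENNReal.ofReal ((1 + ‖τ + ρ‖ ^ 2) ^ (-(2 * θ) / 2))) := by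
    intro τ
    rw [← ENNReal.ofReal_add (by positivity) (by positivity),
      ← ENNReal.ofReal_mul (by positivity)]
    apply ENNReal.ofReal_le_ofReal
    refine (symMinus_neg_le (by linarith) _ _).trans ?_
    gcongr
    have hpi : 1 ≤ 2 * Real.pi := by linarith [Real.pi_gt_three]
    have e1 : ‖ξ‖ = 2 * Real.pi * ρ := by rw [hρ]; field_simp
    have hm : ∀ x : ℝ, (1 + (2 * Real.pi * x) ^ 2) ^ (-θ) ≤ (1 + ‖x‖ ^ 2) ^ (-(2 * θ) / 2) := by
      intro x
      rw [neg_div, mul_div_cancel_left₀ _ two_ne_zero, Real.norm_eq_abs, sq_abs]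
      apply Real.rpow_le_rpow_of_nonpos (by positivity) _ (by linarith)
      rw [mul_pow]
      have : 1 ≤ (2 * Real.pi) ^ 2 := one_le_pow₀ hpi
      nlinarith [sq_nonneg x]
    rcases le_total 0 τ with h | h
    · rw [abs_of_nonneg (by positivity), e1, ← mul_sub]
      exact (hm _).trans (le_add_of_nonneg_right (by positivity))
    · rw [abs_of_nonpos (mul_nonpos_of_nonneg_of_nonpos (by positivity) h), e1,
        show -(2 * Real.pi * τ) - 2 * Real.pi * ρ = -(2 * Real.pi * (τ + ρ)) by ring, neg_sq]
      exact (hm _).trans (le_add_of_nonneg_left (by positivity))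
  refine (lintegral_mono key).trans ?_
  rw [lintegral_const_mul _ (by fun_prop), lintegral_add_left (by fun_prop),
    lintegral_sub_right_eq_self (fun τ : ℝ ↦ ENNReal.ofReal ((1 + ‖τ‖ ^ 2) ^ (-(2 * θ) / 2))) ρ,
    lintegral_add_right_eq_self (fun τ : ℝ ↦ ENNReal.ofReal ((1 + ‖τ‖ ^ 2) ^ (-(2 * θ) / 2))) ρ]

end Symbols

/-! ### Sobolev norms as weighted L² norms in frequency -/

section WeightedNorm

/-- The `L²` norm of `H` with the weight of `H^s` on the Fourier side. -/
def weightedNorm (s : ℝ) (H : Space n → ℝ≥0∞) : ℝ≥0∞ :=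
  (∫⁻ η, (ENNReal.ofReal (symLam s ((2 * Real.pi) • η)) * H η) ^ (2 : ℝ)) ^ (1 / 2 : ℝ)

theorem eLpNorm_two_eq {α ε : Type*} [MeasurableSpace α] {μ : Measure α} [ENorm ε] (f : α → ε) :
    eLpNorm f 2 μ = (∫⁻ x, ‖f x‖ₑ ^ (2 : ℝ) ∂μ) ^ (1 / 2 : ℝ) := by
  rw [eLpNorm_eq_lintegral_rpow_enorm_toReal (by norm_num) (by norm_num)]
  simp

theorem weightedNorm_mono {s : ℝ} {H H' : Space n → ℝ≥0∞} (h : ∀ᵐ η, H η ≤ H' η) :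
    weightedNorm s H ≤ weightedNorm s H' := by
  unfold weightedNorm
  refine ENNReal.rpow_le_rpow (lintegral_mono_ae ?_) (by norm_num)
  filter_upwards [h] with η hη
  gcongr

theorem weightedNorm_const_mul (s : ℝ) {c : ℝ≥0∞} (hc : c ≠ ∞) (H : Space n → ℝ≥0∞) :
    weightedNorm s (fun η ↦ c * H η) = c * weightedNorm s H := by
  unfold weightedNorm
  simp_rw [mul_left_comm _ c]
  simp_rw [ENNReal.mul_rpow_of_nonneg c _ (zero_le_two (α := ℝ))]
  rw [lintegral_const_mul' _ _ (by finiteness), ENNReal.mul_rpow_of_nonneg _ _ (by norm_num),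
    ← ENNReal.rpow_mul]
  simp

theorem weightedNorm_add_le (s : ℝ) {H H' : Space n → ℝ≥0∞} (h : AEMeasurable H)
    (h' : AEMeasurable H') :
    weightedNorm s (fun η ↦ H η + H' η) ≤ weightedNorm s H + weightedNorm s H' := by
  unfold weightedNorm
  simp_rw [mul_add]
  exact ENNReal.lintegral_Lp_add_le (by fun_prop) (by fun_prop) (by norm_num)

theorem weightedNorm_symLam_mul (s b : ℝ) (H : Space n → ℝ≥0∞) :
    weightedNorm s (fun η ↦ ENNReal.ofReal (symLam b ((2 * Real.pi) • η)) * H η) =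
      weightedNorm (s + b) H := by
  unfold weightedNorm
  simp_rw [← mul_assoc, ← ENNReal.ofReal_mul (symLam_pos s _).le, symLam_mul]

theorem ae_lt_top_of_weightedNorm {s : ℝ} {H : Space n → ℝ≥0∞} (hm : AEMeasurable H)
    (h : weightedNorm s H < ∞) : ∀ᵐ η, H η < ∞ := by
  have h1 : ∫⁻ η, (ENNReal.ofReal (symLam s ((2 * Real.pi) • η)) * H η) ^ (2 : ℝ) ≠ ∞ := by
    intro h2
    rw [weightedNorm, h2, ENNReal.top_rpow_of_pos (by norm_num)] at h
    exact h.ne rfl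
  filter_upwards [ae_lt_top' (by fun_prop) h1] with η hη
  have h3 : ENNReal.ofReal (symLam s ((2 * Real.pi) • η)) * H η ≠ ∞ := by
    intro h4
    simp [h4] at hη
  by_contra h5
  rw [not_lt, top_le_iff] at h5
  exact h3 (by rw [h5, ENNReal.mul_top]; simpa using symLam_pos s _)

theorem enorm_ofReal_mul {c : ℝ} (hc : 0 ≤ c) (z : ℂ) :
    ‖(c : ℂ) * z‖ₑ = ENNReal.ofReal c * ‖z‖ₑ := by
  rw [enorm_mul, ← ofReal_norm, Complex.norm_real, Real.norm_of_nonneg hc]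

theorem sobolevNorm_eq {f : 𝓢'(Space n, ℂ)} {a : Space n → ℂ} (h : IsFunction (𝓕 f) a) (s : ℝ) :
    sobolevNorm s f = weightedNorm s (fun η ↦ ‖a η‖ₑ) := by
  have h1 := h.fourierMultiplier (hasTemperateGrowth_symLam (n := n) s)
  rw [sobolevNorm, lam, l2Norm_eq_of_fourier h1, eLpNorm_two_eq]
  simp_rw [enorm_ofReal_mul (symLam_pos s _).le]
  rfl

theorem exists_isFunction_of_sobolevNorm {s : ℝ} {f : 𝓢'(Space n, ℂ)}
    (h : sobolevNorm s f < ∞) : ∃ a, StronglyMeasurable a ∧ IsFunction (𝓕 f) a := by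
  refine exists_fourier_isFunction_of_multiplier (hasTemperateGrowth_symLam s)
    (hasTemperateGrowth_symLam (-s)) (fun x ↦ ?_) h
  rw [← Complex.ofReal_mul, symLam_mul]
  simp

theorem exists_of_weightedNorm {s : ℝ} {a : Space n → ℂ} (ha : AEStronglyMeasurable a volume)
    (h : weightedNorm s (fun η ↦ ‖a η‖ₑ) < ∞) : ∃ f : 𝓢'(Space n, ℂ), IsFunction (𝓕 f) a := by
  refine exists_fourier_isFunction (hasTemperateGrowth_symLam (-s))
    (m := fun η ↦ ((symLam s ((2 * Real.pi) • η) : ℝ) : ℂ)) (fun x ↦ ?_) ⟨?_, ?_⟩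
  · rw [← Complex.ofReal_mul, symLam_mul]
    simp
  · exact (hasTemperateGrowth_symLam s).1.continuous.aestronglyMeasurable.mul ha
  · rw [eLpNorm_two_eq]
    simp_rw [enorm_ofReal_mul (symLam_pos s _).le]
    exact h

end WeightedNorm

/-! ### Fubini's theorem on space-time -/

section SpaceTimeIntegral

theorem measurePreserving_toLp : MeasurePreserving
    (WithLp.toLp 2 : ℝ × Space n → SpaceTime n) volume volume :=
  WithLp.volume_preserving_toLp ℝ (Space n)

theorem measurable_point : Measurable (fun p : ℝ × Space n ↦ point p.1 p.2) :=
  measurePreserving_toLp.measurable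

@[fun_prop]
theorem measurable_point_comp {α : Type*} [MeasurableSpace α] {g : α → ℝ} {f : α → Space n}
    (hg : Measurable g) (hf : Measurable f) : Measurable (fun x ↦ point (g x) (f x)) :=
  measurable_point.comp (hg.prodMk hf)

theorem measurable_fst_spaceTime : Measurable (fun ζ : SpaceTime n ↦ ζ.fst) :=
  (WithLp.fstL 2 ℝ ℝ (Space n)).continuous.measurable

theorem measurable_snd_spaceTime : Measurable (fun ζ : SpaceTime n ↦ ζ.snd) :=
  (WithLp.sndL 2 ℝ ℝ (Space n)).continuous.measurable

@[simp] theorem point_fst (t : ℝ) (x : Space n) : (point t x).fst = t := rfl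

@[simp] theorem point_snd (t : ℝ) (x : Space n) : (point t x).snd = x := rfl

theorem point_fst_snd (ζ : SpaceTime n) : point ζ.fst ζ.snd = ζ := rfl

theorem lintegral_spaceTime {f : SpaceTime n → ℝ≥0∞} (hf : Measurable f) :
    ∫⁻ ζ, f ζ = ∫⁻ η : Space n, ∫⁻ τ : ℝ, f (point τ η) := by
  rw [← measurePreserving_toLp.lintegral_comp hf, Measure.volume_eq_prod]
  exact lintegral_prod_symm' _ (hf.comp measurable_point)

theorem integrable_spaceTime_iff {f : SpaceTime n → ℂ} :
    Integrable f ↔ Integrable (fun p : ℝ × Space n ↦ f (point p.1 p.2))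
      ((volume : Measure ℝ).prod (volume : Measure (Space n))) := by
  rw [← Measure.volume_eq_prod]
  exact (measurePreserving_toLp.integrable_comp_emb
    (MeasurableEquiv.toLp 2 (ℝ × Space n)).measurableEmbedding).symm

theorem integral_spaceTime {f : SpaceTime n → ℂ} (hf : Integrable f) :
    ∫ ζ, f ζ = ∫ η : Space n, ∫ τ : ℝ, f (point τ η) := by
  rw [← measurePreserving_toLp.integral_comp
    (MeasurableEquiv.toLp 2 (ℝ × Space n)).measurableEmbedding, Measure.volume_eq_prod]
  exact integral_prod_symm _ (integrable_spaceTime_iff.1 hf)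

end SpaceTimeIntegral

/-! ### From the energy norm to L¹ in the time frequency -/

section FiberMass

/-- The `L¹` norm in `τ` with the weight `Λ₊`. -/
def fiberMass (a : SpaceTime n → ℂ) (η : Space n) : ℝ≥0∞ :=
  ∫⁻ τ : ℝ, ENNReal.ofReal (symPlus 1 (2 * Real.pi * τ) ((2 * Real.pi) • η)) * ‖a (point τ η)‖ₑ

/-- The norm of `𝓗^{s,θ}` on the Fourier side. -/
def energyNorm (s θ : ℝ) (a : SpaceTime n → ℂ) : ℝ≥0∞ :=
  (∫⁻ ζ : SpaceTime n, (ENNReal.ofReal (symLam (s - 1) ((2 * Real.pi) • ζ.snd) *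
    symPlus 1 (2 * Real.pi * ζ.fst) ((2 * Real.pi) • ζ.snd) *
    symMinus θ (2 * Real.pi * ζ.fst) ((2 * Real.pi) • ζ.snd)) * ‖a ζ‖ₑ) ^ (2 : ℝ)) ^ (1 / 2 : ℝ)

theorem measurable_fiberMass {a : SpaceTime n → ℂ} (ha : Measurable a) :
    Measurable (fiberMass a) := by
  unfold fiberMass
  exact Measurable.lintegral_prod_right' (f := fun p : Space n × ℝ ↦
    ENNReal.ofReal (symPlus 1 (2 * Real.pi * p.2) ((2 * Real.pi) • p.1)) * ‖a (point p.2 p.1)‖ₑ)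
    (by fun_prop)

theorem exists_isFunction_of_calHNorm {s θ : ℝ} {u : 𝓢'(SpaceTime n, ℂ)}
    (h : calHNorm s θ u < ∞) : ∃ a, StronglyMeasurable a ∧ IsFunction (𝓕 u) a := by
  have h1 : waveSobolevNorm s θ u < ∞ := lt_of_le_of_lt le_self_add h
  rw [waveSobolevNorm, lamX, lamMinus,
    TemperedDistribution.fourierMultiplierCLM_fourierMultiplierCLM_apply
    (hasTemperateGrowth_symMinus θ) (hasTemperateGrowth_symLamX s)] at h1
  refine exists_fourier_isFunction_of_multiplier
    ((hasTemperateGrowth_symMinus θ).mul (hasTemperateGrowth_symLamX s))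
    ((hasTemperateGrowth_symMinus (-θ)).mul (hasTemperateGrowth_symLamX (-s))) (fun ζ ↦ ?_) h1
  simp only [Pi.mul_apply]
  rw [mul_mul_mul_comm, ← Complex.ofReal_mul, ← Complex.ofReal_mul, symLam_mul, symMinus_mul]
  simp

theorem energyNorm_le_calHNorm {s θ : ℝ} {u : 𝓢'(SpaceTime n, ℂ)} {a : SpaceTime n → ℂ}
    (ha : Measurable a) (h : IsFunction (𝓕 u) a) : energyNorm s θ a ≤ calHNorm s θ u := by
  have h1 := (h.fourierMultiplier (hasTemperateGrowth_symMinus θ)).fourierMultiplier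
    (hasTemperateGrowth_symLamX s)
  have h2 := ((h.fourier_lineDeriv (point 1 0)).fourierMultiplier
    (hasTemperateGrowth_symMinus θ)).fourierMultiplier (hasTemperateGrowth_symLamX (s - 1))
  rw [calHNorm, waveSobolevNorm, waveSobolevNorm]
  simp only [lamX, lamMinus]
  rw [l2Norm_eq_of_fourier h1, l2Norm_eq_of_fourier h2, eLpNorm_two_eq, eLpNorm_two_eq]
  have hm1 := measurable_fst_spaceTime (n := n)
  have hm2 := measurable_snd_spaceTime (n := n)
  -- Minkowski's inequality joins the two L² norms, since Λ₊ ≤ Λ + |τ| pointwise and |τ| is the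
  -- symbol of ∂_t up to a phase.
  refine le_trans ?_ (ENNReal.lintegral_Lp_add_le (by fun_prop)
    (by have : Continuous (fun x : SpaceTime n ↦ (inner ℝ x (point 1 0) : ℝ)) := by fun_prop
        fun_prop) (by norm_num))
  unfold energyNorm
  gcongr with ζ
  simp only [Pi.add_apply, enorm_ofReal_mul (symLam_pos _ _).le,
    enorm_ofReal_mul (symMinus_pos _ _ _).le]
  have e : ‖(2 * Real.pi * Complex.I) * (((inner ℝ ζ (point 1 0) : ℝ) : ℂ) * a ζ)‖ₑ =
      ENNReal.ofReal |2 * Real.pi * ζ.fst| * ‖a ζ‖ₑ := by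
    have : (inner ℝ ζ (point 1 0) : ℝ) = ζ.fst := by
      simp [WithLp.prod_inner_apply, point]
    rw [this, ← mul_assoc, enorm_mul, ← ofReal_norm (2 * Real.pi * Complex.I * _)]
    simp [abs_mul, abs_of_pos Real.pi_pos]
  rw [e, ← mul_assoc, ← mul_assoc, ← mul_assoc, ← add_mul]
  gcongr
  rw [← ENNReal.ofReal_mul (symLam_pos _ _).le, ← ENNReal.ofReal_mul (symLam_pos _ _).le,
    ← ENNReal.ofReal_mul (mul_pos (symLam_pos _ _) (symMinus_pos _ _ _)).le,
    ← ENNReal.ofReal_add (mul_pos (symLam_pos _ _) (symMinus_pos _ _ _)).le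
      (mul_nonneg (mul_pos (symLam_pos _ _) (symMinus_pos _ _ _)).le (abs_nonneg _))]
  apply ENNReal.ofReal_le_ofReal
  set ξ := (2 * Real.pi) • ζ.snd
  set τ := 2 * Real.pi * ζ.fst
  have e1 : symLam s ξ = symLam (s - 1) ξ * symLam 1 ξ := by
    rw [symLam_mul]; ring_nf
  have := mul_le_mul_of_nonneg_left (symPlus_one_le_symLam_add τ ξ)
    (mul_pos (symLam_pos (s - 1) ξ) (symMinus_pos θ τ ξ)).le
  rw [e1]
  linarith

theorem lintegral_sq_rpow_half (c : ℝ≥0∞) : (c ^ (2 : ℝ)) ^ (1 / 2 : ℝ) = c := by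
  rw [← ENNReal.rpow_mul]; simp

/-- Insert Λ₋^{-θ}Λ₋^θ and apply Cauchy–Schwarz in τ; the first factor is square integrable
uniformly in ξ because θ > 1/2. -/
theorem exists_weightedNorm_fiberMass_le (n : ℕ) {θ : ℝ} (hθ : 1 / 2 < θ) :
    ∃ C : ℝ≥0, ∀ (s : ℝ) (a : SpaceTime n → ℂ), Measurable a →
      weightedNorm (s - 1) (fiberMass a) ≤ C * energyNorm s θ a := by
  obtain ⟨C, hC⟩ := exists_lintegral_symMinus_le (n := n) hθ
  refine ⟨C ^ (1 / 2 : ℝ), fun s a ha ↦ ?_⟩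
  have hm1 := measurable_fst_spaceTime (n := n)
  have hm2 := measurable_snd_spaceTime (n := n)
  rw [weightedNorm, energyNorm, lintegral_spaceTime (by fun_prop), ENNReal.coe_rpow_of_nonneg _
    (by norm_num), ← ENNReal.mul_rpow_of_nonneg _ _ (by norm_num)]
  gcongr
  rw [← lintegral_const_mul' _ _ ENNReal.coe_ne_top]
  gcongr with η
  set L := ENNReal.ofReal (symLam (s - 1) ((2 * Real.pi) • η)) with hL
  have hf : L * fiberMass a η = ∫⁻ τ : ℝ,
      ENNReal.ofReal (symMinus (-θ) (2 * Real.pi * τ) ((2 * Real.pi) • η)) *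
      (ENNReal.ofReal (symLam (s - 1) ((2 * Real.pi) • η) *
        symPlus 1 (2 * Real.pi * τ) ((2 * Real.pi) • η) *
        symMinus θ (2 * Real.pi * τ) ((2 * Real.pi) • η)) * ‖a (point τ η)‖ₑ) := by
    rw [fiberMass, ← lintegral_const_mul' _ _ ENNReal.ofReal_ne_top]
    congr 1 with τ
    rw [← mul_assoc, ← mul_assoc, ← ENNReal.ofReal_mul (symLam_pos _ _).le,
      ← ENNReal.ofReal_mul (symMinus_pos _ _ _).le]
    congr 2
    have : symMinus (-θ) (2 * Real.pi * τ) ((2 * Real.pi) • η) *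
      symMinus θ (2 * Real.pi * τ) ((2 * Real.pi) • η) = 1 := by
      rw [symMinus_mul]; simp
    linear_combination -(symLam (s - 1) ((2 * Real.pi) • η) *
      symPlus 1 (2 * Real.pi * τ) ((2 * Real.pi) • η)) * this
  rw [hf]
  have hold := ENNReal.lintegral_mul_le_Lp_mul_Lq (volume : Measure ℝ) Real.HolderConjugate.two_two
    (f := fun τ : ℝ ↦ ENNReal.ofReal (symMinus (-θ) (2 * Real.pi * τ) ((2 * Real.pi) • η)))
    (g := fun τ : ℝ ↦ ENNReal.ofReal (symLam (s - 1) ((2 * Real.pi) • η) *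
        symPlus 1 (2 * Real.pi * τ) ((2 * Real.pi) • η) *
        symMinus θ (2 * Real.pi * τ) ((2 * Real.pi) • η)) * ‖a (point τ η)‖ₑ)
    (by fun_prop) (by fun_prop)
  refine (ENNReal.rpow_le_rpow hold (by norm_num)).trans ?_
  rw [ENNReal.mul_rpow_of_nonneg _ _ (by norm_num), ← ENNReal.rpow_mul, ← ENNReal.rpow_mul]
  norm_num only [ENNReal.rpow_one]
  refine mul_le_mul' ?_ le_rfl
  refine le_trans (le_of_eq ?_) (hC ((2 * Real.pi) • η))
  congr 1 with τ
  rw [ENNReal.ofReal_rpow_of_pos (symMinus_pos _ _ _), symMinus_eq_rpow,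
    ← Real.rpow_mul (symMinus_pos _ _ _).le, ← symMinus_eq_rpow]
  ring_nf

end FiberMass

/-! ### The oscillator with exponential forcing -/

section Kernels

/-- The exponential `e^{iλt}`. -/
def wave (lam t : ℝ) : ℂ := Complex.exp (Complex.I * ((lam * t : ℝ) : ℂ))

/-- The function `sin (rt) / r`, extended by `t` to `r = 0`. -/
def sinKer (r t : ℝ) : ℝ := ∫ s in (0 : ℝ)..t, Real.cos (r * s)

/-- The solution of `(-∂_t² - r²) y = e^{iλt}` with vanishing data at `t = 0`. -/
def duhamel (lam r t : ℝ) : ℂ :=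
  (Real.cos (r * t) : ℝ) * (∫ s in (0 : ℝ)..t, (sinKer r s : ℂ) * wave lam s) -
    (sinKer r t : ℝ) * ∫ s in (0 : ℝ)..t, (Real.cos (r * s) : ℂ) * wave lam s

/-- The derivative in `t` of `duhamel lam r t`. -/
def duhamelDeriv (lam r t : ℝ) : ℂ :=
  -((Real.cos (r * t) : ℝ) * (∫ s in (0 : ℝ)..t, (Real.cos (r * s) : ℂ) * wave lam s) +
    r ^ 2 * (sinKer r t : ℝ) * ∫ s in (0 : ℝ)..t, (sinKer r s : ℂ) * wave lam s)

theorem norm_wave (lam t : ℝ) : ‖wave lam t‖ = 1 := by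
  rw [wave, mul_comm, Complex.norm_exp_ofReal_mul_I]

@[simp] theorem wave_zero (lam : ℝ) : wave lam 0 = 1 := by simp [wave]

theorem wave_add (a b t : ℝ) : wave (a + b) t = wave a t * wave b t := by
  rw [wave, wave, wave, ← Complex.exp_add]
  push_cast
  ring_nf

@[fun_prop]
theorem continuous_wave : Continuous (fun p : ℝ × ℝ ↦ wave p.1 p.2) := by
  unfold wave
  fun_prop

theorem hasDerivAt_wave (lam t : ℝ) :
    HasDerivAt (wave lam) (Complex.I * lam * wave lam t) t := by
  unfold wave
  have h1 : HasDerivAt (fun t : ℝ ↦ Complex.I * ((lam * t : ℝ) : ℂ)) (Complex.I * lam) t := by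
    have := ((hasDerivAt_id t).const_mul lam).ofReal_comp.const_mul Complex.I
    simpa using this
  convert h1.cexp using 1
  ring

theorem continuous_wave_right (lam : ℝ) : Continuous (wave lam) :=
  continuous_iff_continuousAt.2 fun t ↦ (hasDerivAt_wave lam t).continuousAt

theorem continuous_sinKer : Continuous (fun p : ℝ × ℝ ↦ sinKer p.1 p.2) := by
  unfold sinKer
  exact intervalIntegral.continuous_parametric_intervalIntegral_of_continuous
    (f := fun (p : ℝ × ℝ) (s : ℝ) ↦ Real.cos (p.1 * s)) (by fun_prop) (by fun_prop)

theorem continuous_sinKer_right (r : ℝ) : Continuous (sinKer r) :=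
  continuous_sinKer.comp (by fun_prop : Continuous fun t : ℝ ↦ (r, t))

theorem hasDerivAt_sinKer (r t : ℝ) : HasDerivAt (sinKer r) (Real.cos (r * t)) t :=
  (Continuous.integral_hasStrictDerivAt (f := fun s ↦ Real.cos (r * s)) (by fun_prop)
    0 t).hasDerivAt

theorem hasDerivAt_cos_mul (r t : ℝ) :
    HasDerivAt (fun t : ℝ ↦ Real.cos (r * t)) (-(r * Real.sin (r * t))) t := by
  have := ((hasDerivAt_id t).const_mul r).cos
  simp only [id, mul_one] at this
  convert this using 1
  ring

@[simp] theorem sinKer_zero (r : ℝ) : sinKer r 0 = 0 := by simp [sinKer]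

theorem mul_sinKer (r t : ℝ) : r * sinKer r t = Real.sin (r * t) := by
  rw [sinKer, ← intervalIntegral.integral_const_mul]
  have h : ∀ x ∈ Set.uIcc (0 : ℝ) t, HasDerivAt (fun t : ℝ ↦ Real.sin (r * t))
      (r * Real.cos (r * x)) x := by
    intro x _
    have := ((hasDerivAt_id x).const_mul r).sin
    simp only [id, mul_one] at this
    convert this using 1
    ring
  rw [intervalIntegral.integral_eq_sub_of_hasDerivAt h
    (Continuous.intervalIntegrable (by fun_prop) _ _)]
  simp

theorem abs_sinKer_le (r t : ℝ) : |sinKer r t| ≤ |t| := by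
  have := intervalIntegral.norm_integral_le_of_norm_le_const (a := 0) (b := t) (C := 1)
    (f := fun s ↦ Real.cos (r * s)) (fun x _ ↦ Real.abs_cos_le_one _)
  simpa [sinKer] using this

theorem mul_abs_sinKer_le {r : ℝ} (hr : 0 ≤ r) (t : ℝ) : (1 + r) * |sinKer r t| ≤ 1 + |t| := by
  have h1 := abs_sinKer_le r t
  have h2 : r * |sinKer r t| ≤ 1 := by
    rw [← abs_of_nonneg hr, ← abs_mul, abs_of_nonneg hr, mul_sinKer]
    exact Real.abs_sin_le_one _
  linarith

theorem cos_sq_add (r t : ℝ) : Real.cos (r * t) ^ 2 + r ^ 2 * sinKer r t ^ 2 = 1 := by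
  rw [← mul_pow, mul_sinKer, Real.cos_sq_add_sin_sq]

theorem cos_add_sinKer (r t : ℝ) :
    ((Real.cos (r * t) : ℝ) : ℂ) + Complex.I * r * (sinKer r t : ℝ) = wave r t := by
  rw [mul_assoc, ← Complex.ofReal_mul, mul_sinKer, wave, mul_comm Complex.I, mul_comm Complex.I,
    Complex.exp_mul_I]
  push_cast
  ring

theorem cos_sub_sinKer (r t : ℝ) :
    ((Real.cos (r * t) : ℝ) : ℂ) - Complex.I * r * (sinKer r t : ℝ) = wave (-r) t := by
  have h : sinKer (-r) t = sinKer r t := by simp [sinKer]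
  rw [← cos_add_sinKer, h, neg_mul, Real.cos_neg]
  push_cast
  ring

theorem continuous_sinKer_mul_wave (lam r : ℝ) :
    Continuous (fun s ↦ (sinKer r s : ℂ) * wave lam s) :=
  (Complex.continuous_ofReal.comp (continuous_sinKer_right r)).mul (continuous_wave_right lam)

theorem continuous_cos_mul_wave (lam r : ℝ) :
    Continuous (fun s ↦ (Real.cos (r * s) : ℂ) * wave lam s) :=
  (by fun_prop : Continuous fun s : ℝ ↦ (Real.cos (r * s) : ℂ)).mul (continuous_wave_right lam)

/-- Variation of constants: the terms coming from the derivatives of the two integrals cancel. In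
the second derivative they add up, by cos² + sin² = 1, to the forcing. -/
theorem hasDerivAt_duhamel (lam r t : ℝ) :
    HasDerivAt (duhamel lam r) (duhamelDeriv lam r t) t := by
  have h1 := ((continuous_sinKer_mul_wave lam r).integral_hasStrictDerivAt 0 t).hasDerivAt
  have h2 := ((continuous_cos_mul_wave lam r).integral_hasStrictDerivAt 0 t).hasDerivAt
  have h3 := ((hasDerivAt_cos_mul r t).ofReal_comp.mul h1).sub
    ((hasDerivAt_sinKer r t).ofReal_comp.mul h2)
  refine h3.congr_deriv ?_
  rw [duhamelDeriv, ← mul_sinKer]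
  push_cast
  ring

theorem hasDerivAt_duhamelDeriv (lam r t : ℝ) :
    HasDerivAt (duhamelDeriv lam r) (-(r ^ 2 * duhamel lam r t + wave lam t)) t := by
  have h1 := ((continuous_sinKer_mul_wave lam r).integral_hasStrictDerivAt 0 t).hasDerivAt
  have h2 := ((continuous_cos_mul_wave lam r).integral_hasStrictDerivAt 0 t).hasDerivAt
  have h3 := (((hasDerivAt_cos_mul r t).ofReal_comp.mul h2).add
    ((((hasDerivAt_sinKer r t).ofReal_comp).const_mul ((r : ℂ) ^ 2)).mul h1)).neg
  refine h3.congr_deriv ?_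
  have h4 : ((Real.cos (r * t) : ℝ) : ℂ) ^ 2 + r ^ 2 * (sinKer r t : ℂ) ^ 2 = 1 := by
    exact_mod_cast cos_sq_add r t
  rw [duhamel, ← mul_sinKer]
  push_cast
  push_cast at h4
  linear_combination -wave lam t * h4

@[simp] theorem duhamel_zero (lam r : ℝ) : duhamel lam r 0 = 0 := by simp [duhamel]

@[simp] theorem duhamelDeriv_zero (lam r : ℝ) : duhamelDeriv lam r 0 = 0 := by
  simp [duhamelDeriv]

/-- The right-hand side is an explicit primitive minus its value at 0. Keeping the factor r² - λ² on
the left makes the identity valid at resonance as well. -/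
theorem integral_cos_mul_wave (lam r t : ℝ) :
    ((r : ℂ) ^ 2 - lam ^ 2) * ∫ s in (0 : ℝ)..t, (Real.cos (r * s) : ℂ) * wave lam s =
      (Complex.I * lam * (Real.cos (r * t) : ℝ) + r ^ 2 * (sinKer r t : ℝ)) * wave lam t -
        Complex.I * lam := by
  rw [← intervalIntegral.integral_const_mul]
  have h : ∀ x ∈ Set.uIcc (0 : ℝ) t, HasDerivAt (fun t : ℝ ↦
      (Complex.I * lam * (Real.cos (r * t) : ℝ) + r ^ 2 * (sinKer r t : ℝ)) * wave lam t)
      (((r : ℂ) ^ 2 - lam ^ 2) * ((Real.cos (r * x) : ℂ) * wave lam x)) x := by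
    intro x _
    have h1 := (((hasDerivAt_cos_mul r x).ofReal_comp.const_mul (Complex.I * lam)).add
      ((hasDerivAt_sinKer r x).ofReal_comp.const_mul ((r : ℂ) ^ 2))).mul (hasDerivAt_wave lam x)
    refine h1.congr_deriv ?_
    simp only [Pi.add_apply]
    rw [← mul_sinKer]
    push_cast
    linear_combination (-(lam : ℂ) ^ 2 * Complex.cos (r * x) * wave lam x) * -Complex.I_sq
  rw [intervalIntegral.integral_eq_sub_of_hasDerivAt h
    ((continuous_cos_mul_wave lam r).const_mul _ |>.intervalIntegrable _ _)]
  simp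

theorem integral_sinKer_mul_wave (lam r t : ℝ) :
    ((r : ℂ) ^ 2 - lam ^ 2) * ∫ s in (0 : ℝ)..t, (sinKer r s : ℂ) * wave lam s =
      (Complex.I * lam * (sinKer r t : ℝ) - (Real.cos (r * t) : ℝ)) * wave lam t + 1 := by
  rw [← intervalIntegral.integral_const_mul]
  have h : ∀ x ∈ Set.uIcc (0 : ℝ) t, HasDerivAt (fun t : ℝ ↦
      (Complex.I * lam * (sinKer r t : ℝ) - (Real.cos (r * t) : ℝ)) * wave lam t)
      (((r : ℂ) ^ 2 - lam ^ 2) * ((sinKer r x : ℂ) * wave lam x)) x := by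
    intro x _
    have h1 := (((hasDerivAt_sinKer r x).ofReal_comp.const_mul (Complex.I * lam)).sub
      (hasDerivAt_cos_mul r x).ofReal_comp).mul (hasDerivAt_wave lam x)
    refine h1.congr_deriv ?_
    simp only [Pi.sub_apply]
    rw [← mul_sinKer]
    push_cast
    linear_combination (-(lam : ℂ) ^ 2 * sinKer r x * wave lam x) * -Complex.I_sq
  rw [intervalIntegral.integral_eq_sub_of_hasDerivAt h
    ((continuous_sinKer_mul_wave lam r).const_mul _ |>.intervalIntegrable _ _)]
  simp

/-- Away from resonance the response is the stationary solution e^{iλt}/(λ² - r²) minus the free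
solution with the same data. This is what splits the far part of the forcing into an element of the
space and a free wave. -/
theorem mul_duhamel (lam r t : ℝ) : ((lam : ℂ) ^ 2 - r ^ 2) * duhamel lam r t =
    wave lam t - (Real.cos (r * t) : ℝ) - Complex.I * lam * (sinKer r t : ℝ) := by
  have h4 : ((Real.cos (r * t) : ℝ) : ℂ) ^ 2 + r ^ 2 * (sinKer r t : ℂ) ^ 2 = 1 := by
    exact_mod_cast cos_sq_add r t
  rw [duhamel]
  linear_combination -((Real.cos (r * t) : ℝ) : ℂ) * integral_sinKer_mul_wave lam r t +
    (sinKer r t : ℂ) * integral_cos_mul_wave lam r t + wave lam t * h4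

theorem mul_duhamelDeriv (lam r t : ℝ) : ((lam : ℂ) ^ 2 - r ^ 2) * duhamelDeriv lam r t =
    Complex.I * lam * wave lam t + r ^ 2 * (sinKer r t : ℝ) -
      Complex.I * lam * (Real.cos (r * t) : ℝ) := by
  have h4 : ((Real.cos (r * t) : ℝ) : ℂ) ^ 2 + r ^ 2 * (sinKer r t : ℂ) ^ 2 = 1 := by
    exact_mod_cast cos_sq_add r t
  rw [duhamelDeriv]
  linear_combination ((Real.cos (r * t) : ℝ) : ℂ) * integral_cos_mul_wave lam r t +
    (r : ℂ) ^ 2 * (sinKer r t : ℂ) * integral_sinKer_mul_wave lam r t +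
    Complex.I * lam * wave lam t * h4

theorem norm_integral_sinKer_mul_wave_le {r : ℝ} (hr : 0 ≤ r) (lam t : ℝ) :
    (1 + r) * ‖∫ s in (0 : ℝ)..t, (sinKer r s : ℂ) * wave lam s‖ ≤ (1 + |t|) * |t| := by
  have h : ∀ x ∈ Set.uIoc (0 : ℝ) t, ‖(sinKer r x : ℂ) * wave lam x‖ ≤ (1 + |t|) / (1 + r) := by
    intro x hx
    rw [norm_mul, norm_wave, mul_one, Complex.norm_real, Real.norm_eq_abs,
      le_div_iff₀ (by positivity), mul_comm]
    refine (mul_abs_sinKer_le hr x).trans ?_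
    have : |x| ≤ |t| := by
      rcases Set.mem_uIoc.1 hx with h | h
      · rw [abs_of_pos h.1, abs_of_pos (h.1.trans_le h.2)]; exact h.2
      · rw [abs_of_nonpos h.2, abs_of_neg (h.1.trans_le h.2)]; linarith [h.1]
    linarith
  have := intervalIntegral.norm_integral_le_of_norm_le_const h
  rw [sub_zero] at this
  calc _ ≤ (1 + r) * ((1 + |t|) / (1 + r) * |t|) := by gcongr
    _ = _ := by field_simp

theorem norm_integral_cos_mul_wave_le (lam r t : ℝ) :
    ‖∫ s in (0 : ℝ)..t, (Real.cos (r * s) : ℂ) * wave lam s‖ ≤ |t| := by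
  have h : ∀ x ∈ Set.uIoc (0 : ℝ) t, ‖(Real.cos (r * x) : ℂ) * wave lam x‖ ≤ 1 := by
    intro x _
    rw [norm_mul, norm_wave, mul_one, Complex.norm_real]
    exact Real.abs_cos_le_one _
  simpa using intervalIntegral.norm_integral_le_of_norm_le_const h

/-- Each of the two terms contains one factor `sinKer`, which supplies the gain 1/(1 + r). The bound
is uniform in λ and so covers resonance. -/
theorem mul_norm_duhamel_le {r : ℝ} (hr : 0 ≤ r) (lam t : ℝ) :
    (1 + r) * ‖duhamel lam r t‖ ≤ 2 * (1 + |t|) * |t| := by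
  have h1 := norm_integral_sinKer_mul_wave_le hr lam t
  have h2 := norm_integral_cos_mul_wave_le lam r t
  have h3 := mul_abs_sinKer_le hr t
  have h4 := Real.abs_cos_le_one (r * t)
  set A := ∫ s in (0 : ℝ)..t, (sinKer r s : ℂ) * wave lam s with hA
  set B := ∫ s in (0 : ℝ)..t, (Real.cos (r * s) : ℂ) * wave lam s with hB
  have h5 : ‖duhamel lam r t‖ ≤ 1 * ‖A‖ + |sinKer r t| * |t| := by
    rw [duhamel, ← hA, ← hB]
    refine (norm_sub_le _ _).trans ?_
    rw [norm_mul, norm_mul, Complex.norm_real, Complex.norm_real, Real.norm_eq_abs,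
      Real.norm_eq_abs]
    gcongr
  calc (1 + r) * ‖duhamel lam r t‖ ≤ (1 + r) * (1 * ‖A‖ + |sinKer r t| * |t|) := by gcongr
    _ = (1 + r) * ‖A‖ + (1 + r) * |sinKer r t| * |t| := by ring
    _ ≤ (1 + |t|) * |t| + (1 + |t|) * |t| := by gcongr
    _ = _ := by ring

theorem norm_duhamelDeriv_le {r : ℝ} (hr : 0 ≤ r) (lam t : ℝ) :
    ‖duhamelDeriv lam r t‖ ≤ 2 * (1 + |t|) * |t| := by
  have h1 := norm_integral_sinKer_mul_wave_le hr lam t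
  have h2 := norm_integral_cos_mul_wave_le lam r t
  have h4 := Real.abs_cos_le_one (r * t)
  have h3 : r * |sinKer r t| ≤ 1 := by
    rw [← abs_of_nonneg hr, ← abs_mul, abs_of_nonneg hr, mul_sinKer]
    exact Real.abs_sin_le_one _
  set A := ∫ s in (0 : ℝ)..t, (sinKer r s : ℂ) * wave lam s with hA
  set B := ∫ s in (0 : ℝ)..t, (Real.cos (r * s) : ℂ) * wave lam s with hB
  have h6 : r * ‖A‖ ≤ (1 + |t|) * |t| := by nlinarith [norm_nonneg A]
  have h5 : ‖duhamelDeriv lam r t‖ ≤ 1 * |t| + (r * |sinKer r t|) * (r * ‖A‖) := by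
    rw [duhamelDeriv, ← hA, ← hB, norm_neg]
    refine (norm_add_le _ _).trans ?_
    rw [norm_mul, norm_mul, norm_mul, Complex.norm_real, Complex.norm_real, norm_pow,
      Complex.norm_real, Real.norm_of_nonneg hr,
      show r ^ 2 * ‖sinKer r t‖ * ‖A‖ = (r * |sinKer r t|) * (r * ‖A‖) by
        rw [Real.norm_eq_abs]; ring]
    gcongr
    exact h4
  calc ‖duhamelDeriv lam r t‖ ≤ 1 * |t| + 1 * ((1 + |t|) * |t|) :=
        h5.trans (by gcongr)
    _ ≤ _ := by nlinarith [abs_nonneg t]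

theorem continuous_wave_comp {α : Type*} [TopologicalSpace α] {f g : α → ℝ} (hf : Continuous f)
    (hg : Continuous g) : Continuous fun x ↦ wave (f x) (g x) :=
  continuous_wave.comp (hf.prodMk hg)

theorem continuous_sinKer_comp {α : Type*} [TopologicalSpace α] {f g : α → ℝ} (hf : Continuous f)
    (hg : Continuous g) : Continuous fun x ↦ sinKer (f x) (g x) :=
  continuous_sinKer.comp (hf.prodMk hg)

theorem continuous_integral_sinKer :
    Continuous (fun p : ℝ × ℝ × ℝ ↦ ∫ s in (0 : ℝ)..p.2.2, (sinKer p.2.1 s : ℂ) * wave p.1 s) :=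
  intervalIntegral.continuous_parametric_intervalIntegral_of_continuous
    (f := fun (p : ℝ × ℝ × ℝ) (s : ℝ) ↦ (sinKer p.2.1 s : ℂ) * wave p.1 s)
    ((Complex.continuous_ofReal.comp (continuous_sinKer_comp (by fun_prop) (by fun_prop))).mul
      (continuous_wave_comp (by fun_prop) (by fun_prop))) (by fun_prop)

theorem continuous_integral_cos :
    Continuous (fun p : ℝ × ℝ × ℝ ↦
      ∫ s in (0 : ℝ)..p.2.2, (Real.cos (p.2.1 * s) : ℂ) * wave p.1 s) :=
  intervalIntegral.continuous_parametric_intervalIntegral_of_continuous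
    (f := fun (p : ℝ × ℝ × ℝ) (s : ℝ) ↦ (Real.cos (p.2.1 * s) : ℂ) * wave p.1 s)
    ((by fun_prop : Continuous fun q : (ℝ × ℝ × ℝ) × ℝ ↦ (Real.cos (q.1.2.1 * q.2) : ℂ)).mul
      (continuous_wave_comp (by fun_prop) (by fun_prop))) (by fun_prop)

theorem continuous_duhamel : Continuous (fun p : ℝ × ℝ × ℝ ↦ duhamel p.1 p.2.1 p.2.2) := by
  unfold duhamel
  exact ((by fun_prop : Continuous fun p : ℝ × ℝ × ℝ ↦ ((Real.cos (p.2.1 * p.2.2) : ℝ) : ℂ)).mul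
    continuous_integral_sinKer).sub ((Complex.continuous_ofReal.comp
      (continuous_sinKer_comp (by fun_prop) (by fun_prop))).mul continuous_integral_cos)

theorem continuous_duhamelDeriv :
    Continuous (fun p : ℝ × ℝ × ℝ ↦ duhamelDeriv p.1 p.2.1 p.2.2) := by
  unfold duhamelDeriv
  refine (((by fun_prop : Continuous fun p : ℝ × ℝ × ℝ ↦
    ((Real.cos (p.2.1 * p.2.2) : ℝ) : ℂ)).mul
    continuous_integral_cos).add (((by fun_prop : Continuous fun p : ℝ × ℝ × ℝ ↦
      (p.2.1 : ℂ) ^ 2).mul (Complex.continuous_ofReal.comp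
      (continuous_sinKer_comp (by fun_prop) (by fun_prop)))).mul continuous_integral_sinKer)).neg

/-- For `r ≠ 0` the Duhamel kernel is a difference of two modulated primitives. -/
theorem mul_duhamel_eq_sub (lam r t : ℝ) :
    -(2 * Complex.I * r) * duhamel lam r t =
      wave r t * (∫ s in (0 : ℝ)..t, wave (lam - r) s) -
        wave (-r) t * ∫ s in (0 : ℝ)..t, wave (lam + r) s := by
  have i1 := (continuous_sinKer_mul_wave lam r).intervalIntegrable (μ := volume) 0 t
  have i2 := (continuous_cos_mul_wave lam r).intervalIntegrable (μ := volume) 0 t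
  have e1 : ∫ s in (0 : ℝ)..t, wave (lam - r) s =
      (∫ s in (0 : ℝ)..t, (Real.cos (r * s) : ℂ) * wave lam s) -
        Complex.I * r * ∫ s in (0 : ℝ)..t, (sinKer r s : ℂ) * wave lam s := by
    rw [← intervalIntegral.integral_const_mul, ← intervalIntegral.integral_sub i2
      (i1.const_mul _)]
    congr 1 with s
    rw [sub_eq_add_neg lam, wave_add, ← cos_sub_sinKer]
    ring
  have e2 : ∫ s in (0 : ℝ)..t, wave (lam + r) s =
      (∫ s in (0 : ℝ)..t, (Real.cos (r * s) : ℂ) * wave lam s) +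
        Complex.I * r * ∫ s in (0 : ℝ)..t, (sinKer r s : ℂ) * wave lam s := by
    rw [← intervalIntegral.integral_const_mul, ← intervalIntegral.integral_add i2
      (i1.const_mul _)]
    congr 1 with s
    rw [wave_add, ← cos_add_sinKer r]
    ring
  rw [e1, e2, ← cos_add_sinKer, ← cos_sub_sinKer, duhamel]
  ring

theorem sinKer_scale (T r t : ℝ) : sinKer r (T * t) = T * sinKer (T * r) t := by
  have := intervalIntegral.smul_integral_comp_mul_left
    (fun s ↦ Real.cos (r * s)) T (a := 0) (b := t)
  rw [mul_zero] at this
  rw [sinKer, sinKer, ← this, smul_eq_mul]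
  congr 2 with s
  ring_nf

theorem wave_scale (T lam t : ℝ) : wave lam (T * t) = wave (T * lam) t := by
  rw [wave, wave]; ring_nf

/-- The oscillator is homogeneous under rescaling of time; the factor T² is the order of the
equation and the source of the 2 in the exponent 2 - γ. -/
theorem duhamel_scale (T lam r t : ℝ) :
    duhamel lam r (T * t) = T ^ 2 * duhamel (T * lam) (T * r) t := by
  have e1 : ∫ s in (0 : ℝ)..T * t, (sinKer r s : ℂ) * wave lam s =
      T ^ 2 * ∫ s in (0 : ℝ)..t, (sinKer (T * r) s : ℂ) * wave (T * lam) s := by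
    have := intervalIntegral.smul_integral_comp_mul_left
      (fun s ↦ (sinKer r s : ℂ) * wave lam s) T (a := 0) (b := t)
    rw [mul_zero] at this
    rw [← this, ← intervalIntegral.integral_const_mul, Complex.real_smul,
      ← intervalIntegral.integral_const_mul]
    congr 1 with s
    rw [sinKer_scale, wave_scale]
    push_cast
    ring
  have e2 : ∫ s in (0 : ℝ)..T * t, (Real.cos (r * s) : ℂ) * wave lam s =
      T * ∫ s in (0 : ℝ)..t, (Real.cos (T * r * s) : ℂ) * wave (T * lam) s := by
    have := intervalIntegral.smul_integral_comp_mul_left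
      (fun s ↦ (Real.cos (r * s) : ℂ) * wave lam s) T (a := 0) (b := t)
    rw [mul_zero] at this
    rw [← this, Complex.real_smul]
    congr 2 with s
    rw [wave_scale]
    ring_nf
  rw [duhamel, duhamel, e1, e2, sinKer_scale, show r * (T * t) = T * r * t by ring]
  push_cast
  ring

end Kernels

/-! ### Fourier decay of functions localized in time -/

section TimeFourier

/-- The Fourier transform in `t` as a function of the angular frequency. -/
def angFT (h : ℝ → ℂ) (ω : ℝ) : ℂ := ∫ t, wave (-ω) t * h t

theorem fourier_eq_angFT (h : ℝ → ℂ) (τ : ℝ) : 𝓕 h τ = angFT h (2 * Real.pi * τ) := by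
  rw [Real.fourier_real_eq_integral_exp_smul, angFT]
  congr 1 with t
  rw [smul_eq_mul, wave]
  congr 2
  push_cast
  ring

theorem fourierInv_eq_integral_wave (h : ℝ → ℂ) (t : ℝ) :
    𝓕⁻ h t = ∫ τ, wave (2 * Real.pi * τ) t * h τ := by
  rw [Real.fourierInv_eq']
  congr 1 with τ
  rw [smul_eq_mul, wave]
  congr 2
  simp only [RCLike.inner_apply, conj_trivial]
  push_cast
  ring

theorem angFT_eq_fourier (h : ℝ → ℂ) (ω : ℝ) : angFT h ω = 𝓕 h (ω / (2 * Real.pi)) := by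
  rw [fourier_eq_angFT]
  congr 1
  field_simp

theorem norm_angFT_le (h : ℝ → ℂ) (ω : ℝ) : ‖angFT h ω‖ ≤ ∫ t, ‖h t‖ := by
  refine (norm_integral_le_integral_norm _).trans (le_of_eq ?_)
  congr 1 with t
  rw [norm_mul, norm_wave, one_mul]

theorem angFT_deriv {h h' : ℝ → ℂ} (hd : ∀ t, HasDerivAt h (h' t) t) (hi : Integrable h)
    (hi' : Integrable h') (ω : ℝ) : angFT h' ω = Complex.I * ω * angFT h ω := by
  have e : deriv h = h' := funext fun t ↦ (hd t).deriv
  have := Real.fourier_deriv hi (fun t ↦ (hd t).differentiableAt) (e ▸ hi')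
  rw [angFT_eq_fourier, angFT_eq_fourier, ← e, this]
  simp only [smul_eq_mul]
  push_cast
  field_simp

theorem angFT_wave_mul (r : ℝ) (χ h : ℝ → ℂ) (ω : ℝ) :
    angFT (fun t ↦ χ t * (wave r t * h t)) ω = angFT (fun t ↦ χ t * h t) (ω - r) := by
  unfold angFT
  congr 1 with t
  rw [neg_sub, sub_eq_add_neg, add_comm, wave_add]
  ring

theorem integrable_of_support {h : ℝ → ℂ} (hc : Continuous h) {R : ℝ}
    (hs : ∀ t, R < |t| → h t = 0) : Integrable h := by
  refine hc.integrable_of_hasCompactSupport ?_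
  refine HasCompactSupport.intro (isCompact_closedBall (0 : ℝ) R) fun t ht ↦ hs t ?_
  simpa using ht

theorem integral_norm_le_of_support {h : ℝ → ℂ} {M : ℝ} (hs : ∀ t, 2 < |t| → h t = 0)
    (hM : ∀ t, |t| ≤ 2 → ‖h t‖ ≤ M) : ∫ t, ‖h t‖ ≤ 4 * M := by
  have h1 : ∫ t, ‖h t‖ = ∫ t in Set.Icc (-2) 2, ‖h t‖ := by
    rw [setIntegral_eq_integral_of_forall_compl_eq_zero]
    intro t ht
    rw [hs t, norm_zero]
    by_contra hc
    exact ht (abs_le.1 (not_lt.1 hc))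
  have h2 := norm_setIntegral_le_of_norm_le_const (μ := volume) (s := Set.Icc (-2 : ℝ) 2)
    (f := fun t ↦ ‖h t‖) (C := M) (by simp) (fun t ht ↦ by
      rw [norm_norm]; exact hM t (abs_le.2 ht))
  rw [h1]
  refine (le_abs_self _).trans (h2.trans (le_of_eq ?_))
  simp [measureReal_def]
  norm_num
  ring

/-- Three integrations by parts on an interval of length 4. Three powers are needed because Λ₊Λ₋^γ
with γ ≤ 2 can cost three powers of the distance to the cone. -/
theorem angFT_decay {h₀ h₁ h₂ h₃ : ℝ → ℂ} (d₀ : ∀ t, HasDerivAt h₀ (h₁ t) t)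
    (d₁ : ∀ t, HasDerivAt h₁ (h₂ t) t) (d₂ : ∀ t, HasDerivAt h₂ (h₃ t) t) (c₃ : Continuous h₃)
    (s₀ : ∀ t, 2 < |t| → h₀ t = 0) (s₁ : ∀ t, 2 < |t| → h₁ t = 0) (s₂ : ∀ t, 2 < |t| → h₂ t = 0)
    (s₃ : ∀ t, 2 < |t| → h₃ t = 0) {M : ℝ} (m₀ : ∀ t, |t| ≤ 2 → ‖h₀ t‖ ≤ M)
    (m₃ : ∀ t, |t| ≤ 2 → ‖h₃ t‖ ≤ M) (ω : ℝ) : (1 + |ω|) ^ 3 * ‖angFT h₀ ω‖ ≤ 32 * M := by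
  have c₀ : Continuous h₀ := continuous_iff_continuousAt.2 fun t ↦ (d₀ t).continuousAt
  have c₁ : Continuous h₁ := continuous_iff_continuousAt.2 fun t ↦ (d₁ t).continuousAt
  have c₂ : Continuous h₂ := continuous_iff_continuousAt.2 fun t ↦ (d₂ t).continuousAt
  have i₀ := integrable_of_support c₀ s₀
  have i₁ := integrable_of_support c₁ s₁
  have i₂ := integrable_of_support c₂ s₂
  have i₃ := integrable_of_support c₃ s₃
  have e : angFT h₃ ω = (Complex.I * ω) ^ 3 * angFT h₀ ω := by
    rw [angFT_deriv d₂ i₂ i₃, angFT_deriv d₁ i₁ i₂, angFT_deriv d₀ i₀ i₁]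
    ring
  have b₀ := (norm_angFT_le h₀ ω).trans (integral_norm_le_of_support s₀ m₀)
  have b₃ := (norm_angFT_le h₃ ω).trans (integral_norm_le_of_support s₃ m₃)
  rw [e, norm_mul, norm_pow, norm_mul, Complex.norm_I, one_mul, Complex.norm_real,
    Real.norm_eq_abs] at b₃
  -- The constant 32 is this 4 times the sum of the two bounds 4M.
  have h3 : (1 + |ω|) ^ 3 ≤ 4 * (1 + |ω| ^ 3) := by
    have := abs_nonneg ω
    nlinarith [mul_nonneg (by linarith : 0 ≤ 1 + |ω|) (sq_nonneg (|ω| - 1))]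
  calc (1 + |ω|) ^ 3 * ‖angFT h₀ ω‖ ≤ 4 * (1 + |ω| ^ 3) * ‖angFT h₀ ω‖ := by gcongr
    _ = 4 * (‖angFT h₀ ω‖ + |ω| ^ 3 * ‖angFT h₀ ω‖) := by ring
    _ ≤ 32 * M := by linarith

/-- The smooth bump function underlying `cutoff`. -/
def bump : ContDiffBump (0 : ℝ) := ⟨1, 2, by norm_num, by norm_num⟩

/-- A smooth function equal to `1` on `[-1, 1]` and supported in `[-2, 2]`. -/
def cutoff (t : ℝ) : ℂ := (bump t : ℝ)

theorem contDiff_cutoff : ContDiff ℝ ((⊤ : ℕ∞) : WithTop ℕ∞) cutoff :=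
  Complex.ofRealCLM.contDiff.comp bump.contDiff

theorem cutoff_eq_one {t : ℝ} (ht : |t| ≤ 1) : cutoff t = 1 := by
  rw [cutoff, bump.one_of_mem_closedBall (by simpa [bump] using ht), Complex.ofReal_one]

theorem cutoff_eq_zero {t : ℝ} (ht : 2 ≤ |t|) : cutoff t = 0 := by
  rw [cutoff, bump.zero_of_le_dist (by simpa [bump] using ht), Complex.ofReal_zero]

theorem hasCompactSupport_cutoff : HasCompactSupport cutoff :=
  bump.hasCompactSupport.comp_left (g := fun x : ℝ ↦ (x : ℂ)) rfl

theorem continuous_cutoff : Continuous cutoff := contDiff_cutoff.continuous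

theorem norm_cutoff_le (t : ℝ) : ‖cutoff t‖ ≤ 1 := by
  rw [cutoff, Complex.norm_real, Real.norm_of_nonneg bump.nonneg]
  exact bump.le_one

/-- The Leibniz rule; the constant depends only on the cutoff, and f enters only through its values
and derivatives on the support [-2, 2], so that f may grow elsewhere. -/
theorem angFT_cutoff_mul_decay : ∃ C : ℝ, 0 ≤ C ∧ ∀ (f₀ f₁ f₂ f₃ : ℝ → ℂ) (M : ℝ),
    (∀ t, HasDerivAt f₀ (f₁ t) t) → (∀ t, HasDerivAt f₁ (f₂ t) t) →
    (∀ t, HasDerivAt f₂ (f₃ t) t) → Continuous f₃ →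
    (∀ t, |t| ≤ 2 → ‖f₀ t‖ ≤ M ∧ ‖f₁ t‖ ≤ M ∧ ‖f₂ t‖ ≤ M ∧ ‖f₃ t‖ ≤ M) →
    ∀ ω, (1 + |ω|) ^ 3 * ‖angFT (fun t ↦ cutoff t * f₀ t) ω‖ ≤ C * M := by
  set χ := fun k ↦ deriv^[k] cutoff with hχ
  have hsm : ∀ k, ContDiff ℝ ((⊤ : ℕ∞) : WithTop ℕ∞) (χ k) := fun k ↦
    contDiff_cutoff.iterate_deriv k
  have hd : ∀ k t, HasDerivAt (χ k) (χ (k + 1) t) t := by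
    intro k t
    have := ((hsm k).differentiable (by simp) t).hasDerivAt
    simpa only [hχ, Function.iterate_succ_apply'] using this
  have hcs : ∀ k, HasCompactSupport (χ k) := by
    intro k
    induction k with
    | zero => exact hasCompactSupport_cutoff
    | succ k ih =>
      have := ih.deriv
      simpa only [hχ, Function.iterate_succ_apply'] using this
  have hz : ∀ k t, 2 < |t| → χ k t = 0 := by
    intro k
    induction k with
    | zero => exact fun t ht ↦ cutoff_eq_zero ht.le
    | succ k ih =>
      intro t ht
      have he : χ k =ᶠ[𝓝 t] fun _ ↦ 0 := by
        filter_upwards [(continuous_abs.isOpen_preimage _ isOpen_Ioi).mem_nhds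
          (show t ∈ abs ⁻¹' Set.Ioi (2 : ℝ) from ht)] with x hx using ih x hx
      exact (hd k t).unique ((hasDerivAt_const t (0 : ℂ)).congr_of_eventuallyEq he)
  choose b hb using fun k ↦ (hcs k).exists_bound_of_continuous (hsm k).continuous
  have hb0 : ∀ k, 0 ≤ b k := fun k ↦ (norm_nonneg _).trans (hb k 0)
  refine ⟨32 * (b 0 + b 3 + 3 * b 2 + 3 * b 1), by
    have := hb0 0; have := hb0 1; have := hb0 2; have := hb0 3; positivity, ?_⟩
  intro f₀ f₁ f₂ f₃ M d₀ d₁ d₂ c₃ hM ω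
  have hM0 : 0 ≤ M := (norm_nonneg _).trans (hM 0 (by simp)).1
  have c₀ : Continuous f₀ := continuous_iff_continuousAt.2 fun t ↦ (d₀ t).continuousAt
  have c₁ : Continuous f₁ := continuous_iff_continuousAt.2 fun t ↦ (d₁ t).continuousAt
  have c₂ : Continuous f₂ := continuous_iff_continuousAt.2 fun t ↦ (d₂ t).continuousAt
  rw [mul_assoc]
  refine angFT_decay (h₀ := fun t ↦ χ 0 t * f₀ t)
    (h₁ := fun t ↦ χ 1 t * f₀ t + χ 0 t * f₁ t)
    (h₂ := fun t ↦ χ 2 t * f₀ t + 2 * χ 1 t * f₁ t + χ 0 t * f₂ t)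
    (h₃ := fun t ↦ χ 3 t * f₀ t + 3 * χ 2 t * f₁ t + 3 * χ 1 t * f₂ t + χ 0 t * f₃ t)
    (fun t ↦ ?_) (fun t ↦ ?_) (fun t ↦ ?_) ?_ (fun t ht ↦ ?_) (fun t ht ↦ ?_) (fun t ht ↦ ?_)
    (fun t ht ↦ ?_) (fun t ht ↦ ?_) (fun t ht ↦ ?_) ω
  · exact (hd 0 t).mul (d₀ t)
  · refine (((hd 1 t).mul (d₀ t)).add ((hd 0 t).mul (d₁ t))).congr_deriv ?_
    ring
  · refine ((((hd 2 t).mul (d₀ t)).add (((hd 1 t).const_mul 2).mul (d₁ t))).add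
      ((hd 0 t).mul (d₂ t))).congr_deriv ?_
    ring
  · have := fun k ↦ (hsm k).continuous
    fun_prop
  · simp [hz _ t ht]
  · simp [hz _ t ht]
  · simp [hz _ t ht]
  · simp [hz _ t ht]
  · obtain ⟨h0, -⟩ := hM t ht
    rw [norm_mul]
    calc ‖χ 0 t‖ * ‖f₀ t‖ ≤ b 0 * M := by gcongr; exacts [hb0 0, hb 0 t]
      _ ≤ _ := by
        have := mul_nonneg (hb0 1) hM0; have := mul_nonneg (hb0 2) hM0
        have := mul_nonneg (hb0 3) hM0
        nlinarith
  · obtain ⟨h0, h1, h2, h3⟩ := hM t ht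
    have k0 : ‖χ 3 t * f₀ t‖ ≤ b 3 * M := by
      rw [norm_mul]; gcongr; exacts [hb0 3, hb 3 t]
    have k1 : ‖3 * χ 2 t * f₁ t‖ ≤ 3 * b 2 * M := by
      rw [norm_mul, norm_mul, Complex.norm_ofNat]; gcongr
      exacts [mul_nonneg (by norm_num) (hb0 2), hb 2 t]
    have k2 : ‖3 * χ 1 t * f₂ t‖ ≤ 3 * b 1 * M := by
      rw [norm_mul, norm_mul, Complex.norm_ofNat]; gcongr
      exacts [mul_nonneg (by norm_num) (hb0 1), hb 1 t]
    have k3 : ‖χ 0 t * f₃ t‖ ≤ b 0 * M := by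
      rw [norm_mul]; gcongr; exacts [hb0 0, hb 0 t]
    refine (norm_add_le _ _).trans ?_
    refine (add_le_add (norm_add₃_le (a := χ 3 t * f₀ t)) le_rfl).trans ?_
    linarith

theorem hasDerivAt_const_mul_wave (c : ℂ) (μ t : ℝ) :
    HasDerivAt (fun t ↦ c * wave μ t) (c * (Complex.I * μ) * wave μ t) t := by
  refine ((hasDerivAt_wave μ t).const_mul c).congr_deriv ?_
  ring

theorem mul_integral_wave (μ t : ℝ) :
    Complex.I * μ * (∫ s in (0 : ℝ)..t, wave μ s) = wave μ t - 1 := by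
  rw [← intervalIntegral.integral_const_mul,
    intervalIntegral.integral_eq_sub_of_hasDerivAt (fun x _ ↦ hasDerivAt_wave μ x)
      ((continuous_wave_right μ).const_mul _ |>.intervalIntegrable _ _), wave_zero]

theorem hasDerivAt_integral_wave (μ t : ℝ) :
    HasDerivAt (fun t ↦ ∫ s in (0 : ℝ)..t, wave μ s) (wave μ t) t :=
  ((continuous_wave_right μ).integral_hasStrictDerivAt 0 t).hasDerivAt

theorem norm_integral_wave_le (μ t : ℝ) : ‖∫ s in (0 : ℝ)..t, wave μ s‖ ≤ |t| := by
  have h : ∀ x ∈ Set.uIoc (0 : ℝ) t, ‖wave μ x‖ ≤ 1 := fun x _ ↦ (norm_wave μ x).le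
  simpa using intervalIntegral.norm_integral_le_of_norm_le_const h

theorem exists_angFT_cutoff_le : ∃ C : ℝ, 0 ≤ C ∧ ∀ ω, (1 + |ω|) ^ 3 * ‖angFT cutoff ω‖ ≤ C := by
  obtain ⟨C, hC0, hC⟩ := angFT_cutoff_mul_decay
  refine ⟨C, hC0, fun ω ↦ ?_⟩
  have := hC (fun _ ↦ 1) (fun _ ↦ 0) (fun _ ↦ 0) (fun _ ↦ 0) 1 (fun t ↦ hasDerivAt_const _ _)
    (fun t ↦ hasDerivAt_const _ _) (fun t ↦ hasDerivAt_const _ _) continuous_const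
    (fun t _ ↦ by simp) ω
  simpa using this

theorem integrable_wave_mul {h : ℝ → ℂ} (hi : Integrable h) (ω : ℝ) :
    Integrable (fun t ↦ wave ω t * h t) := by
  refine (integrable_norm_iff
    ((continuous_wave_right ω).aestronglyMeasurable.mul hi.1)).1 (hi.norm.congr ?_)
  filter_upwards with t
  rw [Pi.mul_apply, norm_mul, norm_wave, one_mul]

theorem integrable_cutoff_mul {f : ℝ → ℂ} (hf : Continuous f) :
    Integrable (fun t ↦ cutoff t * f t) :=
  integrable_of_support (continuous_cutoff.mul hf) (R := 2) fun t ht ↦ by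
    rw [cutoff_eq_zero ht.le, zero_mul]

theorem angFT_sub {f g : ℝ → ℂ} (hf : Integrable f) (hg : Integrable g) (ω : ℝ) :
    angFT (fun t ↦ f t - g t) ω = angFT f ω - angFT g ω := by
  unfold angFT
  simp_rw [mul_sub]
  exact integral_sub (integrable_wave_mul hf _) (integrable_wave_mul hg _)

theorem angFT_add {f g : ℝ → ℂ} (hf : Integrable f) (hg : Integrable g) (ω : ℝ) :
    angFT (fun t ↦ f t + g t) ω = angFT f ω + angFT g ω := by
  unfold angFT
  simp_rw [mul_add]
  exact integral_add (integrable_wave_mul hf _) (integrable_wave_mul hg _)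

theorem angFT_const_mul (c : ℂ) (f : ℝ → ℂ) (ω : ℝ) :
    angFT (fun t ↦ c * f t) ω = c * angFT f ω := by
  unfold angFT
  simp_rw [mul_left_comm _ c]
  exact integral_const_mul _ _

/-- The primitive is (e^{iμt} - 1)/(iμ), whose localization has one peak at 0 and one at μ. For |μ|
≤ 1 division by μ is useless, but then the primitive has bounded derivatives and the single peak at
0 suffices. -/
theorem exists_angFT_primitive_le : ∃ C : ℝ, 0 ≤ C ∧ ∀ μ ω,
    ‖angFT (fun t ↦ cutoff t * ∫ s in (0 : ℝ)..t, wave μ s) ω‖ ≤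
      C * (((1 + |ω|) ^ 3)⁻¹ + ((1 + |ω - μ|) ^ 3)⁻¹) := by
  obtain ⟨C, hC0, hC⟩ := angFT_cutoff_mul_decay
  obtain ⟨C', hC0', hC'⟩ := exists_angFT_cutoff_le
  refine ⟨C * 2 + C', by positivity, fun μ ω ↦ ?_⟩
  have hc : Continuous (fun t ↦ ∫ s in (0 : ℝ)..t, wave μ s) :=
    continuous_iff_continuousAt.2 fun t ↦ (hasDerivAt_integral_wave μ t).continuousAt
  have hp1 : 0 < (1 + |ω|) ^ 3 := by positivity
  have hp2 : 0 < (1 + |ω - μ|) ^ 3 := by positivity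
  rcases le_or_gt |μ| 1 with hμ | hμ
  · have := hC (fun t ↦ ∫ s in (0 : ℝ)..t, wave μ s) (fun t ↦ 1 * wave μ t)
      (fun t ↦ 1 * (Complex.I * μ) * wave μ t)
      (fun t ↦ 1 * (Complex.I * μ) * (Complex.I * μ) * wave μ t) 2
      (fun t ↦ by simpa using hasDerivAt_integral_wave μ t)
      (fun t ↦ hasDerivAt_const_mul_wave _ _ _) (fun t ↦ hasDerivAt_const_mul_wave _ _ _)
      ((continuous_wave_right μ).const_mul _) (fun t ht ↦ ?_) ω
    · have h1 : ‖angFT (fun t ↦ cutoff t * ∫ s in (0 : ℝ)..t, wave μ s) ω‖ ≤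
          C * 2 * ((1 + |ω|) ^ 3)⁻¹ := by
        rw [← div_eq_mul_inv, le_div_iff₀ hp1, mul_comm]
        exact this
      have h2 : 0 ≤ C' * ((1 + |ω|) ^ 3)⁻¹ := by positivity
      have h3 : 0 ≤ (C * 2 + C') * ((1 + |ω - μ|) ^ 3)⁻¹ := by positivity
      nlinarith
    · refine ⟨(norm_integral_wave_le μ t).trans ht, ?_, ?_, ?_⟩ <;>
        simp only [norm_mul, norm_wave, Complex.norm_I, Complex.norm_real, Real.norm_eq_abs,
          one_mul, mul_one]
      · norm_num
      · linarith
      · nlinarith [abs_nonneg μ]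
  · have e : (Complex.I * μ) * angFT (fun t ↦ cutoff t * ∫ s in (0 : ℝ)..t, wave μ s) ω =
        angFT cutoff (ω - μ) - angFT cutoff ω := by
      rw [← angFT_const_mul]
      have e1 : (fun t ↦ Complex.I * μ * (cutoff t * ∫ s in (0 : ℝ)..t, wave μ s)) =
          fun t ↦ cutoff t * (wave μ t * 1) - cutoff t := by
        ext t
        rw [mul_left_comm, mul_integral_wave]
        ring
      rw [e1, angFT_sub (integrable_cutoff_mul (f := fun t ↦ wave μ t * 1) ((continuous_wave_right μ).mul continuous_const))
        (by simpa using integrable_cutoff_mul (f := fun _ ↦ 1) continuous_const), angFT_wave_mul]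
      simp
    have h1 : ‖angFT (fun t ↦ cutoff t * ∫ s in (0 : ℝ)..t, wave μ s) ω‖ ≤
        ‖angFT cutoff (ω - μ)‖ + ‖angFT cutoff ω‖ := by
      refine le_trans ?_ (norm_sub_le _ _)
      rw [← e, norm_mul, norm_mul, Complex.norm_I, one_mul, Complex.norm_real, Real.norm_eq_abs]
      exact le_mul_of_one_le_left (norm_nonneg _) hμ.le
    have h2 : ∀ ω, ‖angFT cutoff ω‖ ≤ C' * ((1 + |ω|) ^ 3)⁻¹ := by
      intro ω
      rw [← div_eq_mul_inv, le_div_iff₀ (by positivity), mul_comm]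
      exact hC' ω
    have h3 := h2 ω
    have h4 := h2 (ω - μ)
    have h5 : 0 ≤ C * 2 * ((1 + |ω - μ|) ^ 3)⁻¹ := by positivity
    have h6 : 0 ≤ C * 2 * ((1 + |ω|) ^ 3)⁻¹ := by positivity
    nlinarith

end TimeFourier

/-! ### Decay of the localized kernels away from the cone -/

section KernelDecay

theorem inv_cube_le {x d k : ℝ} (hd : 0 ≤ d) (h : 1 + d ≤ k * (1 + |x|)) :
    ((1 + |x|) ^ 3)⁻¹ ≤ k ^ 3 * ((1 + d) ^ 3)⁻¹ := by
  rw [← div_eq_mul_inv, le_div_iff₀ (by positivity), mul_comm, ← div_eq_mul_inv,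
    div_le_iff₀ (by positivity), ← mul_pow]
  gcongr

theorem abs_abs_sub_le_abs_sub {r : ℝ} (hr : 0 ≤ r) (τ : ℝ) : |(|τ| - r)| ≤ |τ - r| := by
  have := abs_abs_sub_abs_le_abs_sub τ r
  rwa [abs_of_nonneg hr] at this

theorem abs_abs_sub_le_abs_add {r : ℝ} (hr : 0 ≤ r) (τ : ℝ) : |(|τ| - r)| ≤ |τ + r| := by
  have := abs_abs_sub_abs_le_abs_sub τ (-r)
  rwa [abs_neg, abs_of_nonneg hr, sub_neg_eq_add] at this

/-- Trades the weight Λ₊ for 1 + r and one power of the distance to the cone. -/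
theorem one_add_add_le {r : ℝ} (hr : 0 ≤ r) (τ : ℝ) :
    1 + |τ| + r ≤ 2 * (1 + r) * (1 + |(|τ| - r)|) := by
  have := le_abs_self (|τ| - r)
  nlinarith [abs_nonneg (|τ| - r), mul_nonneg hr (abs_nonneg (|τ| - r))]

/-- The cosine shifts the transform of the cutoff to ±r, and the distance of τ to either point is at
least the distance to the cone. -/
theorem exists_angFT_cutoff_cos_le : ∃ C : ℝ, 0 ≤ C ∧ ∀ r, 0 ≤ r → ∀ τ,
    (1 + |(|τ| - r)|) ^ 3 * ‖angFT (fun t ↦ cutoff t * (Real.cos (r * t) : ℝ)) τ‖ ≤ C := by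
  obtain ⟨C, hC0, hC⟩ := exists_angFT_cutoff_le
  refine ⟨C, hC0, fun r hr τ ↦ ?_⟩
  have e : angFT (fun t ↦ cutoff t * (Real.cos (r * t) : ℝ)) τ =
      (1 / 2 : ℂ) * (angFT cutoff (τ - r) + angFT cutoff (τ + r)) := by
    have e1 : (fun t ↦ cutoff t * ((Real.cos (r * t) : ℝ) : ℂ)) = fun t ↦
        (1 / 2 : ℂ) * (cutoff t * (wave r t * 1) + cutoff t * (wave (-r) t * 1)) := by
      ext t
      rw [← cos_add_sinKer, ← cos_sub_sinKer]
      ring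
    rw [e1, angFT_const_mul, angFT_add (integrable_cutoff_mul (f := fun t ↦ wave r t * 1)
      ((continuous_wave_right r).mul continuous_const))
      (integrable_cutoff_mul (f := fun t ↦ wave (-r) t * 1)
      ((continuous_wave_right (-r)).mul continuous_const)), angFT_wave_mul, angFT_wave_mul]
    simp
  have h1 : (1 + |(|τ| - r)|) ^ 3 * ‖angFT cutoff (τ - r)‖ ≤ C :=
    le_trans (mul_le_mul_of_nonneg_right (pow_le_pow_left₀ (by positivity)
      (by linarith [abs_abs_sub_le_abs_sub hr τ]) 3) (norm_nonneg _)) (hC (τ - r))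
  have h2 : (1 + |(|τ| - r)|) ^ 3 * ‖angFT cutoff (τ + r)‖ ≤ C :=
    le_trans (mul_le_mul_of_nonneg_right (pow_le_pow_left₀ (by positivity)
      (by linarith [abs_abs_sub_le_abs_add hr τ]) 3) (norm_nonneg _)) (hC (τ + r))
  rw [e, norm_mul]
  have h3 : ‖(1 / 2 : ℂ)‖ = 1 / 2 := by norm_num
  rw [h3]
  have h4 := mul_le_mul_of_nonneg_left (norm_add_le (angFT cutoff (τ - r)) (angFT cutoff (τ + r)))
    (by positivity : 0 ≤ (1 + |(|τ| - r)|) ^ 3)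
  linarith

theorem one_add_abs_le {r : ℝ} (hr : 0 ≤ r) (hr1 : r ≤ 1) (τ : ℝ) :
    1 + |(|τ| - r)| ≤ 2 * (1 + |τ|) := by
  have : |(|τ| - r)| ≤ |τ| + r := by
    rw [abs_le]; constructor <;> linarith [abs_nonneg τ]
  linarith [abs_nonneg τ]

/-- For r ≥ 1, dividing the difference of two exponentials by 2ir yields the gain 1/(1 + r). For r ≤
1 the function has bounded derivatives, and decay in τ is decay in the distance to the cone. -/
theorem exists_angFT_cutoff_sinKer_le : ∃ C : ℝ, 0 ≤ C ∧ ∀ r, 0 ≤ r → ∀ τ,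
    (1 + r) * (1 + |(|τ| - r)|) ^ 3 * ‖angFT (fun t ↦ cutoff t * (sinKer r t : ℝ)) τ‖ ≤ C := by
  obtain ⟨C, hC0, hC⟩ := exists_angFT_cutoff_le
  obtain ⟨D, hD0, hD⟩ := angFT_cutoff_mul_decay
  refine ⟨2 * C + 2 * 8 * (D * 2), by positivity, fun r hr τ ↦ ?_⟩
  rcases le_total r 1 with hr1 | hr1
  · have := hD (fun t ↦ (sinKer r t : ℝ)) (fun t ↦ (Real.cos (r * t) : ℝ))
      (fun t ↦ ((-(r * Real.sin (r * t)) : ℝ) : ℂ)) (fun t ↦ ((-(r * (r * Real.cos (r * t))) : ℝ) : ℂ))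
      2 (fun t ↦ (hasDerivAt_sinKer r t).ofReal_comp) (fun t ↦ (hasDerivAt_cos_mul r t).ofReal_comp)
      (fun t ↦ ?_) (by fun_prop) (fun t ht ↦ ?_) τ
    · have h1 : (1 + |(|τ| - r)|) ^ 3 ≤ 8 * (1 + |τ|) ^ 3 := by
        calc (1 + |(|τ| - r)|) ^ 3 ≤ (2 * (1 + |τ|)) ^ 3 := by
              gcongr; exact one_add_abs_le hr hr1 τ
          _ = _ := by ring
      calc _ ≤ 2 * (8 * (1 + |τ|) ^ 3) * ‖angFT (fun t ↦ cutoff t * (sinKer r t : ℝ)) τ‖ := by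
            gcongr; linarith
        _ = 2 * 8 * ((1 + |τ|) ^ 3 * ‖angFT (fun t ↦ cutoff t * (sinKer r t : ℝ)) τ‖) := by ring
        _ ≤ 2 * 8 * (D * 2) := by gcongr
        _ ≤ _ := by linarith
    · have h1 : HasDerivAt (fun t : ℝ ↦ Real.sin (r * t)) (r * Real.cos (r * t)) t := by
        have := ((hasDerivAt_id t).const_mul r).sin
        simp only [id, mul_one] at this
        convert this using 1
        ring
      exact (h1.const_mul r).neg.ofReal_comp
    · simp only [Complex.norm_real, Real.norm_eq_abs, abs_neg, abs_mul, abs_of_nonneg hr]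
      have hs := Real.abs_sin_le_one (r * t)
      have hc := Real.abs_cos_le_one (r * t)
      refine ⟨(abs_sinKer_le r t).trans ht, by linarith, ?_, ?_⟩
      · nlinarith [abs_nonneg (Real.sin (r * t))]
      · have : r * |Real.cos (r * t)| ≤ 1 := by nlinarith [abs_nonneg (Real.cos (r * t))]
        nlinarith [abs_nonneg (Real.cos (r * t)), mul_nonneg hr (abs_nonneg (Real.cos (r * t)))]
  · have e : (2 * Complex.I * r) * angFT (fun t ↦ cutoff t * (sinKer r t : ℝ)) τ =
        angFT cutoff (τ - r) - angFT cutoff (τ + r) := by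
      have e1 : (fun t ↦ 2 * Complex.I * r * (cutoff t * ((sinKer r t : ℝ) : ℂ))) = fun t ↦
          (cutoff t * (wave r t * 1) - cutoff t * (wave (-r) t * 1)) := by
        ext t
        rw [← cos_add_sinKer, ← cos_sub_sinKer]
        ring
      rw [← angFT_const_mul, e1, angFT_sub (integrable_cutoff_mul (f := fun t ↦ wave r t * 1)
        ((continuous_wave_right r).mul continuous_const))
        (integrable_cutoff_mul (f := fun t ↦ wave (-r) t * 1)
        ((continuous_wave_right (-r)).mul continuous_const)), angFT_wave_mul, angFT_wave_mul]
      simp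
    have h1 : (1 + |(|τ| - r)|) ^ 3 * ‖angFT cutoff (τ - r)‖ ≤ C :=
      le_trans (mul_le_mul_of_nonneg_right (pow_le_pow_left₀ (by positivity)
      (by linarith [abs_abs_sub_le_abs_sub hr τ]) 3) (norm_nonneg _)) (hC (τ - r))
    have h2 : (1 + |(|τ| - r)|) ^ 3 * ‖angFT cutoff (τ + r)‖ ≤ C :=
      le_trans (mul_le_mul_of_nonneg_right (pow_le_pow_left₀ (by positivity)
      (by linarith [abs_abs_sub_le_abs_add hr τ]) 3) (norm_nonneg _)) (hC (τ + r))
    have h3 := norm_sub_le (angFT cutoff (τ - r)) (angFT cutoff (τ + r))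
    rw [← e, norm_mul, norm_mul, norm_mul, Complex.norm_I, Complex.norm_real, Complex.norm_ofNat,
      mul_one, Real.norm_of_nonneg hr] at h3
    have h4 := mul_le_mul_of_nonneg_left h3 (by positivity : 0 ≤ (1 + |(|τ| - r)|) ^ 3)
    set A := ‖angFT (fun t ↦ cutoff t * (sinKer r t : ℝ)) τ‖
    calc (1 + r) * (1 + |(|τ| - r)|) ^ 3 * A ≤ (2 * r) * (1 + |(|τ| - r)|) ^ 3 * A := by
          gcongr; linarith
      _ = (1 + |(|τ| - r)|) ^ 3 * (2 * r * A) := by ring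
      _ ≤ 2 * C := by linarith
      _ ≤ _ := by linarith [mul_nonneg (by norm_num : (0 : ℝ) ≤ 2 * 8) (by positivity : 0 ≤ D * 2)]

/-- Here |λ| ≤ 4, so the equation itself bounds the derivatives of the response up to order three on
[-2, 2]. -/
theorem exists_angFT_cutoff_duhamel_le_of_le_one : ∃ C : ℝ, 0 ≤ C ∧ ∀ r, 0 ≤ r → r ≤ 1 →
    ∀ lam, |(|lam| - r)| ≤ 3 → ∀ τ,
    (1 + r) * (1 + |(|τ| - r)|) ^ 3 * ‖angFT (fun t ↦ cutoff t * duhamel lam r t) τ‖ ≤ C := by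
  obtain ⟨D, hD0, hD⟩ := angFT_cutoff_mul_decay
  refine ⟨2 * 8 * (D * 20), by positivity, fun r hr hr1 lam hlam τ ↦ ?_⟩
  have hl : |lam| ≤ 4 := by have := (abs_le.1 hlam).2; linarith
  have := hD (duhamel lam r) (duhamelDeriv lam r)
    (fun t ↦ -(r ^ 2 * duhamel lam r t + wave lam t))
    (fun t ↦ -(r ^ 2 * duhamelDeriv lam r t + Complex.I * lam * wave lam t)) 20
    (fun t ↦ hasDerivAt_duhamel lam r t) (fun t ↦ hasDerivAt_duhamelDeriv lam r t)
    (fun t ↦ (((hasDerivAt_duhamel lam r t).const_mul _).add (hasDerivAt_wave lam t)).neg)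
    ?_ (fun t ht ↦ ?_) τ
  · have h1 : (1 + |(|τ| - r)|) ^ 3 ≤ 8 * (1 + |τ|) ^ 3 := by
      calc (1 + |(|τ| - r)|) ^ 3 ≤ (2 * (1 + |τ|)) ^ 3 := by
            gcongr; exact one_add_abs_le hr hr1 τ
        _ = _ := by ring
    calc _ ≤ 2 * (8 * (1 + |τ|) ^ 3) * ‖angFT (fun t ↦ cutoff t * duhamel lam r t) τ‖ := by
          gcongr; linarith
      _ = 2 * 8 * ((1 + |τ|) ^ 3 * ‖angFT (fun t ↦ cutoff t * duhamel lam r t) τ‖) := by ring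
      _ ≤ 2 * 8 * (D * 20) := by gcongr
  · have h1 : Continuous (duhamelDeriv lam r) :=
      continuous_iff_continuousAt.2 fun t ↦ (hasDerivAt_duhamelDeriv lam r t).continuousAt
    exact ((h1.const_mul _).add ((continuous_wave_right lam).const_mul _)).neg
  · have h1 : ‖duhamel lam r t‖ ≤ 12 := by
      have := mul_norm_duhamel_le hr lam t
      nlinarith [abs_nonneg t, mul_nonneg hr (norm_nonneg (duhamel lam r t))]
    have h2 : ‖duhamelDeriv lam r t‖ ≤ 12 := by
      have := norm_duhamelDeriv_le hr lam t
      nlinarith [abs_nonneg t]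
    have hr2 : r ^ 2 ≤ 1 := by nlinarith
    refine ⟨by linarith, by linarith, ?_, ?_⟩
    · rw [norm_neg]
      refine (norm_add_le _ _).trans ?_
      rw [norm_mul, norm_wave, norm_pow, Complex.norm_real, Real.norm_of_nonneg hr]
      nlinarith [norm_nonneg (duhamel lam r t)]
    · rw [norm_neg]
      refine (norm_add_le _ _).trans ?_
      rw [norm_mul, norm_mul, norm_mul, norm_wave, norm_pow, Complex.norm_real, Complex.norm_real,
        Complex.norm_I, Real.norm_of_nonneg hr, Real.norm_eq_abs]
      nlinarith [norm_nonneg (duhamelDeriv lam r t)]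

/-- For r ≥ 1 the response is 1/r times modulated primitives of e^{i(λ∓r)s}, whose transforms peak
at ±r and at λ. Since λ is within 3 of the cone, a peak at λ is as good as one on the cone. -/
theorem exists_angFT_cutoff_duhamel_le : ∃ C : ℝ, 0 ≤ C ∧ ∀ r, 0 ≤ r →
    ∀ lam, |(|lam| - r)| ≤ 3 → ∀ τ,
    (1 + r) * (1 + |(|τ| - r)|) ^ 3 * ‖angFT (fun t ↦ cutoff t * duhamel lam r t) τ‖ ≤ C := by
  obtain ⟨D, hD0, hD⟩ := exists_angFT_cutoff_duhamel_le_of_le_one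
  obtain ⟨C, hC0, hC⟩ := exists_angFT_primitive_le
  refine ⟨D + C * 130, by positivity, fun r hr lam hlam τ ↦ ?_⟩
  rcases le_total r 1 with hr1 | hr1
  · exact (hD r hr hr1 lam hlam τ).trans (by linarith [mul_nonneg hC0 (by norm_num : (0 : ℝ) ≤ 130)])
  set d := |(|τ| - r)| with hd
  have hd0 : 0 ≤ d := abs_nonneg _
  have hcp : ∀ μ, Continuous (fun t ↦ ∫ s in (0 : ℝ)..t, wave μ s) := fun μ ↦
    continuous_iff_continuousAt.2 fun t ↦ (hasDerivAt_integral_wave μ t).continuousAt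
  have e : -(2 * Complex.I * r) * angFT (fun t ↦ cutoff t * duhamel lam r t) τ =
      angFT (fun t ↦ cutoff t * ∫ s in (0 : ℝ)..t, wave (lam - r) s) (τ - r) -
        angFT (fun t ↦ cutoff t * ∫ s in (0 : ℝ)..t, wave (lam + r) s) (τ - -r) := by
    have e1 : (fun t ↦ -(2 * Complex.I * r) * (cutoff t * duhamel lam r t)) = fun t ↦
        cutoff t * (wave r t * ∫ s in (0 : ℝ)..t, wave (lam - r) s) -
          cutoff t * (wave (-r) t * ∫ s in (0 : ℝ)..t, wave (lam + r) s) := by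
      ext t
      rw [mul_left_comm, mul_duhamel_eq_sub]
      ring
    rw [← angFT_const_mul, e1, angFT_sub (integrable_cutoff_mul
      (f := fun t ↦ wave r t * ∫ s in (0 : ℝ)..t, wave (lam - r) s)
      ((continuous_wave_right r).mul (hcp _)))
      (integrable_cutoff_mul (f := fun t ↦ wave (-r) t * ∫ s in (0 : ℝ)..t, wave (lam + r) s)
      ((continuous_wave_right (-r)).mul (hcp _))), angFT_wave_mul, angFT_wave_mul]
  have b1 := hC (lam - r) (τ - r)
  have b2 := hC (lam + r) (τ - -r)
  rw [show τ - r - (lam - r) = τ - lam by ring] at b1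
  rw [show τ - -r - (lam + r) = τ - lam by ring, sub_neg_eq_add] at b2
  have hB := ((1 + d) ^ 3)⁻¹
  have c1 : ((1 + |τ - r|) ^ 3)⁻¹ ≤ 1 ^ 3 * ((1 + d) ^ 3)⁻¹ :=
    inv_cube_le hd0 (by linarith [abs_abs_sub_le_abs_sub hr τ])
  have c2 : ((1 + |τ + r|) ^ 3)⁻¹ ≤ 1 ^ 3 * ((1 + d) ^ 3)⁻¹ :=
    inv_cube_le hd0 (by linarith [abs_abs_sub_le_abs_add hr τ])
  -- The factor 4 is 1 + 3, with 3 the allowed distance of λ from the cone.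
  have c3 : ((1 + |τ - lam|) ^ 3)⁻¹ ≤ 4 ^ 3 * ((1 + d) ^ 3)⁻¹ := by
    refine inv_cube_le hd0 ?_
    have h1 := abs_abs_sub_abs_le_abs_sub τ lam
    have h2 : d ≤ |(|τ| - |lam|)| + |(|lam| - r)| := by
      rw [hd]; exact abs_sub_le _ _ _
    linarith [abs_nonneg (τ - lam)]
  have h3 := norm_sub_le
    (angFT (fun t ↦ cutoff t * ∫ s in (0 : ℝ)..t, wave (lam - r) s) (τ - r))
    (angFT (fun t ↦ cutoff t * ∫ s in (0 : ℝ)..t, wave (lam + r) s) (τ - -r))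
  rw [← e, norm_mul, norm_neg, norm_mul, norm_mul, Complex.norm_I, Complex.norm_real,
    Complex.norm_ofNat, mul_one, Real.norm_of_nonneg hr, sub_neg_eq_add] at h3
  set A := ‖angFT (fun t ↦ cutoff t * duhamel lam r t) τ‖
  -- The four peaks contribute 1 + 64 + 1 + 64 = 130.
  have h4 : 2 * r * A ≤ C * 130 * ((1 + d) ^ 3)⁻¹ := by
    have k1 := mul_le_mul_of_nonneg_left c1 hC0
    have k2 := mul_le_mul_of_nonneg_left c2 hC0
    have k3 := mul_le_mul_of_nonneg_left c3 hC0
    linarith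
  rw [← div_eq_mul_inv, le_div_iff₀ (by positivity)] at h4
  calc (1 + r) * (1 + d) ^ 3 * A ≤ (2 * r) * (1 + d) ^ 3 * A := by gcongr; linarith
    _ = 2 * r * A * (1 + d) ^ 3 := by ring
    _ ≤ C * 130 := h4
    _ ≤ _ := by linarith

/-- T² comes from the homogeneity of the response and one more T from dt. -/
theorem angFT_cutoff_duhamel_scale {T : ℝ} (hT : 0 < T) (lam r τ : ℝ) :
    angFT (fun t ↦ cutoff (t / T) * duhamel lam r t) τ =
      T ^ 3 * angFT (fun t ↦ cutoff t * duhamel (T * lam) (T * r) t) (T * τ) := by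
  unfold angFT
  have h := Measure.integral_comp_mul_left
    (fun t ↦ wave (-τ) t * (cutoff (t / T) * duhamel lam r t)) T
  rw [abs_of_pos (inv_pos.2 hT)] at h
  have h2 : (∫ t, wave (-τ) t * (cutoff (t / T) * duhamel lam r t)) =
      T • ∫ t, wave (-τ) (T * t) * (cutoff (T * t / T) * duhamel lam r (T * t)) := by
    rw [h, smul_smul, mul_inv_cancel₀ hT.ne', one_smul]
  rw [h2, Complex.real_smul, ← integral_const_mul, ← integral_const_mul]
  congr 1 with t
  rw [duhamel_scale, wave_scale, mul_div_cancel_left₀ _ hT.ne', mul_neg]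
  ring

/-- Rescaling to T = 1 turns the distance 3/T into 3. Exchanging 1 + Tr for T(1 + |τ| + r) spends
one of the three powers of decay and one of the three factors T. -/
theorem exists_angFT_cutoff_scale_duhamel_le : ∃ C : ℝ, 0 ≤ C ∧ ∀ T, 0 < T → T < 1 → ∀ r, 0 ≤ r →
    ∀ lam, |(|lam| - r)| ≤ 3 / T → ∀ τ,
    (1 + |τ| + r) * (1 + T * |(|τ| - r)|) ^ 2 *
      ‖angFT (fun t ↦ cutoff (t / T) * duhamel lam r t) τ‖ ≤ C * T ^ 2 := by
  obtain ⟨C, hC0, hC⟩ := exists_angFT_cutoff_duhamel_le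
  refine ⟨2 * C, by positivity, fun T hT hT1 r hr lam hlam τ ↦ ?_⟩
  have hTr : 0 ≤ T * r := by positivity
  have h1 := hC (T * r) hTr (T * lam) (by
    rw [abs_mul, abs_of_pos hT, ← mul_sub, abs_mul, abs_of_pos hT]
    rw [le_div_iff₀ hT] at hlam
    linarith) (T * τ)
  rw [angFT_cutoff_duhamel_scale hT, norm_mul, norm_pow, Complex.norm_real,
    Real.norm_of_nonneg hT.le]
  set A := ‖angFT (fun t ↦ cutoff t * duhamel (T * lam) (T * r) t) (T * τ)‖
  have e : |(|T * τ| - T * r)| = T * |(|τ| - r)| := by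
    rw [abs_mul, abs_of_pos hT, ← mul_sub, abs_mul, abs_of_pos hT]
  rw [e] at h1
  set d := T * |(|τ| - r)| with hd
  have hd0 : 0 ≤ d := by positivity
  have h2 : T * (1 + |τ| + r) ≤ 2 * (1 + T * r) * (1 + d) := by
    have := one_add_add_le hTr (T * τ)
    rw [e, abs_mul, abs_of_pos hT] at this
    nlinarith
  calc (1 + |τ| + r) * (1 + d) ^ 2 * (T ^ 3 * A)
      = T * (1 + |τ| + r) * ((1 + d) ^ 2 * T ^ 2 * A) := by ring
    _ ≤ 2 * (1 + T * r) * (1 + d) * ((1 + d) ^ 2 * T ^ 2 * A) := by gcongr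
    _ = 2 * ((1 + T * r) * (1 + d) ^ 3 * A) * T ^ 2 := by ring
    _ ≤ 2 * C * T ^ 2 := by gcongr

end KernelDecay

/-! ### Restrictions of test functions to fixed times -/

section Slices

theorem hasTemperateGrowth_point_left (η : Space n) :
    (fun τ : ℝ ↦ point τ η).HasTemperateGrowth := by
  let iL : ℝ →L[ℝ] SpaceTime n :=
    (WithLp.prodContinuousLinearEquiv 2 ℝ ℝ (Space n)).symm.toContinuousLinearMap ∘L
      ContinuousLinearMap.inl ℝ _ _
  have h : (fun τ : ℝ ↦ iL τ + point 0 η).HasTemperateGrowth :=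
    iL.hasTemperateGrowth.add (Function.HasTemperateGrowth.const _)
  refine (funext fun x ↦ ?_ : (fun τ : ℝ ↦ point τ η) = _) ▸ h
  apply (WithLp.equiv 2 (ℝ × Space n)).injective
  simp [point, iL]

theorem antilipschitz_point_left (η : Space n) : AntilipschitzWith 1 (fun τ : ℝ ↦ point τ η) := by
  intro x y
  simp [point, edist_dist, WithLp.prod_dist_eq_of_L2]

/-- The restriction `ψ(·, η)` of a Schwartz function on space-time to a line. -/
def fiber (η : Space n) : 𝓢(SpaceTime n, ℂ) →L[ℂ] 𝓢(ℝ, ℂ) :=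
  SchwartzMap.compCLMOfAntilipschitz ℂ (hasTemperateGrowth_point_left η)
    (antilipschitz_point_left η)

@[simp] theorem fiber_apply (η : Space n) (ψ : 𝓢(SpaceTime n, ℂ)) (τ : ℝ) :
    fiber η ψ τ = ψ (point τ η) := rfl

@[simp] theorem slice_apply (t : ℝ) (ψ : 𝓢(SpaceTime n, ℂ)) (x : Space n) :
    slice t ψ x = ψ (point t x) := rfl

/-- The Fourier transform of `ψ` in the space variables, as a function of time. -/
def partialFT (ψ : 𝓢(SpaceTime n, ℂ)) (η : Space n) : 𝓢(ℝ, ℂ) := 𝓕 (fiber η (𝓕⁻ ψ))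

theorem partialFT_apply (ψ : 𝓢(SpaceTime n, ℂ)) (η : Space n) (t : ℝ) :
    partialFT ψ η t = ∫ τ, wave (-(2 * Real.pi * t)) τ * (𝓕⁻ ψ) (point τ η) := by
  rw [partialFT, SchwartzMap.fourier_coe, fourier_eq_angFT, angFT]
  rfl

/-- Of the N + 2 powers of Schwartz decay, two are kept for integrability in τ. -/
theorem exists_pow_mul_norm_le (ψ : 𝓢(SpaceTime n, ℂ)) (N : ℕ) : ∃ C : ℝ, 0 ≤ C ∧ ∀ τ (η : Space n),
    ‖ψ (point τ η)‖ ≤ C * ((1 + ‖η‖) ^ N)⁻¹ * (1 + τ ^ 2)⁻¹ := by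
  have h := SchwartzMap.one_add_le_sup_seminorm_apply (𝕜 := ℝ) (m := (N + 2, 0)) (k := N + 2) (n := 0)
    le_rfl le_rfl ψ
  generalize (2 ^ (N + 2, 0).1 * _ : ℝ) = C at h
  refine ⟨C, le_trans (by positivity) (h 0), fun τ η ↦ ?_⟩
  · have h1 := h (point τ η)
    rw [norm_iteratedFDeriv_zero] at h1
    have e : ‖point τ η‖ ^ 2 = τ ^ 2 + ‖η‖ ^ 2 := by
      rw [WithLp.prod_norm_sq_eq_of_L2]; simp
    have h2 : ‖η‖ ≤ ‖point τ η‖ := by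
      refine le_of_sq_le_sq ?_ (norm_nonneg _); rw [e]; nlinarith [sq_nonneg τ]
    have h3 : 1 + τ ^ 2 ≤ (1 + ‖point τ η‖) ^ 2 := by nlinarith [norm_nonneg (point τ η), norm_nonneg η]
    rw [← div_eq_mul_inv, ← div_eq_mul_inv, le_div_iff₀ (by positivity), le_div_iff₀ (by positivity)]
    refine le_trans ?_ h1
    rw [pow_add]
    calc ‖ψ (point τ η)‖ * (1 + τ ^ 2) * (1 + ‖η‖) ^ N
        ≤ ‖ψ (point τ η)‖ * (1 + ‖point τ η‖) ^ 2 * (1 + ‖point τ η‖) ^ N := by gcongr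
      _ = _ := by ring

theorem exists_norm_partialFT_le (ψ : 𝓢(SpaceTime n, ℂ)) (N : ℕ) : ∃ C : ℝ, 0 ≤ C ∧
    ∀ t (η : Space n), ‖partialFT ψ η t‖ ≤ C * ((1 + ‖η‖) ^ N)⁻¹ := by
  obtain ⟨C, hC0, hC⟩ := exists_pow_mul_norm_le (𝓕⁻ ψ) N
  refine ⟨C * Real.pi, by positivity, fun t η ↦ ?_⟩
  rw [partialFT_apply]
  refine (norm_integral_le_of_norm_le (integrable_inv_one_add_sq.const_mul (C * ((1 + ‖η‖) ^ N)⁻¹))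
    (ae_of_all _ fun τ ↦ ?_)).trans (le_of_eq ?_)
  · rw [norm_mul, norm_wave, one_mul]
    exact hC τ η
  · rw [integral_const_mul, integral_univ_inv_one_add_sq]
    ring

theorem stronglyMeasurable_partialFT (ψ : 𝓢(SpaceTime n, ℂ)) :
    StronglyMeasurable (fun p : ℝ × Space n ↦ partialFT ψ p.2 p.1) := by
  simp_rw [partialFT_apply]
  refine StronglyMeasurable.integral_prod_right (ν := (volume : Measure ℝ)) (f := fun (p : ℝ × Space n) (τ : ℝ) ↦
    wave (-(2 * Real.pi * p.1)) τ * (𝓕⁻ ψ) (point τ p.2)) ?_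
  refine Measurable.stronglyMeasurable (Measurable.mul ?_ ?_)
  · exact (continuous_wave_comp (by fun_prop) (by fun_prop)).measurable
  · exact (𝓕⁻ ψ).continuous.measurable.comp (by fun_prop)

theorem continuous_partialFT (ψ : 𝓢(SpaceTime n, ℂ)) (t : ℝ) :
    Continuous (fun η : Space n ↦ partialFT ψ η t) := by
  simp_rw [partialFT_apply]
  obtain ⟨C, hC0, hC⟩ := exists_pow_mul_norm_le (𝓕⁻ ψ) 0
  refine continuous_of_dominated (bound := fun τ ↦ C * (1 + τ ^ 2)⁻¹) (fun η ↦ ?_) (fun η ↦ ?_)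
    (integrable_inv_one_add_sq.const_mul C) (ae_of_all _ fun τ ↦ ?_)
  · refine Measurable.aestronglyMeasurable (Measurable.mul ?_ ?_)
    · exact (continuous_wave_comp (by fun_prop) (by fun_prop)).measurable
    · exact (𝓕⁻ ψ).continuous.measurable.comp (by fun_prop)
  · refine ae_of_all _ fun τ ↦ ?_
    rw [norm_mul, norm_wave, one_mul]
    simpa using hC τ η
  · exact continuous_const.mul ((𝓕⁻ ψ).continuous.comp (hasTemperateGrowth_point τ).1.continuous)

theorem integrable_partialFT (ψ : 𝓢(SpaceTime n, ℂ)) (t : ℝ) :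
    Integrable (fun η : Space n ↦ partialFT ψ η t) := by
  obtain ⟨C, hC0, hC⟩ := exists_norm_partialFT_le ψ (n + 1)
  have h1 : Integrable (fun η : Space n ↦ (1 + ‖η‖) ^ (-((n + 1 : ℕ) : ℝ))) :=
    integrable_one_add_norm (by simp)
  refine (h1.const_mul C).mono' (continuous_partialFT ψ t).aestronglyMeasurable
    (ae_of_all _ fun η ↦ ?_)
  rw [Real.rpow_neg (by positivity), Real.rpow_natCast]
  exact hC t η

/-- Writing ψ as the transform of its inverse transform and applying Fubini exhibits the slice as
the space Fourier transform of `partialFT`; Fourier inversion in x then gives the claim. -/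
theorem fourierInv_slice (ψ : 𝓢(SpaceTime n, ℂ)) (t : ℝ) (η : Space n) :
    (𝓕⁻ (slice t ψ)) η = partialFT ψ η t := by
  have h1 : (slice t ψ : Space n → ℂ) = 𝓕 (fun η : Space n ↦ partialFT ψ η t) := by
    ext x
    have e : ψ (point t x) = (𝓕 (𝓕⁻ ψ)) (point t x) := by simp
    rw [slice_apply, e, SchwartzMap.fourier_coe, Real.fourier_eq', integral_spaceTime, Real.fourier_eq']
    · congr 1 with η
      rw [partialFT_apply, smul_eq_mul, ← integral_const_mul]
      congr 1 with τ
      rw [smul_eq_mul, ← mul_assoc]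
      congr 1
      rw [wave, ← Complex.exp_add]
      congr 1
      rw [WithLp.prod_inner_apply]
      simp
      ring
    · refine (𝓕⁻ ψ).integrable.bdd_mul (c := 1) ?_ (ae_of_all _ fun ζ ↦ ?_)
      · refine Continuous.aestronglyMeasurable ?_
        fun_prop
      · rw [Complex.norm_exp_ofReal_mul_I]
  rw [SchwartzMap.fourierInv_coe, h1]
  have h2 : Integrable (𝓕 (fun η : Space n ↦ partialFT ψ η t)) := by
    rw [← h1]; exact (slice t ψ).integrable
  rw [(continuous_partialFT ψ t).fourierInv_fourier_eq (integrable_partialFT ψ t) h2]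

theorem integral_wave_mul_partialFT (ψ : 𝓢(SpaceTime n, ℂ)) (η : Space n) (τ : ℝ) :
    ∫ t, wave (2 * Real.pi * τ) t * partialFT ψ η t = (𝓕⁻ ψ) (point τ η) := by
  have e (t : ℝ) : wave (2 * Real.pi * τ) t = wave (2 * Real.pi * t) τ := by
    unfold wave; congr 3; ring
  simp_rw [e]
  rw [← fourierInv_eq_integral_wave, ← SchwartzMap.fourierInv_coe, partialFT,
    FourierTransform.fourierInv_fourier_eq, fiber_apply]

end Slices

/-! ### The wave operator on test functions, and pairing with curves -/

section BoxPairing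

theorem hasCompactSupport_lineDerivOp {E : Type*} [NormedAddCommGroup E] [NormedSpace ℝ E]
    {ψ : 𝓢(E, ℂ)} (h : HasCompactSupport ψ) (m : E) : HasCompactSupport (∂_{m} ψ : 𝓢(E, ℂ)) := by
  have e : ((∂_{m} ψ : 𝓢(E, ℂ)) : E → ℂ) = fun x ↦ fderiv ℝ ψ x m :=
    funext fun x ↦ SchwartzMap.lineDerivOp_apply_eq_fderiv m ψ x
  rw [e]
  exact h.fderiv_apply (𝕜 := ℝ) m

theorem exists_slice_eq_zero {ψ : 𝓢(SpaceTime n, ℂ)} (h : HasCompactSupport ψ) :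
    ∃ R : ℝ, 0 ≤ R ∧ ∀ t, R < |t| → slice t ψ = 0 := by
  obtain ⟨R, hR0, hR⟩ := h.isCompact.isBounded.subset_closedBall_lt 0 (0 : SpaceTime n)
  refine ⟨R, hR0.le, fun t ht ↦ ?_⟩
  ext x
  rw [slice_apply]
  refine image_eq_zero_of_notMem_tsupport fun hx ↦ ?_
  have h1 := hR hx
  rw [mem_closedBall_zero_iff] at h1
  have e : ‖point t x‖ ^ 2 = t ^ 2 + ‖x‖ ^ 2 := by
    rw [WithLp.prod_norm_sq_eq_of_L2]; simp
  have h2 : |t| ≤ ‖point t x‖ := by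
    refine abs_le_of_sq_le_sq ?_ (norm_nonneg _)
    rw [e]; nlinarith [sq_nonneg ‖x‖]
  linarith

theorem partialFT_eq_zero {ψ : 𝓢(SpaceTime n, ℂ)} {t : ℝ} (h : slice t ψ = 0) (η : Space n) :
    partialFT ψ η t = 0 := by
  rw [← fourierInv_slice, h]
  simp

theorem hasCompactSupport_box {ψ : 𝓢(SpaceTime n, ℂ)} (h : HasCompactSupport ψ) :
    HasCompactSupport (box ψ) := by
  obtain ⟨R, hR0, hR⟩ := h.isCompact.isBounded.subset_closedBall_lt 0 (0 : SpaceTime n)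
  have h1 (m : SpaceTime n) : HasCompactSupport (∂_{m} (∂_{m} ψ) : 𝓢(SpaceTime n, ℂ)) :=
    hasCompactSupport_lineDerivOp (hasCompactSupport_lineDerivOp h m) m
  have h2 : (box ψ : SpaceTime n → ℂ) = -((∂_{point (n := n) 1 0} (∂_{point (n := n) 1 0} ψ) :
      𝓢(SpaceTime n, ℂ)) : SpaceTime n → ℂ) +
      ∑ i : Fin n, ((∂_{point 0 (EuclideanSpace.single i (1 : ℝ))}
      (∂_{point 0 (EuclideanSpace.single i (1 : ℝ))} ψ) : 𝓢(SpaceTime n, ℂ)) : SpaceTime n → ℂ) := by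
    ext x
    simp [box]
  rw [h2]
  refine HasCompactSupport.add (h1 _).neg ?_
  refine Finset.sum_induction _ (fun f : SpaceTime n → ℂ ↦ HasCompactSupport f)
    (fun _ _ h h' ↦ h.add h') HasCompactSupport.zero (fun i _ ↦ h1 _)

theorem fourierInv_lineDerivOp_twice {E : Type*} [NormedAddCommGroup E] [InnerProductSpace ℝ E]
    [FiniteDimensional ℝ E] [MeasurableSpace E] [BorelSpace E] (ψ : 𝓢(E, ℂ)) (m x : E) :
    (𝓕⁻ (∂_{m} (∂_{m} ψ) : 𝓢(E, ℂ))) x = -(((2 * Real.pi * inner ℝ x m) ^ 2 : ℝ) : ℂ) * (𝓕⁻ ψ) x := by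
  rw [SchwartzMap.fourierInv_lineDerivOp_eq, SchwartzMap.fourierInv_lineDerivOp_eq]
  rw [smul_apply, SchwartzMap.smulLeftCLM_apply_apply (by fun_prop), smul_apply,
    SchwartzMap.smulLeftCLM_apply_apply (by fun_prop)]
  simp only [smul_eq_mul, Complex.real_smul]
  push_cast
  ring_nf
  simp

theorem fourierInv_box (ψ : 𝓢(SpaceTime n, ℂ)) (τ : ℝ) (η : Space n) :
    (𝓕⁻ (box ψ)) (point τ η) =
      (((2 * Real.pi * τ) ^ 2 - (2 * Real.pi * ‖η‖) ^ 2 : ℝ) : ℂ) * (𝓕⁻ ψ) (point τ η) := by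
  have hadd : 𝓕⁻ (box ψ) = - 𝓕⁻ (∂_{point (n := n) 1 0} (∂_{point (n := n) 1 0} ψ)) +
    ∑ i : Fin n, 𝓕⁻ (∂_{point 0 (EuclideanSpace.single i (1 : ℝ))}
      (∂_{point 0 (EuclideanSpace.single i (1 : ℝ))} ψ)) := by
    rw [box, FourierTransform.fourierInv_add, FourierTransform.fourierInv_neg,
      FourierTransform.fourierInv_sum]
  rw [hadd]
  simp only [add_apply, neg_apply, sum_apply,
    fourierInv_lineDerivOp_twice]
  have e1 : inner ℝ (point τ η) (point (n := n) 1 0) = τ := by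
    rw [WithLp.prod_inner_apply]; simp [point]
  have e2 (i : Fin n) : inner ℝ (point τ η) (point 0 (EuclideanSpace.single i (1 : ℝ))) = η i := by
    rw [WithLp.prod_inner_apply]
    simp [point, EuclideanSpace.inner_single_right]
  rw [e1]
  simp_rw [e2]
  rw [← Finset.sum_mul, mul_pow _ ‖η‖, EuclideanSpace.norm_sq_eq]
  simp only [Real.norm_eq_abs, sq_abs, mul_pow, Finset.mul_sum]
  push_cast
  simp only [Finset.sum_neg_distrib]
  ring

/-- In the mixed variables (t, η) the wave operator is an oscillator; this is where the equation for
distributions meets the kernels. -/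
theorem partialFT_box (ψ : 𝓢(SpaceTime n, ℂ)) (η : Space n) (t : ℝ) :
    partialFT (box ψ) η t = -(∂_{(1 : ℝ)} (∂_{(1 : ℝ)} (partialFT ψ η) : 𝓢(ℝ, ℂ)) : 𝓢(ℝ, ℂ)) t -
      (((2 * Real.pi * ‖η‖) ^ 2 : ℝ) : ℂ) * partialFT ψ η t := by
  have e : fiber η (𝓕⁻ (box ψ)) = -𝓕⁻ (∂_{(1 : ℝ)} (∂_{(1 : ℝ)} (partialFT ψ η))) -
      (((2 * Real.pi * ‖η‖) ^ 2 : ℝ) : ℂ) • 𝓕⁻ (partialFT ψ η) := by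
    ext τ
    rw [fiber_apply, fourierInv_box, sub_apply, neg_apply,
      fourierInv_lineDerivOp_twice, smul_apply, partialFT,
      FourierTransform.fourierInv_fourier_eq, fiber_apply]
    simp
    ring
  rw [partialFT, e, sub_eq_add_neg, FourierTransform.fourier_add]
  rw [← neg_one_smul ℂ, ← neg_one_smul ℂ (_ • _), FourierTransform.fourier_smul, FourierTransform.fourier_smul, FourierTransform.fourier_smul, FourierTransform.fourier_fourierInv_eq, FourierTransform.fourier_fourierInv_eq]
  simp
  ring

theorem hasDerivAt_schwartz (f : 𝓢(ℝ, ℂ)) (t : ℝ) :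
    HasDerivAt f ((∂_{(1 : ℝ)} f : 𝓢(ℝ, ℂ)) t) t := by
  rw [SchwartzMap.lineDerivOp_apply_eq_fderiv, fderiv_apply_one_eq_deriv]
  exact (f.differentiableAt).hasDerivAt

/-- Integration by parts against a kernel in the time variable. -/
theorem integral_mul_partialFT_box {ψ : 𝓢(SpaceTime n, ℂ)} (h : HasCompactSupport ψ) (η : Space n)
    {S S' S'' : ℝ → ℂ} (h₁ : ∀ t, HasDerivAt S (S' t) t) (h₂ : ∀ t, HasDerivAt S' (S'' t) t)
    (h₃ : Continuous S'') :
    ∫ t, S t * partialFT (box ψ) η t =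
      ∫ t, (-S'' t - (((2 * Real.pi * ‖η‖) ^ 2 : ℝ) : ℂ) * S t) * partialFT ψ η t := by
  obtain ⟨R, hR0, hR⟩ := exists_slice_eq_zero h
  have hc : HasCompactSupport (partialFT ψ η) := by
    refine HasCompactSupport.intro (isCompact_closedBall (0 : ℝ) R) fun t ht ↦
      partialFT_eq_zero (hR t ?_) η
    simpa using ht
  have c0 : Continuous S := continuous_iff_continuousAt.2 fun t ↦ (h₁ t).continuousAt
  have c1 : Continuous S' := continuous_iff_continuousAt.2 fun t ↦ (h₂ t).continuousAt
  set k := partialFT ψ η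
  have hc1 : HasCompactSupport (∂_{(1 : ℝ)} k : 𝓢(ℝ, ℂ)) := hasCompactSupport_lineDerivOp hc 1
  have hc2 := hasCompactSupport_lineDerivOp hc1 1
  have int {f : ℝ → ℂ} (hf : Continuous f) {g : 𝓢(ℝ, ℂ)} (hg : HasCompactSupport g) :
      Integrable (fun t ↦ f t * g t) :=
    (hf.mul g.continuous).integrable_of_hasCompactSupport hg.mul_left
  have i1 : ∫ t, S t * (∂_{(1 : ℝ)} (∂_{(1 : ℝ)} k) : 𝓢(ℝ, ℂ)) t =
      -∫ t, S' t * (∂_{(1 : ℝ)} k : 𝓢(ℝ, ℂ)) t :=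
    integral_mul_deriv_eq_deriv_mul_of_integrable (fun t _ ↦ h₁ t)
      (fun t _ ↦ hasDerivAt_schwartz _ t) (int c0 hc2) (int c1 hc1) (int c0 hc1)
  have i2 : ∫ t, S' t * (∂_{(1 : ℝ)} k : 𝓢(ℝ, ℂ)) t = -∫ t, S'' t * k t :=
    integral_mul_deriv_eq_deriv_mul_of_integrable (fun t _ ↦ h₂ t)
      (fun t _ ↦ hasDerivAt_schwartz _ t) (int c1 hc1) (int h₃ hc) (int c1 hc)
  rw [i2, neg_neg] at i1
  have e1 : (fun t ↦ S t * partialFT (box ψ) η t) = fun t ↦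
      -(S t * (∂_{(1 : ℝ)} (∂_{(1 : ℝ)} k) : 𝓢(ℝ, ℂ)) t) -
        (((2 * Real.pi * ‖η‖) ^ 2 : ℝ) : ℂ) * (S t * k t) := by
    ext t
    rw [partialFT_box]
    ring
  have e2 : (fun t ↦ (-S'' t - (((2 * Real.pi * ‖η‖) ^ 2 : ℝ) : ℂ) * S t) * k t) = fun t ↦
      -(S'' t * k t) - (((2 * Real.pi * ‖η‖) ^ 2 : ℝ) : ℂ) * (S t * k t) := by
    ext t
    ring
  rw [e1, e2, integral_sub (f := fun t ↦ -(S t * _)) (int c0 hc2).neg ((int c0 hc).const_mul _),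
    integral_sub (f := fun t ↦ -(S'' t * _)) (int h₃ hc).neg ((int c0 hc).const_mul _), integral_neg, integral_neg, i1]

theorem symLam_le_rpow (s : ℝ) (η : Space n) :
    symLam s ((2 * Real.pi) • η) ≤ ((2 * Real.pi) * (1 + ‖η‖)) ^ |s| := by
  have hpi := Real.pi_gt_three
  have h1 : 1 + ‖(2 * Real.pi) • η‖ ^ 2 ≤ ((2 * Real.pi) * (1 + ‖η‖)) ^ 2 := by
    rw [norm_smul, Real.norm_of_nonneg (by positivity)]
    nlinarith [norm_nonneg η, mul_nonneg (norm_nonneg η) Real.pi_pos.le]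
  calc symLam s ((2 * Real.pi) • η) ≤ (1 + ‖(2 * Real.pi) • η‖ ^ 2) ^ (|s| / 2) :=
        Real.rpow_le_rpow_of_exponent_le (by simp) (by linarith [le_abs_self s])
    _ ≤ (((2 * Real.pi) * (1 + ‖η‖)) ^ 2) ^ (|s| / 2) := by gcongr
    _ = _ := by
      rw [← Real.rpow_natCast, ← Real.rpow_mul (by positivity)]
      congr 1
      push_cast
      ring

/-- Cauchy–Schwarz, with the weights of orders s and -s cancelling: the duality of H^s and H^{-s}.
-/
theorem lintegral_mul_le_weightedNorm (s : ℝ) {H H' : Space n → ℝ≥0∞} (h : AEMeasurable H)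
    (h' : AEMeasurable H') : ∫⁻ η, H η * H' η ≤ weightedNorm (-s) H * weightedNorm s H' := by
  have h1 : ∫⁻ η, H η * H' η = ∫⁻ η, (ENNReal.ofReal (symLam (-s) ((2 * Real.pi) • η)) * H η) *
      (ENNReal.ofReal (symLam s ((2 * Real.pi) • η)) * H' η) := by
    congr 1 with η
    rw [mul_mul_mul_comm, ← ENNReal.ofReal_mul (symLam_pos _ _).le, symLam_mul]
    simp
  rw [h1]
  exact ENNReal.lintegral_mul_le_Lp_mul_Lq volume Real.HolderConjugate.two_two
    (AEMeasurable.mul (by fun_prop) h) (AEMeasurable.mul (by fun_prop) h')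

theorem exists_weightedNorm_inv_pow_lt_top (n : ℕ) (s : ℝ) : ∃ N : ℕ,
    weightedNorm (n := n) s (fun η ↦ ENNReal.ofReal (((1 + ‖η‖) ^ N)⁻¹)) < ∞ := by
  -- The weight grows at most like the power |s|, so this N leaves a square decaying faster than the
  -- power 2n, hence integrable.
  obtain ⟨N, hN⟩ := exists_nat_gt (|s| + n)
  refine ⟨N, ENNReal.rpow_lt_top_of_nonneg (by norm_num) (ne_of_lt ?_)⟩
  have hi : Integrable (fun η : Space n ↦
      ((2 * Real.pi) ^ |s|) ^ 2 * (1 + ‖η‖) ^ (-(2 * (N - |s|)))) :=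
    (integrable_one_add_norm (by simp; linarith [abs_nonneg s, n.cast_nonneg (α := ℝ)])).const_mul _
  refine lt_of_le_of_lt (lintegral_mono fun η ↦ ?_) hi.lintegral_lt_top
  rw [← ENNReal.ofReal_mul (symLam_pos _ _).le, ENNReal.ofReal_rpow_of_nonneg
    (mul_nonneg (symLam_pos _ _).le (by positivity)) (by norm_num)]
  refine ENNReal.ofReal_le_ofReal ?_
  rw [Real.rpow_two]
  have e : ((2 * Real.pi) ^ |s|) ^ 2 * (1 + ‖η‖) ^ (-(2 * (N - |s|))) =
      (((2 * Real.pi) * (1 + ‖η‖)) ^ |s| * ((1 + ‖η‖) ^ N)⁻¹) ^ 2 := by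
    rw [Real.mul_rpow (by positivity : 0 ≤ 2 * Real.pi) (by positivity : 0 ≤ 1 + ‖η‖),
      ← Real.rpow_natCast (1 + ‖η‖) N, ← Real.rpow_neg (by positivity : 0 ≤ 1 + ‖η‖)]
    have : (1 + ‖η‖) ^ (-(2 * (N - |s|))) = ((1 + ‖η‖) ^ |s| * (1 + ‖η‖) ^ (-(N : ℝ))) ^ 2 := by
      rw [← Real.rpow_add (by positivity), ← Real.rpow_natCast, ← Real.rpow_mul (by positivity)]
      congr 1
      push_cast
      ring
    rw [this]
    ring
  rw [e]
  have h2 := symLam_le_rpow (n := n) s η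
  have := (symLam_pos s ((2 * Real.pi) • η)).le
  gcongr

/-- A common majorant for the Fourier transforms of the restrictions `ψ(t, ·)`. -/
theorem exists_partialFT_majorant (ψ : 𝓢(SpaceTime n, ℂ)) (s : ℝ) : ∃ m : Space n → ℝ≥0∞,
    Measurable m ∧ (∀ t η, ‖partialFT ψ η t‖ₑ ≤ m η) ∧
      ∀ H : Space n → ℝ≥0∞, AEMeasurable H → weightedNorm s H < ∞ → ∫⁻ η, m η * H η < ∞ := by
  obtain ⟨N, hN⟩ := exists_weightedNorm_inv_pow_lt_top n (-s)
  obtain ⟨C, hC0, hC⟩ := exists_norm_partialFT_le ψ N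
  refine ⟨fun η ↦ ENNReal.ofReal C * ENNReal.ofReal (((1 + ‖η‖) ^ N)⁻¹), by fun_prop,
    fun t η ↦ ?_, fun H hH hs ↦ ?_⟩
  · dsimp only
    rw [← ofReal_norm, ← ENNReal.ofReal_mul hC0]
    exact ENNReal.ofReal_le_ofReal (hC t η)
  · refine (lintegral_mul_le_weightedNorm s (by fun_prop) hH).trans_lt (ENNReal.mul_lt_top ?_ hs)
    rw [weightedNorm_const_mul _ ENNReal.ofReal_ne_top]
    exact ENNReal.mul_lt_top ENNReal.ofReal_lt_top hN

/-- Fubini's theorem for the pairing of a curve of superpositions with a test function. -/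
theorem integral_curve_slice {Ω : Type*} [MeasurableSpace Ω] {μ : Measure Ω} [SFinite μ] {s R : ℝ}
    {K : Space n → Ω → ℝ → ℂ} (hK : Measurable fun p : ℝ × Space n × Ω ↦ K p.2.1 p.2.2 p.1)
    {G : Space n → Ω → ℝ≥0∞} (hG : Measurable fun p : Space n × Ω ↦ G p.1 p.2)
    (hKG : ∀ t, |t| ≤ R → ∀ η ω, ‖K η ω t‖ₑ ≤ G η ω)
    (hGs : weightedNorm s (fun η ↦ ∫⁻ ω, G η ω ∂μ) < ∞)
    {u : ℝ → 𝓢'(Space n, ℂ)} (hu : ∀ t, IsFunction (𝓕 (u t)) (fun η ↦ ∫ ω, K η ω t ∂μ))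
    {ψ : 𝓢(SpaceTime n, ℂ)} (hψ : ∀ t, R < |t| → slice t ψ = 0) :
    Integrable (fun t ↦ u t (slice t ψ)) ∧
      ∫ t, u t (slice t ψ) = ∫ η, ∫ ω, (∫ t, K η ω t * partialFT ψ η t) ∂μ := by
  obtain ⟨m, hm, hkm, hmH⟩ := exists_partialFT_majorant ψ s
  have hG' : Measurable fun η ↦ ∫⁻ ω, G η ω ∂μ := hG.lintegral_prod_right'
  have hfin := hmH _ hG'.aemeasurable hGs
  set Φ : ℝ → Space n × Ω → ℂ := fun t p ↦ partialFT ψ p.1 t * K p.1 p.2 t with hΦ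
  have hΦm : Measurable (Function.uncurry Φ) := by
    have h : Measurable fun p : ℝ × Space n × Ω ↦ partialFT ψ p.2.1 p.1 :=
      Measurable.comp (g := fun q : ℝ × Space n ↦ partialFT ψ q.2 q.1)
        (f := fun p : ℝ × Space n × Ω ↦ (p.1, p.2.1)) (stronglyMeasurable_partialFT ψ).measurable
        (measurable_fst.prodMk (measurable_fst.comp measurable_snd))
    exact h.mul hK
  -- Outside [-R, R] the test function vanishes, inside the kernel is dominated by G. So one
  -- integrable function dominates the triple integrand and Fubini applies.
  have hbd : ∀ t p, ‖Φ t p‖ₑ ≤ (Set.Icc (-R) R).indicator (fun _ ↦ m p.1 * G p.1 p.2) t := by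
    intro t p
    by_cases ht : |t| ≤ R
    · rw [Set.indicator_of_mem (by rwa [Set.mem_Icc, ← abs_le]), hΦ, enorm_mul]
      exact mul_le_mul' (hkm t p.1) (hKG t ht p.1 p.2)
    · rw [hΦ]
      simp [partialFT_eq_zero (hψ t (not_le.1 ht)) p.1]
  have hmG : Measurable fun p : Space n × Ω ↦ m p.1 * G p.1 p.2 := by fun_prop
  have hI : ∫⁻ p, m p.1 * G p.1 p.2 ∂((volume : Measure (Space n)).prod μ) < ∞ := by
    rw [lintegral_prod _ hmG.aemeasurable]
    refine lt_of_le_of_lt (lintegral_mono fun η ↦ ?_) hfin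
    dsimp only
    rw [lintegral_const_mul _ (by fun_prop)]
  have hint : Integrable (Function.uncurry Φ)
      ((volume : Measure ℝ).prod ((volume : Measure (Space n)).prod μ)) := by
    refine ⟨hΦm.aestronglyMeasurable, ?_⟩
    rw [HasFiniteIntegral, lintegral_prod _ hΦm.enorm.aemeasurable]
    calc _ ≤ ∫⁻ t : ℝ, (Set.Icc (-R) R).indicator (fun _ ↦
          ∫⁻ p, m p.1 * G p.1 p.2 ∂((volume : Measure (Space n)).prod μ)) t := by
          refine lintegral_mono fun t ↦ (lintegral_mono fun p ↦ hbd t p).trans (le_of_eq ?_)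
          by_cases ht : t ∈ Set.Icc (-R) R
          · simp [ht]
          · simp [ht]
      _ < ∞ := by
          rw [lintegral_indicator measurableSet_Icc, lintegral_const]
          exact ENNReal.mul_lt_top hI (by simp)
  have h1 : (fun t ↦ u t (slice t ψ)) =ᵐ[volume]
      fun t ↦ ∫ p, Φ t p ∂((volume : Measure (Space n)).prod μ) := by
    filter_upwards [hint.prod_right_ae] with t ht
    rw [(hu t).apply_eq, integral_prod (Φ t) ht]
    congr 1 with η
    rw [fourierInv_slice, ← integral_const_mul]
  refine ⟨hint.integral_prod_left.congr h1.symm, ?_⟩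
  rw [integral_congr_ae h1, integral_integral_swap hint, integral_prod]
  · simp_rw [hΦ, mul_comm]
  · exact hint.integral_prod_right

end BoxPairing

/-! ### Curves in Sobolev spaces from their Fourier transforms -/

section Curves

theorem tendsto_weightedNorm_zero {s : ℝ} {l : Filter ℝ} [l.IsCountablyGenerated]
    {G : ℝ → Space n → ℝ≥0∞} {H : Space n → ℝ≥0∞} (hm : ∀ t, AEMeasurable (G t))
    (hb : ∀ᶠ t in l, ∀ᵐ η, G t η ≤ H η) (hH : weightedNorm s H < ∞)
    (hl : ∀ᵐ η, Tendsto (fun t ↦ G t η) l (𝓝 0)) :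
    Tendsto (fun t ↦ weightedNorm s (G t)) l (𝓝 0) := by
  have h1 : Tendsto (fun t ↦ ∫⁻ η, (ENNReal.ofReal (symLam s ((2 * Real.pi) • η)) * G t η) ^ (2 : ℝ))
      l (𝓝 (∫⁻ _ : Space n, 0)) := by
    -- Dominated convergence is applied along sequences; dropping the first N terms makes the
    -- eventual majorant hold at every index.
    refine tendsto_of_seq_tendsto fun x hx ↦ ?_
    obtain ⟨N, hN⟩ := eventually_atTop.1 (hx.eventually hb)
    refine (tendsto_add_atTop_iff_nat N).1 ?_
    refine tendsto_lintegral_of_dominated_convergence'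
      (fun η ↦ (ENNReal.ofReal (symLam s ((2 * Real.pi) • η)) * H η) ^ (2 : ℝ))
      (fun k ↦ ?_) (fun k ↦ ?_) ?_ ?_
    · have h : AEMeasurable fun η : Space n ↦ ENNReal.ofReal (symLam s ((2 * Real.pi) • η)) := by
        fun_prop
      exact (h.mul (hm _)).pow_const _
    · filter_upwards [hN (k + N) (Nat.le_add_left N k)] with η hη
      gcongr
    · intro h
      rw [weightedNorm, h, ENNReal.top_rpow_of_pos (by norm_num)] at hH
      exact lt_irrefl _ hH
    · filter_upwards [hl] with η hη
      have h2 := (ENNReal.continuous_rpow_const (y := 2)).tendsto _ |>.comp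
        (ENNReal.Tendsto.const_mul ((hη.comp hx).comp (tendsto_add_atTop_nat N)) (Or.inr (ENNReal.ofReal_ne_top
          (r := symLam s ((2 * Real.pi) • η)))))
      simpa [Function.comp_def] using h2
  have h2 := ((ENNReal.continuous_rpow_const (y := 1 / 2)).tendsto _).comp h1
  simpa [weightedNorm, Function.comp_def] using h2

/-- A majorant, locally uniform in time, in the weighted `L²` space of order `s`. -/
def LocallyMajorized (s : ℝ) (U : ℝ → Space n → ℂ) : Prop :=
  ∀ R : ℝ, ∃ H : Space n → ℝ≥0∞, AEMeasurable H ∧ weightedNorm s H < ∞ ∧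
    ∀ᵐ η, ∀ t, |t| ≤ R → ‖U t η‖ₑ ≤ H η

theorem LocallyMajorized.exists_curve {s : ℝ} {U : ℝ → Space n → ℂ} (h : LocallyMajorized s U)
    (hm : ∀ t, AEStronglyMeasurable (U t) volume) :
    ∃ u : ℝ → 𝓢'(Space n, ℂ), ∀ t, IsFunction (𝓕 (u t)) (U t) := by
  have h1 (t : ℝ) : ∃ f : 𝓢'(Space n, ℂ), IsFunction (𝓕 f) (U t) := by
    obtain ⟨H, hHm, hH, hUH⟩ := h |t|
    refine exists_of_weightedNorm (s := s) (hm t) (lt_of_le_of_lt (weightedNorm_mono ?_) hH)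
    filter_upwards [hUH] with η hη
    exact hη t le_rfl
  choose u hu using h1
  exact ⟨u, hu⟩

theorem LocallyMajorized.continuousSobolev {s : ℝ} {U : ℝ → Space n → ℂ} (h : LocallyMajorized s U)
    {u : ℝ → 𝓢'(Space n, ℂ)} (hu : ∀ t, IsFunction (𝓕 (u t)) (U t))
    (hc : ∀ᵐ η, Continuous fun t ↦ U t η) : ContinuousSobolev s u := by
  refine ⟨fun t ↦ ?_, fun t₀ ↦ ?_⟩
  · obtain ⟨H, hHm, hH, hUH⟩ := h |t|
    rw [sobolevNorm_eq (hu t)]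
    refine lt_of_le_of_lt (weightedNorm_mono ?_) hH
    filter_upwards [hUH] with η hη
    exact hη t le_rfl
  · obtain ⟨H, hHm, hH, hUH⟩ := h (|t₀| + 1)
    simp_rw [fun t ↦ sobolevNorm_eq ((hu t).fourier_sub (hu t₀)) s]
    refine tendsto_weightedNorm_zero (H := fun η ↦ 2 * H η)
      (fun t ↦ ((hu t).1.sub (hu t₀).1).enorm) ?_ ?_ ?_
    · filter_upwards [Metric.ball_mem_nhds t₀ one_pos] with t ht
      filter_upwards [hUH] with η hη
      rw [two_mul]
      refine enorm_sub_le.trans (add_le_add (hη t ?_) (hη t₀ (by linarith)))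
      rw [Metric.mem_ball, Real.dist_eq] at ht
      have := abs_sub_abs_le_abs_sub t t₀
      linarith
    · rw [weightedNorm_const_mul s (by simp)]
      exact ENNReal.mul_lt_top (by simp) hH
    · filter_upwards [hc] with η hη
      have h2 := ((hη.tendsto t₀).sub_const (U t₀ η)).enorm
      simpa using h2

/-- The mean value inequality bounds the difference quotients by the majorant of the derivative, so
pointwise differentiability in t becomes differentiability in norm by dominated convergence. -/
theorem LocallyMajorized.hasSobolevDeriv {s : ℝ} {U U' : ℝ → Space n → ℂ}
    (h : LocallyMajorized s U') {u u' : ℝ → 𝓢'(Space n, ℂ)}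
    (hu : ∀ t, IsFunction (𝓕 (u t)) (U t)) (hu' : ∀ t, IsFunction (𝓕 (u' t)) (U' t))
    (hd : ∀ᵐ η, ∀ t, HasDerivAt (fun t ↦ U t η) (U' t η) t) : HasSobolevDeriv s u u' := by
  intro t₀
  obtain ⟨H, hHm, hH, hUH⟩ := h (|t₀| + 1)
  simp_rw [fun t ↦ sobolevNorm_eq ((((hu t).fourier_sub (hu t₀)).fourier_smul
    (((t - t₀ : ℝ) : ℂ)⁻¹)).fourier_sub (hu' t₀)) s]
  refine tendsto_weightedNorm_zero (H := fun η ↦ 2 * H η)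
    (fun t ↦ ((((hu t).1.sub (hu t₀).1).const_mul _).sub (hu' t₀).1).enorm) ?_ ?_ ?_
  · filter_upwards [mem_nhdsWithin_of_mem_nhds (Metric.ball_mem_nhds t₀ one_pos)] with t ht
    filter_upwards [hUH, hd, ae_lt_top_of_weightedNorm hHm hH] with η hη hdη hfin
    rw [two_mul]
    refine enorm_sub_le.trans (add_le_add ?_ (hη t₀ (by linarith)))
    have hb : ∀ x ∈ Metric.ball t₀ 1, ‖U' x η‖ ≤ (H η).toReal := by
      intro x hx
      rw [Metric.mem_ball, Real.dist_eq] at hx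
      have h1 := hη x (by linarith [abs_sub_abs_le_abs_sub x t₀])
      rw [← ofReal_norm] at h1
      exact (ENNReal.ofReal_le_iff_le_toReal hfin.ne).1 h1
    have h2 := (convex_ball t₀ (1 : ℝ)).norm_image_sub_le_of_norm_hasDerivWithin_le
      (f := fun t ↦ U t η) (fun x _ ↦ (hdη x).hasDerivWithinAt) hb
      (Metric.mem_ball_self one_pos) ht
    rw [← ENNReal.ofReal_toReal hfin.ne, ← ofReal_norm]
    refine ENNReal.ofReal_le_ofReal ?_
    rw [norm_mul, norm_inv, Complex.norm_real]
    rcases eq_or_ne t t₀ with rfl | hne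
    · simp
    · rw [inv_mul_le_iff₀ (norm_pos_iff.2 (sub_ne_zero.2 hne)), mul_comm]
      exact h2
  · rw [weightedNorm_const_mul s (by simp)]
    exact ENNReal.mul_lt_top (by simp) hH
  · filter_upwards [hd] with η hη
    have h2 := ((hasDerivAt_iff_tendsto_slope.1 (hη t₀)).sub_const (U' t₀ η)).enorm
    simp only [sub_self, enorm_zero] at h2
    refine h2.congr fun t ↦ ?_
    rw [slope_def_module, Complex.real_smul]
    push_cast
    rfl

theorem lintegral_enorm_le_fiberMass (a : SpaceTime n → ℂ) (η : Space n) :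
    ENNReal.ofReal (symLam 1 ((2 * Real.pi) • η)) * ∫⁻ τ, ‖a (point τ η)‖ₑ ≤ fiberMass a η := by
  rw [fiberMass, ← lintegral_const_mul' _ _ ENNReal.ofReal_ne_top]
  gcongr
  exact symLam_one_le_symPlus_one _ _

/-- The Fourier transform in space of a function of space-time, in terms of its Fourier transform in
space-time. -/
def fiberInv (a : SpaceTime n → ℂ) (t : ℝ) (η : Space n) : ℂ :=
  ∫ τ, wave (2 * Real.pi * τ) t * a (point τ η)

theorem weightedNorm_lintegral_enorm_le (s : ℝ) (a : SpaceTime n → ℂ) :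
    weightedNorm s (fun η ↦ ∫⁻ τ, ‖a (point τ η)‖ₑ) ≤ weightedNorm (s - 1) (fiberMass a) := by
  have := weightedNorm_symLam_mul (s - 1) 1 (fun η : Space n ↦ ∫⁻ τ, ‖a (point τ η)‖ₑ)
  rw [sub_add_cancel] at this
  rw [← this]
  exact weightedNorm_mono (ae_of_all _ fun η ↦ lintegral_enorm_le_fiberMass a η)

theorem enorm_fiberInv_le (a : SpaceTime n → ℂ) (t : ℝ) (η : Space n) :
    ‖fiberInv a t η‖ₑ ≤ ∫⁻ τ, ‖a (point τ η)‖ₑ := by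
  refine (enorm_integral_le_lintegral_enorm _).trans (le_of_eq ?_)
  congr 1 with τ
  rw [enorm_mul, ← ofReal_norm, norm_wave]
  simp

theorem measurable_lintegral_enorm {a : SpaceTime n → ℂ} (ha : Measurable a) :
    Measurable fun η ↦ ∫⁻ τ, ‖a (point τ η)‖ₑ :=
  Measurable.lintegral_prod_right' (f := fun p : Space n × ℝ ↦ ‖a (point p.2 p.1)‖ₑ)
    (ha.comp (measurable_point_comp measurable_snd measurable_fst)).enorm

theorem stronglyMeasurable_fiberInv {a : SpaceTime n → ℂ} (ha : Measurable a) (t : ℝ) :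
    StronglyMeasurable (fiberInv a t) := by
  refine StronglyMeasurable.integral_prod_right (ν := (volume : Measure ℝ))
    (f := fun (η : Space n) (τ : ℝ) ↦ wave (2 * Real.pi * τ) t * a (point τ η)) ?_
  refine Measurable.stronglyMeasurable (Measurable.mul ?_ ?_)
  · exact (continuous_wave_comp (by fun_prop) (by fun_prop)).measurable
  · exact ha.comp (measurable_point_comp measurable_snd measurable_fst)

theorem ae_integrable_fiber {s : ℝ} {a : SpaceTime n → ℂ} (ha : Measurable a)
    (hfin : weightedNorm (s - 1) (fiberMass a) < ∞) :
    ∀ᵐ η : Space n, Integrable fun τ ↦ a (point τ η) := by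
  have h1 := lt_of_le_of_lt (weightedNorm_lintegral_enorm_le s a) hfin
  filter_upwards [ae_lt_top_of_weightedNorm (measurable_lintegral_enorm ha).aemeasurable h1] with η hη
  exact ⟨(ha.comp (measurable_point_comp measurable_id measurable_const)).aestronglyMeasurable, hη⟩

theorem continuous_fiberInv {a : SpaceTime n → ℂ} {η : Space n}
    (h : Integrable fun τ ↦ a (point τ η)) : Continuous fun t ↦ fiberInv a t η := by
  refine continuous_of_dominated (bound := fun τ ↦ ‖a (point τ η)‖) (fun t ↦ ?_) (fun t ↦ ?_)
    h.norm (ae_of_all _ fun τ ↦ ?_)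
  · exact (continuous_wave_comp (by fun_prop) (by fun_prop)).aestronglyMeasurable.mul h.1
  · exact ae_of_all _ fun τ ↦ by rw [norm_mul, norm_wave, one_mul]
  · exact (continuous_wave_comp (by fun_prop) (by fun_prop)).mul continuous_const

/-- A distribution whose Fourier transform is sufficiently integrable in time frequency is a
continuous curve in the Sobolev space. -/
theorem exists_curve_of_fiberMass {s : ℝ} {a : SpaceTime n → ℂ} (ha : Measurable a)
    (hfin : weightedNorm (s - 1) (fiberMass a) < ∞) {w : 𝓢'(SpaceTime n, ℂ)}
    (hw : IsFunction (𝓕 w) a) : ∃ v : ℝ → 𝓢'(Space n, ℂ), ContinuousSobolev s v ∧ IsCurveOf w v ∧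
      ∀ t, IsFunction (𝓕 (v t)) (fiberInv a t) := by
  have h1 := lt_of_le_of_lt (weightedNorm_lintegral_enorm_le s a) hfin
  have hmaj : LocallyMajorized s (fiberInv a) := fun R ↦
    ⟨_, (measurable_lintegral_enorm ha).aemeasurable, h1,
      ae_of_all _ fun η t _ ↦ enorm_fiberInv_le a t η⟩
  obtain ⟨v, hv⟩ := hmaj.exists_curve fun t ↦ (stronglyMeasurable_fiberInv ha t).aestronglyMeasurable
  refine ⟨v, hmaj.continuousSobolev hv ?_, fun ψ hψ ↦ ?_, hv⟩
  · filter_upwards [ae_integrable_fiber ha hfin] with η hη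
    exact continuous_fiberInv hη
  · obtain ⟨R, -, hR⟩ := exists_slice_eq_zero hψ
    have hm : Measurable fun p : Space n × ℝ ↦ a (point p.2 p.1) :=
      ha.comp (measurable_point_comp measurable_snd measurable_fst)
    -- A function of space-time is a superposition of exponentials e^{iτt} with amplitudes a, which
    -- is a case of the general pairing formula.
    rw [(integral_curve_slice (μ := (volume : Measure ℝ)) (s := s)
      (K := fun η τ t ↦ wave (2 * Real.pi * τ) t * a (point τ η))
      (G := fun η τ ↦ ‖a (point τ η)‖ₑ) ?_ hm.enorm (fun t _ η τ ↦ ?_) h1 hv hR).2]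
    · rw [hw.apply_eq, integral_spaceTime (hw.2 (𝓕⁻ ψ)).1]
      congr 1 with η
      congr 1 with τ
      rw [← integral_wave_mul_partialFT, ← integral_mul_const]
      congr 1 with t
      ring
    · refine Measurable.mul ?_ ?_
      · exact (continuous_wave_comp (by fun_prop) (by fun_prop)).measurable
      · exact hm.comp measurable_snd
    · rw [enorm_mul, ← ofReal_norm, norm_wave]
      simp

end Curves

/-! ### Superpositions of oscillator solutions -/

section SobolevCurves

theorem sobolevNorm_add_le (s : ℝ) (f g : 𝓢'(Space n, ℂ)) :
    sobolevNorm s (f + g) ≤ sobolevNorm s f + sobolevNorm s g := by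
  by_cases hf : sobolevNorm s f = ∞
  · simp [hf]
  by_cases hg : sobolevNorm s g = ∞
  · simp [hg]
  obtain ⟨a, ha, hfa⟩ := exists_isFunction_of_sobolevNorm (lt_top_iff_ne_top.2 hf)
  obtain ⟨b, hb, hgb⟩ := exists_isFunction_of_sobolevNorm (lt_top_iff_ne_top.2 hg)
  rw [sobolevNorm_eq hfa, sobolevNorm_eq hgb, sobolevNorm_eq (hfa.fourier_add hgb)]
  refine (weightedNorm_mono (ae_of_all _ fun η ↦ enorm_add_le _ _)).trans
    (weightedNorm_add_le s ha.measurable.enorm.aemeasurable hb.measurable.enorm.aemeasurable)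

theorem sobolevNorm_neg (s : ℝ) (f : 𝓢'(Space n, ℂ)) : sobolevNorm s (-f) = sobolevNorm s f := by
  have h (f : 𝓢'(Space n, ℂ)) (hf : sobolevNorm s f ≠ ∞) : sobolevNorm s (-f) = sobolevNorm s f := by
    obtain ⟨a, ha, hfa⟩ := exists_isFunction_of_sobolevNorm (lt_top_iff_ne_top.2 hf)
    have := hfa.fourier_smul (-1)
    rw [neg_one_smul ℂ f] at this
    rw [sobolevNorm_eq hfa, sobolevNorm_eq this]
    simp
  by_cases hf : sobolevNorm s f = ∞
  · by_cases hg : sobolevNorm s (-f) = ∞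
    · rw [hf, hg]
    · have := h _ hg
      rw [neg_neg] at this
      exact this.symm
  · exact h f hf

theorem ContinuousSobolev.add {s : ℝ} {u v : ℝ → 𝓢'(Space n, ℂ)} (hu : ContinuousSobolev s u)
    (hv : ContinuousSobolev s v) : ContinuousSobolev s (fun t ↦ u t + v t) := by
  refine ⟨fun t ↦ (sobolevNorm_add_le s _ _).trans_lt (ENNReal.add_lt_top.2 ⟨hu.1 t, hv.1 t⟩),
    fun t₀ ↦ ?_⟩
  refine tendsto_of_tendsto_of_tendsto_of_le_of_le tendsto_const_nhds
    (by simpa using (hu.2 t₀).add (hv.2 t₀)) (fun _ ↦ zero_le) fun t ↦ ?_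
  dsimp only
  rw [add_sub_add_comm]
  exact sobolevNorm_add_le s _ _

theorem ContinuousSobolev.neg {s : ℝ} {u : ℝ → 𝓢'(Space n, ℂ)} (hu : ContinuousSobolev s u) :
    ContinuousSobolev s (fun t ↦ -u t) := by
  refine ⟨fun t ↦ by rw [sobolevNorm_neg]; exact hu.1 t, fun t₀ ↦ (hu.2 t₀).congr fun t ↦ ?_⟩
  rw [← sobolevNorm_neg, neg_sub, neg_sub_neg]

theorem HasSobolevDeriv.add {s : ℝ} {u v u' v' : ℝ → 𝓢'(Space n, ℂ)} (hu : HasSobolevDeriv s u u')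
    (hv : HasSobolevDeriv s v v') :
    HasSobolevDeriv s (fun t ↦ u t + v t) (fun t ↦ u' t + v' t) := by
  intro t₀
  refine tendsto_of_tendsto_of_tendsto_of_le_of_le tendsto_const_nhds
    (by simpa only [add_zero] using (hu t₀).add (hv t₀)) (fun _ ↦ zero_le) fun t ↦ ?_
  dsimp only
  rw [add_sub_add_comm, smul_add, add_sub_add_comm]
  exact sobolevNorm_add_le s _ _

theorem HasSobolevDeriv.neg {s : ℝ} {u u' : ℝ → 𝓢'(Space n, ℂ)} (hu : HasSobolevDeriv s u u') :
    HasSobolevDeriv s (fun t ↦ -u t) (fun t ↦ -u' t) := by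
  intro t₀
  refine (hu t₀).congr fun t ↦ ?_
  rw [← sobolevNorm_neg]
  rw [neg_sub, neg_sub_neg, ← neg_sub (u t), smul_neg, sub_neg_eq_add, neg_add_eq_sub]

/-- Superpositions of solutions `S` of `-S'' - r² S = W` solve a wave equation. -/
theorem exists_superposition {Ω : Type*} [MeasurableSpace Ω] {μ : Measure Ω} [SFinite μ] {s : ℝ}
    {A : Space n → Ω → ℂ} {S S' W : Space n → Ω → ℝ → ℂ} {G : Space n → Ω → ℝ≥0∞}
    (hA : Measurable fun p : Space n × Ω ↦ A p.1 p.2)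
    (hS : Measurable fun p : ℝ × Space n × Ω ↦ S p.2.1 p.2.2 p.1)
    (hS' : Measurable fun p : ℝ × Space n × Ω ↦ S' p.2.1 p.2.2 p.1)
    (hG : Measurable fun p : Space n × Ω ↦ G p.1 p.2)
    (hGs : weightedNorm (s - 1) (fun η ↦ ∫⁻ ω, G η ω ∂μ) < ∞)
    (hd : ∀ η ω t, HasDerivAt (S η ω) (S' η ω t) t)
    (hd' : ∀ η ω t, HasDerivAt (S' η ω)
      (-((((2 * Real.pi * ‖η‖) ^ 2 : ℝ) : ℂ) * S η ω t + W η ω t)) t)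
    (hW : ∀ η ω, Continuous (W η ω))
    (hb : ∀ R : ℝ, ∃ C : ℝ≥0, ∀ t, |t| ≤ R → ∀ η ω,
      ENNReal.ofReal (symLam 1 ((2 * Real.pi) • η)) * ‖A η ω * S η ω t‖ₑ ≤ C * G η ω ∧
        ‖A η ω * S' η ω t‖ₑ ≤ C * G η ω) :
    ∃ u u' : ℝ → 𝓢'(Space n, ℂ), ContinuousSobolev s u ∧ ContinuousSobolev (s - 1) u' ∧
      HasSobolevDeriv (s - 1) u u' ∧
      (∀ t, IsFunction (𝓕 (u t)) (fun η ↦ ∫ ω, A η ω * S η ω t ∂μ)) ∧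
      (∀ t, IsFunction (𝓕 (u' t)) (fun η ↦ ∫ ω, A η ω * S' η ω t ∂μ)) ∧
      ∀ ψ : 𝓢(SpaceTime n, ℂ), HasCompactSupport ψ →
        Integrable (fun t ↦ u t (slice t (box ψ))) ∧
        ∫ t, u t (slice t (box ψ)) =
          ∫ η, ∫ ω, A η ω * (∫ t, W η ω t * partialFT ψ η t) ∂μ := by
  have hG' : Measurable fun η ↦ ∫⁻ ω, G η ω ∂μ := hG.lintegral_prod_right'
  have hmA : Measurable fun p : ℝ × Space n × Ω ↦ A p.2.1 p.2.2 := hA.comp measurable_snd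
  have hmeas {S : Space n → Ω → ℝ → ℂ}
      (hS : Measurable fun p : ℝ × Space n × Ω ↦ S p.2.1 p.2.2 p.1) (t : ℝ) :
      StronglyMeasurable fun η ↦ ∫ ω, A η ω * S η ω t ∂μ := by
    refine StronglyMeasurable.integral_prod_right (ν := μ)
      (f := fun (η : Space n) (ω : Ω) ↦ A η ω * S η ω t) ?_
    exact (hA.mul (hS.comp measurable_prodMk_left)).stronglyMeasurable
  have hsm (b : ℝ) (z : ℝ≥0∞) (η : Space n) {y : ℝ≥0∞}
      (h : ENNReal.ofReal (symLam b ((2 * Real.pi) • η)) * z ≤ y) :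
      z ≤ ENNReal.ofReal (symLam (-b) ((2 * Real.pi) • η)) * y := by
    calc z = ENNReal.ofReal (symLam (-b) ((2 * Real.pi) • η)) *
          (ENNReal.ofReal (symLam b ((2 * Real.pi) • η)) * z) := by
          rw [← mul_assoc, ← ENNReal.ofReal_mul (symLam_pos _ _).le, symLam_mul]
          simp
      _ ≤ _ := by gcongr
  -- S is better than G by one factor Λ, so a bound on G of order s - 1 is a bound on the curve of
  -- order s; S' has no such gain and stays at order s - 1.
  have hmaj : LocallyMajorized s (fun t η ↦ ∫ ω, A η ω * S η ω t ∂μ) := by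
    intro R
    obtain ⟨C, hC⟩ := hb R
    refine ⟨fun η ↦ ENNReal.ofReal (symLam (-1) ((2 * Real.pi) • η)) * (C * ∫⁻ ω, G η ω ∂μ),
      by fun_prop, ?_, ae_of_all _ fun η t ht ↦ ?_⟩
    · rw [weightedNorm_symLam_mul, ← sub_eq_add_neg, weightedNorm_const_mul _ (by simp)]
      exact ENNReal.mul_lt_top (by simp) hGs
    · refine hsm 1 _ η ?_
      calc _ ≤ ENNReal.ofReal (symLam 1 ((2 * Real.pi) • η)) * ∫⁻ ω, ‖A η ω * S η ω t‖ₑ ∂μ := by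
            gcongr
            exact enorm_integral_le_lintegral_enorm _
        _ ≤ ∫⁻ ω, C * G η ω ∂μ := by
            rw [← lintegral_const_mul' _ _ ENNReal.ofReal_ne_top]
            exact lintegral_mono fun ω ↦ (hC t ht η ω).1
        _ = _ := lintegral_const_mul' _ _ (by simp)
  have hmaj' : LocallyMajorized (s - 1) (fun t η ↦ ∫ ω, A η ω * S' η ω t ∂μ) := by
    intro R
    obtain ⟨C, hC⟩ := hb R
    refine ⟨fun η ↦ C * ∫⁻ ω, G η ω ∂μ, by fun_prop, ?_, ae_of_all _ fun η t ht ↦ ?_⟩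
    · rw [weightedNorm_const_mul _ (by simp)]
      exact ENNReal.mul_lt_top (by simp) hGs
    · calc _ ≤ ∫⁻ ω, ‖A η ω * S' η ω t‖ₑ ∂μ := enorm_integral_le_lintegral_enorm _
        _ ≤ ∫⁻ ω, C * G η ω ∂μ := lintegral_mono fun ω ↦ (hC t ht η ω).2
        _ = _ := lintegral_const_mul' _ _ (by simp)
  have hmS (η : Space n) (t : ℝ) {S : Space n → Ω → ℝ → ℂ}
      (hS : Measurable fun p : ℝ × Space n × Ω ↦ S p.2.1 p.2.2 p.1) :
      AEStronglyMeasurable (fun ω ↦ A η ω * S η ω t) μ :=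
    ((hA.comp measurable_prodMk_left).mul
      (hS.comp (measurable_prodMk_left.comp measurable_prodMk_left))).aestronglyMeasurable
  have hbd' (R : ℝ) : ∃ C : ℝ≥0, ∀ η, ∫⁻ ω, G η ω ∂μ < ∞ →
      Integrable (fun ω ↦ (C * G η ω).toReal) μ ∧
      ∀ᵐ ω ∂μ, ∀ t, |t| ≤ R → ‖A η ω * S' η ω t‖ ≤ (C * G η ω).toReal := by
    obtain ⟨C, hC⟩ := hb R
    refine ⟨C, fun η hη ↦ ⟨?_, ?_⟩⟩
    · refine integrable_toReal_of_lintegral_ne_top ?_ ?_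
      · exact ((hG.comp measurable_prodMk_left).const_mul _).aemeasurable
      · rw [lintegral_const_mul' _ _ (by simp)]
        exact (ENNReal.mul_lt_top (by simp) hη).ne
    · filter_upwards [ae_lt_top (hG.comp measurable_prodMk_left) hη.ne] with ω hω t ht
      have := (hC t ht η ω).2
      rw [← ofReal_norm] at this
      exact (ENNReal.ofReal_le_iff_le_toReal (ENNReal.mul_lt_top (by simp) hω).ne).1 this
  have hbd (t : ℝ) (η : Space n) (hη : ∫⁻ ω, G η ω ∂μ < ∞) :
      Integrable (fun ω ↦ A η ω * S η ω t) μ := by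
    obtain ⟨C, hC⟩ := hb |t|
    refine ⟨hmS η t hS, ?_⟩
    refine lt_of_le_of_lt (lintegral_mono (g := fun ω ↦
      ENNReal.ofReal (symLam (-1) ((2 * Real.pi) • η)) * (C * G η ω)) fun ω ↦
      hsm 1 _ η (hC t le_rfl η ω).1) ?_
    rw [lintegral_const_mul' _ _ ENNReal.ofReal_ne_top, lintegral_const_mul' _ _ (by simp)]
    exact ENNReal.mul_lt_top ENNReal.ofReal_lt_top (ENNReal.mul_lt_top (by simp) hη)
  have hfin := ae_lt_top_of_weightedNorm hG'.aemeasurable hGs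
  -- Differentiation under the integral is possible wherever G has finite mass, that is for almost
  -- every η.
  have hder (η : Space n) (hη : ∫⁻ ω, G η ω ∂μ < ∞) (t₀ : ℝ) :
      HasDerivAt (fun t ↦ ∫ ω, A η ω * S η ω t ∂μ) (∫ ω, A η ω * S' η ω t₀ ∂μ) t₀ := by
    obtain ⟨C, hC⟩ := hbd' (|t₀| + 1)
    refine (hasDerivAt_integral_of_dominated_loc_of_deriv_le
      (F' := fun t ω ↦ A η ω * S' η ω t) (Metric.ball_mem_nhds t₀ one_pos)
      (Eventually.of_forall fun t ↦ hmS η t hS) (hbd t₀ η hη) (hmS η t₀ hS') ?_ (hC η hη).1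
      (ae_of_all _ fun ω t _ ↦ (hd η ω t).const_mul _)).2
    filter_upwards [(hC η hη).2] with ω hω t ht
    refine hω t ?_
    rw [Metric.mem_ball, Real.dist_eq] at ht
    linarith [abs_sub_abs_le_abs_sub t t₀]
  have hcont (η : Space n) (hη : ∫⁻ ω, G η ω ∂μ < ∞) :
      Continuous fun t ↦ ∫ ω, A η ω * S' η ω t ∂μ := by
    refine continuous_iff_continuousAt.2 fun t₀ ↦ ?_
    obtain ⟨C, hC⟩ := hbd' (|t₀| + 1)
    refine continuousAt_of_dominated (bound := fun ω ↦ (C * G η ω).toReal)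
      (Eventually.of_forall fun t ↦ hmS η t hS') ?_ (hC η hη).1
      (ae_of_all _ fun ω ↦ continuousAt_const.mul (hd' η ω t₀).continuousAt)
    filter_upwards [Metric.ball_mem_nhds t₀ one_pos] with t ht
    filter_upwards [(hC η hη).2] with ω hω
    refine hω t ?_
    rw [Metric.mem_ball, Real.dist_eq] at ht
    linarith [abs_sub_abs_le_abs_sub t t₀]
  obtain ⟨u, hu⟩ := hmaj.exists_curve fun t ↦ (hmeas hS t).aestronglyMeasurable
  obtain ⟨u', hu'⟩ := hmaj'.exists_curve fun t ↦ (hmeas hS' t).aestronglyMeasurable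
  refine ⟨u, u', hmaj.continuousSobolev hu ?_, hmaj'.continuousSobolev hu' ?_,
    hmaj'.hasSobolevDeriv hu hu' ?_, hu, hu', fun ψ hψ ↦ ?_⟩
  · filter_upwards [hfin] with η hη
    exact continuous_iff_continuousAt.2 fun t ↦ (hder η hη t).continuousAt
  · filter_upwards [hfin] with η hη
    exact hcont η hη
  · filter_upwards [hfin] with η hη
    exact hder η hη
  · obtain ⟨R, -, hR⟩ := exists_slice_eq_zero (hasCompactSupport_box hψ)
    obtain ⟨C, hC⟩ := hb R
    have key := integral_curve_slice (μ := μ) (s := s) (K := fun η ω t ↦ A η ω * S η ω t)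
      (G := fun η ω ↦ ENNReal.ofReal (symLam (-1) ((2 * Real.pi) • η)) * (C * G η ω))
      (hmA.mul hS) (by fun_prop) (fun t ht η ω ↦ hsm 1 _ η (hC t ht η ω).1) ?_ hu hR
    · refine ⟨key.1, key.2.trans ?_⟩
      congr 1 with η
      congr 1 with ω
      simp_rw [mul_assoc]
      -- The derivatives are moved from the test function to S, where only the source W survives.
      rw [integral_const_mul, integral_mul_partialFT_box hψ η (hd η ω) (hd' η ω)]
      · congr 2 with t
        ring
      · have c0 : Continuous (S η ω) := continuous_iff_continuousAt.2 fun t ↦ (hd η ω t).continuousAt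
        exact ((continuous_const.mul c0).add (hW η ω)).neg
    · simp_rw [lintegral_const_mul' _ _ ENNReal.ofReal_ne_top,
        lintegral_const_mul' _ _ (ENNReal.coe_ne_top (r := C))]
      rw [weightedNorm_symLam_mul, ← sub_eq_add_neg, weightedNorm_const_mul _ (by simp)]
      exact ENNReal.mul_lt_top (by simp) hGs

end SobolevCurves

/-! ### Existence for the Cauchy problem -/

section Existence

/-- Near the cone Λ₋ is bounded and the uniform bound, with its gain 1/(1 + r), suffices. Away from
it, dividing by λ² - r² gains Λ₊Λ₋; of this Λ₊ either pays for Λ or compensates the factor |λ| of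
the free part, whose `sinKer` then pays for Λ. -/
theorem symLam_mul_symMinus_mul_norm_duhamel_le (lam t : ℝ) (ξ : Space n) :
    symLam 1 ξ * symMinus 1 lam ξ * ‖duhamel lam ‖ξ‖ t‖ ≤ 6 * (1 + |t|) ^ 2 := by
  have hL := symLam_pos 1 ξ
  have hM := symMinus_pos 1 lam ξ
  have hP := symPlus_pos 1 lam ξ
  have hE := norm_nonneg (duhamel lam ‖ξ‖ t)
  have ht := abs_nonneg t
  rcases le_total (symMinus 1 lam ξ) 2 with h | h
  · have h1 := mul_norm_duhamel_le (norm_nonneg ξ) lam t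
    calc symLam 1 ξ * symMinus 1 lam ξ * ‖duhamel lam ‖ξ‖ t‖
        ≤ (1 + ‖ξ‖) * 2 * ‖duhamel lam ‖ξ‖ t‖ := by
          gcongr
          exact symLam_one_le ξ
      _ = 2 * ((1 + ‖ξ‖) * ‖duhamel lam ‖ξ‖ t‖) := by ring
      _ ≤ 2 * (2 * (1 + |t|) * |t|) := by gcongr
      _ ≤ _ := by nlinarith
  · have h1 := mul_le_abs_sq_sub_sq h
    have h2 := congrArg norm (mul_duhamel lam ‖ξ‖ t)
    have h3 : ‖(lam : ℂ) ^ 2 - (‖ξ‖ : ℂ) ^ 2‖ = |lam ^ 2 - ‖ξ‖ ^ 2| := by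
      rw [← Real.norm_eq_abs, ← Complex.norm_real]
      push_cast
      rfl
    rw [norm_mul, h3] at h2
    have h4 : |lam ^ 2 - ‖ξ‖ ^ 2| * ‖duhamel lam ‖ξ‖ t‖ ≤ 2 + |lam| * |sinKer ‖ξ‖ t| := by
      rw [h2]
      refine (norm_sub_le _ _).trans (add_le_add ((norm_sub_le _ _).trans ?_) ?_)
      · rw [norm_wave, Complex.norm_real]
        have := Real.abs_cos_le_one (‖ξ‖ * t)
        rw [Real.norm_eq_abs]
        linarith
      · rw [norm_mul, norm_mul, Complex.norm_I, one_mul, Complex.norm_real, Complex.norm_real,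
          Real.norm_eq_abs, Real.norm_eq_abs]
    have h5 := abs_le_symPlus_one lam ξ
    have h6 := symLam_one_le_symPlus_one lam ξ
    have h7 := mul_abs_sinKer_le (norm_nonneg ξ) t
    have h8 : symLam 1 ξ * |sinKer ‖ξ‖ t| ≤ 1 + |t| :=
      le_trans (by gcongr; exact symLam_one_le ξ) h7
    have h9 : symPlus 1 lam ξ * (symLam 1 ξ * symMinus 1 lam ξ * ‖duhamel lam ‖ξ‖ t‖) ≤
        symPlus 1 lam ξ * (6 * (1 + |t|) ^ 2) := by
      calc _ = symLam 1 ξ * (symPlus 1 lam ξ * symMinus 1 lam ξ) * ‖duhamel lam ‖ξ‖ t‖ := by ring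
        _ ≤ symLam 1 ξ * (2 * |lam ^ 2 - ‖ξ‖ ^ 2|) * ‖duhamel lam ‖ξ‖ t‖ := by gcongr
        _ = 2 * symLam 1 ξ * (|lam ^ 2 - ‖ξ‖ ^ 2| * ‖duhamel lam ‖ξ‖ t‖) := by ring
        _ ≤ 2 * symLam 1 ξ * (2 + |lam| * |sinKer ‖ξ‖ t|) := by gcongr
        _ = 2 * (2 * symLam 1 ξ + |lam| * (symLam 1 ξ * |sinKer ‖ξ‖ t|)) := by ring
        _ ≤ 2 * (2 * symPlus 1 lam ξ + symPlus 1 lam ξ * (1 + |t|)) := by gcongr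
        _ = symPlus 1 lam ξ * (6 + 2 * |t|) := by ring
        _ ≤ _ := by gcongr; nlinarith
    exact le_of_mul_le_mul_left h9 hP

/-- The same dichotomy; the numerator now has the size of |λ| + |ξ|, which uses up Λ₊. -/
theorem symMinus_mul_norm_duhamelDeriv_le (lam t : ℝ) (ξ : Space n) :
    symMinus 1 lam ξ * ‖duhamelDeriv lam ‖ξ‖ t‖ ≤ 6 * (1 + |t|) ^ 2 := by
  have hM := symMinus_pos 1 lam ξ
  have hP := symPlus_pos 1 lam ξ
  have hE := norm_nonneg (duhamelDeriv lam ‖ξ‖ t)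
  have ht := abs_nonneg t
  rcases le_total (symMinus 1 lam ξ) 2 with h | h
  · have h1 := norm_duhamelDeriv_le (norm_nonneg ξ) lam t
    calc symMinus 1 lam ξ * ‖duhamelDeriv lam ‖ξ‖ t‖ ≤ 2 * (2 * (1 + |t|) * |t|) := by gcongr
      _ ≤ _ := by nlinarith
  · have h1 := mul_le_abs_sq_sub_sq h
    have h2 := congrArg norm (mul_duhamelDeriv lam ‖ξ‖ t)
    have h3 : ‖(lam : ℂ) ^ 2 - (‖ξ‖ : ℂ) ^ 2‖ = |lam ^ 2 - ‖ξ‖ ^ 2| := by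
      rw [← Real.norm_eq_abs, ← Complex.norm_real]
      push_cast
      rfl
    rw [norm_mul, h3] at h2
    have hs : (‖ξ‖ : ℂ) ^ 2 * (sinKer ‖ξ‖ t : ℝ) = (‖ξ‖ * Real.sin (‖ξ‖ * t) : ℝ) := by
      rw [← mul_sinKer]
      push_cast
      ring
    have h4 : |lam ^ 2 - ‖ξ‖ ^ 2| * ‖duhamelDeriv lam ‖ξ‖ t‖ ≤ |lam| + ‖ξ‖ + |lam| := by
      rw [h2, hs]
      refine (norm_sub_le _ _).trans (add_le_add ((norm_add_le _ _).trans (add_le_add ?_ ?_)) ?_)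
      · rw [norm_mul, norm_mul, norm_wave, Complex.norm_I, one_mul, mul_one, Complex.norm_real,
          Real.norm_eq_abs]
      · rw [Complex.norm_real, norm_mul, norm_norm]
        exact mul_le_of_le_one_right (norm_nonneg _) (Real.abs_sin_le_one _)
      · rw [norm_mul, norm_mul, Complex.norm_I, one_mul, Complex.norm_real, Complex.norm_real,
          Real.norm_eq_abs, Real.norm_eq_abs]
        exact mul_le_of_le_one_right (abs_nonneg _) (Real.abs_cos_le_one _)
    have h5 := abs_le_symPlus_one lam ξ
    have h6 := (norm_le_symLam_one ξ).trans (symLam_one_le_symPlus_one lam ξ)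
    have h9 : symPlus 1 lam ξ * (symMinus 1 lam ξ * ‖duhamelDeriv lam ‖ξ‖ t‖) ≤
        symPlus 1 lam ξ * (6 * (1 + |t|) ^ 2) := by
      calc _ = (symPlus 1 lam ξ * symMinus 1 lam ξ) * ‖duhamelDeriv lam ‖ξ‖ t‖ := by ring
        _ ≤ (2 * |lam ^ 2 - ‖ξ‖ ^ 2|) * ‖duhamelDeriv lam ‖ξ‖ t‖ := by gcongr
        _ = 2 * (|lam ^ 2 - ‖ξ‖ ^ 2| * ‖duhamelDeriv lam ‖ξ‖ t‖) := by ring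
        _ ≤ symPlus 1 lam ξ * 6 := by linarith
        _ ≤ _ := by gcongr; nlinarith
    exact le_of_mul_le_mul_left h9 hP

/-- The Fourier transform of `□̃ Λ₋^{-ε} u` in terms of the one of `u`. -/
def forcing (ε : ℝ) (a : SpaceTime n → ℂ) (ζ : SpaceTime n) : ℂ :=
  ((symPlus 1 (2 * Real.pi * ζ.fst) ((2 * Real.pi) • ζ.snd) *
    symMinus (1 - ε) (2 * Real.pi * ζ.fst) ((2 * Real.pi) • ζ.snd) : ℝ) : ℂ) * a ζ

theorem isFunction_forcing (ε : ℝ) {w : 𝓢'(SpaceTime n, ℂ)} {a : SpaceTime n → ℂ}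
    (h : IsFunction (𝓕 w) a) : IsFunction (𝓕 (boxTilde (lamMinus (-ε) w))) (forcing ε a) := by
  have h1 := ((h.fourierMultiplier (hasTemperateGrowth_symMinus (-ε))).fourierMultiplier
    (hasTemperateGrowth_symMinus 1)).fourierMultiplier (hasTemperateGrowth_symPlus 1)
  refine h1.congr (ae_of_all _ fun ζ ↦ ?_)
  dsimp only
  rw [forcing, sub_eq_add_neg 1 ε, ← symMinus_mul]
  push_cast
  ring

theorem measurable_forcing (ε : ℝ) {a : SpaceTime n → ℂ} (ha : Measurable a) :
    Measurable (forcing ε a) := by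
  unfold forcing
  have h1 := measurable_fst_spaceTime (n := n)
  have h2 := measurable_snd_spaceTime (n := n)
  fun_prop

theorem norm_forcing (ε : ℝ) (a : SpaceTime n → ℂ) (τ : ℝ) (η : Space n) :
    ‖forcing ε a (point τ η)‖ = symPlus 1 (2 * Real.pi * τ) ((2 * Real.pi) • η) *
      symMinus (1 - ε) (2 * Real.pi * τ) ((2 * Real.pi) • η) * ‖a (point τ η)‖ := by
  rw [forcing, norm_mul, Complex.norm_real, Real.norm_of_nonneg
    (mul_nonneg (symPlus_pos _ _ _).le (symMinus_pos _ _ _).le), point_fst, point_snd]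

theorem norm_two_pi_smul (η : Space n) : ‖(2 * Real.pi) • η‖ = 2 * Real.pi * ‖η‖ := by
  rw [norm_smul, Real.norm_of_nonneg (by positivity)]

theorem norm_forcing_le {ε : ℝ} (hε : 0 ≤ ε) (a : SpaceTime n → ℂ) (τ : ℝ) (η : Space n) :
    ‖forcing ε a (point τ η)‖ ≤ symPlus 1 (2 * Real.pi * τ) ((2 * Real.pi) • η) *
      symMinus 1 (2 * Real.pi * τ) ((2 * Real.pi) • η) * ‖a (point τ η)‖ := by
  rw [norm_forcing]
  have := symPlus_pos 1 (2 * Real.pi * τ) ((2 * Real.pi) • η)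
  gcongr
  exact symMinus_mono (by linarith) _ _

theorem hasDerivAt_neg_mul_sin (r t : ℝ) :
    HasDerivAt (fun t : ℝ ↦ -(r * Real.sin (r * t))) (-(r ^ 2 * Real.cos (r * t))) t := by
  have h1 : HasDerivAt (fun t : ℝ ↦ Real.sin (r * t)) (r * Real.cos (r * t)) t := by
    have := ((hasDerivAt_id t).const_mul r).sin
    simp only [id, mul_one] at this
    convert this using 1
    ring
  exact (h1.const_mul r).neg.congr_deriv (by ring)

theorem exists_solution_cos {s : ℝ} {b : Space n → ℂ} (hb : Measurable b)
    (hs : weightedNorm s (fun η ↦ ‖b η‖ₑ) < ∞) :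
    ∃ u u' : ℝ → 𝓢'(Space n, ℂ), ContinuousSobolev s u ∧ ContinuousSobolev (s - 1) u' ∧
      HasSobolevDeriv (s - 1) u u' ∧
      (∀ t, IsFunction (𝓕 (u t)) (fun η ↦ b η * (Real.cos (2 * Real.pi * ‖η‖ * t) : ℝ))) ∧
      (∀ t, IsFunction (𝓕 (u' t)) (fun η ↦
        b η * (-(2 * Real.pi * ‖η‖ * Real.sin (2 * Real.pi * ‖η‖ * t)) : ℝ))) ∧
      ∀ ψ : 𝓢(SpaceTime n, ℂ), HasCompactSupport ψ →
        Integrable (fun t ↦ u t (slice t (box ψ))) ∧ ∫ t, u t (slice t (box ψ)) = 0 := by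
  -- A one-point parameter space: there is a single mode for each η and no forcing. The weight Λ in
  -- G raises order s - 1 to the order s of the datum.
  have key := exists_superposition (μ := Measure.dirac ()) (s := s) (A := fun η _ ↦ b η)
    (S := fun η _ t ↦ (Real.cos (2 * Real.pi * ‖η‖ * t) : ℝ))
    (S' := fun η _ t ↦ (-(2 * Real.pi * ‖η‖ * Real.sin (2 * Real.pi * ‖η‖ * t)) : ℝ))
    (W := fun _ _ _ ↦ 0)
    (G := fun η _ ↦ ENNReal.ofReal (symLam 1 ((2 * Real.pi) • η)) * ‖b η‖ₑ)
    (by fun_prop) (by fun_prop) (by fun_prop) (by fun_prop) ?_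
    (fun η _ t ↦ (hasDerivAt_cos_mul _ t).ofReal_comp)
    (fun η _ t ↦ (hasDerivAt_neg_mul_sin _ t).ofReal_comp.congr_deriv (by push_cast; ring))
    (fun _ _ ↦ continuous_const) (fun R ↦ ⟨1, fun t _ η _ ↦ ⟨?_, ?_⟩⟩)
  · simpa using key
  · simp only [lintegral_dirac]
    rw [weightedNorm_symLam_mul, sub_add_cancel]
    exact hs
  · rw [ENNReal.coe_one, one_mul, enorm_mul]
    gcongr
    refine mul_le_of_le_one_right' ?_
    rw [← ofReal_norm, Complex.norm_real]
    exact ENNReal.ofReal_le_one.2 (Real.abs_cos_le_one _)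
  · rw [ENNReal.coe_one, one_mul, enorm_mul, mul_comm]
    gcongr
    rw [← ofReal_norm, Complex.norm_real]
    refine ENNReal.ofReal_le_ofReal ?_
    rw [norm_neg, norm_mul, ← norm_two_pi_smul, norm_norm]
    exact (mul_le_of_le_one_right (norm_nonneg _) (Real.abs_sin_le_one _)).trans
      (norm_le_symLam_one _)

theorem exists_solution_sinKer {s : ℝ} {b : Space n → ℂ} (hb : Measurable b)
    (hs : weightedNorm (s - 1) (fun η ↦ ‖b η‖ₑ) < ∞) :
    ∃ u u' : ℝ → 𝓢'(Space n, ℂ), ContinuousSobolev s u ∧ ContinuousSobolev (s - 1) u' ∧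
      HasSobolevDeriv (s - 1) u u' ∧
      (∀ t, IsFunction (𝓕 (u t)) (fun η ↦ b η * (sinKer (2 * Real.pi * ‖η‖) t : ℝ))) ∧
      (∀ t, IsFunction (𝓕 (u' t)) (fun η ↦ b η * (Real.cos (2 * Real.pi * ‖η‖ * t) : ℝ))) ∧
      ∀ ψ : 𝓢(SpaceTime n, ℂ), HasCompactSupport ψ →
        Integrable (fun t ↦ u t (slice t (box ψ))) ∧ ∫ t, u t (slice t (box ψ)) = 0 := by
  have key := exists_superposition (μ := Measure.dirac ()) (s := s) (A := fun η _ ↦ b η)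
    (S := fun η _ t ↦ (sinKer (2 * Real.pi * ‖η‖) t : ℝ))
    (S' := fun η _ t ↦ (Real.cos (2 * Real.pi * ‖η‖ * t) : ℝ))
    (W := fun _ _ _ ↦ 0) (G := fun η _ ↦ ‖b η‖ₑ)
    (by fun_prop) ?_ (by fun_prop) (by fun_prop) (by simpa using hs)
    (fun η _ t ↦ (hasDerivAt_sinKer _ t).ofReal_comp)
    (fun η _ t ↦ (hasDerivAt_cos_mul _ t).ofReal_comp.congr_deriv ?_)
    (fun _ _ ↦ continuous_const)
    -- The constant is that of `mul_abs_sinKer_le` for |t| ≤ R.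
    (fun R ↦ ⟨Real.toNNReal (1 + R), fun t ht η _ ↦ ⟨?_, ?_⟩⟩)
  · simpa using key
  · exact Complex.measurable_ofReal.comp
      (continuous_sinKer_comp (by fun_prop) (by fun_prop)).measurable
  · rw [← mul_sinKer]
    push_cast
    ring
  · rw [enorm_mul, mul_left_comm, mul_comm (ENNReal.ofNNReal _)]
    gcongr
    rw [← ofReal_norm, Complex.norm_real, ← ENNReal.ofReal_mul (symLam_pos _ _).le]
    refine ENNReal.ofReal_le_ofReal ?_
    rw [← norm_two_pi_smul]
    calc _ ≤ (1 + ‖(2 * Real.pi) • η‖) * |sinKer ‖(2 * Real.pi) • η‖ t| := by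
          rw [Real.norm_eq_abs]
          gcongr
          exact symLam_one_le _
      _ ≤ 1 + |t| := mul_abs_sinKer_le (norm_nonneg _) t
      _ ≤ 1 + R := by linarith
  · have h1 : (1 : ℝ≥0∞) ≤ (Real.toNNReal (1 + R) : ℝ≥0∞) := by
      have := (abs_nonneg t).trans ht
      rw [← ENNReal.ofReal_one]
      exact ENNReal.ofReal_le_ofReal (by linarith)
    refine le_trans ?_ (mul_le_mul_left h1 _)
    rw [one_mul, enorm_mul]
    refine mul_le_of_le_one_right' ?_
    rw [← ofReal_norm, Complex.norm_real]
    exact ENNReal.ofReal_le_one.2 (Real.abs_cos_le_one _)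

/-- The majorant Λ₊|a| has `fiberMass` as its integral. The other factor of the forcing, Λ₋^{1-ε} ≤
Λ₋, is absorbed by the gain of the kernel. -/
theorem exists_solution_duhamel {s ε : ℝ} (hε : 0 ≤ ε) {a : SpaceTime n → ℂ} (ha : Measurable a)
    (hs : weightedNorm (s - 1) (fiberMass a) < ∞) {F : 𝓢'(SpaceTime n, ℂ)}
    (hF : IsFunction (𝓕 F) (forcing ε a)) :
    ∃ u u' : ℝ → 𝓢'(Space n, ℂ), ContinuousSobolev s u ∧ ContinuousSobolev (s - 1) u' ∧
      HasSobolevDeriv (s - 1) u u' ∧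
      (∀ t, IsFunction (𝓕 (u t)) (fun η ↦ ∫ τ, forcing ε a (point τ η) *
        duhamel (2 * Real.pi * τ) (2 * Real.pi * ‖η‖) t)) ∧
      (∀ t, IsFunction (𝓕 (u' t)) (fun η ↦ ∫ τ, forcing ε a (point τ η) *
        duhamelDeriv (2 * Real.pi * τ) (2 * Real.pi * ‖η‖) t)) ∧
      ∀ ψ : 𝓢(SpaceTime n, ℂ), HasCompactSupport ψ →
        Integrable (fun t ↦ u t (slice t (box ψ))) ∧ ∫ t, u t (slice t (box ψ)) = F ψ := by
  have hmp : Measurable fun p : Space n × ℝ ↦ point p.2 p.1 :=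
    measurable_point_comp measurable_snd measurable_fst
  have hma : Measurable fun p : Space n × ℝ ↦ ‖a (point p.2 p.1)‖ₑ := (ha.comp hmp).enorm
  have key := exists_superposition (μ := (volume : Measure ℝ)) (s := s)
    (A := fun η τ ↦ forcing ε a (point τ η))
    (S := fun η τ t ↦ duhamel (2 * Real.pi * τ) (2 * Real.pi * ‖η‖) t)
    (S' := fun η τ t ↦ duhamelDeriv (2 * Real.pi * τ) (2 * Real.pi * ‖η‖) t)
    (W := fun _ τ t ↦ wave (2 * Real.pi * τ) t)
    (G := fun η τ ↦ ENNReal.ofReal (symPlus 1 (2 * Real.pi * τ) ((2 * Real.pi) • η)) *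
      ‖a (point τ η)‖ₑ)
    ((measurable_forcing ε ha).comp hmp)
    (continuous_duhamel.comp (f := fun p : ℝ × Space n × ℝ ↦
      (2 * Real.pi * p.2.2, 2 * Real.pi * ‖p.2.1‖, p.1)) (by fun_prop)).measurable
    (continuous_duhamelDeriv.comp (f := fun p : ℝ × Space n × ℝ ↦
      (2 * Real.pi * p.2.2, 2 * Real.pi * ‖p.2.1‖, p.1)) (by fun_prop)).measurable
    (by fun_prop) hs (fun η τ t ↦ hasDerivAt_duhamel _ _ t)
    (fun η τ t ↦ (hasDerivAt_duhamelDeriv _ _ t).congr_deriv (by push_cast; ring))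
    (fun _ τ ↦ continuous_wave_right _)
    (fun R ↦ ⟨Real.toNNReal (6 * (1 + R) ^ 2), fun t ht η τ ↦ ⟨?_, ?_⟩⟩)
  · obtain ⟨u, u', h1, h2, h3, h4, h5, h6⟩ := key
    refine ⟨u, u', h1, h2, h3, h4, h5, fun ψ hψ ↦ ⟨(h6 ψ hψ).1, ?_⟩⟩
    rw [(h6 ψ hψ).2, hF.apply_eq, integral_spaceTime (hF.2 (𝓕⁻ ψ)).1]
    congr 1 with η
    congr 1 with τ
    rw [integral_wave_mul_partialFT, mul_comm]
  · rw [← norm_two_pi_smul, ← ofReal_norm, ← ofReal_norm]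
    change _ ≤ ENNReal.ofReal _ * _
    rw [← ENNReal.ofReal_mul (symLam_pos _ _).le, ← ENNReal.ofReal_mul (symPlus_pos _ _ _).le,
      ← ENNReal.ofReal_mul (by positivity), norm_mul]
    refine ENNReal.ofReal_le_ofReal ?_
    have hP := symPlus_pos 1 (2 * Real.pi * τ) ((2 * Real.pi) • η)
    have hL := symLam_pos 1 ((2 * Real.pi) • η)
    have hR := (abs_nonneg t).trans ht
    calc _ ≤ symLam 1 ((2 * Real.pi) • η) * (symPlus 1 (2 * Real.pi * τ) ((2 * Real.pi) • η) *
          symMinus 1 (2 * Real.pi * τ) ((2 * Real.pi) • η) * ‖a (point τ η)‖ *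
          ‖duhamel (2 * Real.pi * τ) ‖(2 * Real.pi) • η‖ t‖) := by
          gcongr
          exact norm_forcing_le hε a τ η
      _ = symPlus 1 (2 * Real.pi * τ) ((2 * Real.pi) • η) * ‖a (point τ η)‖ *
          (symLam 1 ((2 * Real.pi) • η) * symMinus 1 (2 * Real.pi * τ) ((2 * Real.pi) • η) *
          ‖duhamel (2 * Real.pi * τ) ‖(2 * Real.pi) • η‖ t‖) := by ring
      _ ≤ symPlus 1 (2 * Real.pi * τ) ((2 * Real.pi) • η) * ‖a (point τ η)‖ *
          (6 * (1 + R) ^ 2) := by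
          refine mul_le_mul_of_nonneg_left ?_ (by positivity)
          exact (symLam_mul_symMinus_mul_norm_duhamel_le _ t _).trans (by gcongr)
      _ = _ := by ring
  · rw [← norm_two_pi_smul, ← ofReal_norm, ← ofReal_norm]
    change _ ≤ ENNReal.ofReal _ * _
    rw [← ENNReal.ofReal_mul (symPlus_pos _ _ _).le,
      ← ENNReal.ofReal_mul (by positivity), norm_mul]
    refine ENNReal.ofReal_le_ofReal ?_
    have hP := symPlus_pos 1 (2 * Real.pi * τ) ((2 * Real.pi) • η)
    have hR := (abs_nonneg t).trans ht
    calc _ ≤ (symPlus 1 (2 * Real.pi * τ) ((2 * Real.pi) • η) *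
          symMinus 1 (2 * Real.pi * τ) ((2 * Real.pi) • η) * ‖a (point τ η)‖ *
          ‖duhamelDeriv (2 * Real.pi * τ) ‖(2 * Real.pi) • η‖ t‖) := by
          gcongr
          exact norm_forcing_le hε a τ η
      _ = symPlus 1 (2 * Real.pi * τ) ((2 * Real.pi) • η) * ‖a (point τ η)‖ *
          (symMinus 1 (2 * Real.pi * τ) ((2 * Real.pi) • η) *
          ‖duhamelDeriv (2 * Real.pi * τ) ‖(2 * Real.pi) • η‖ t‖) := by ring
      _ ≤ symPlus 1 (2 * Real.pi * τ) ((2 * Real.pi) • η) * ‖a (point τ η)‖ *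
          (6 * (1 + R) ^ 2) := by
          refine mul_le_mul_of_nonneg_left ?_ (by positivity)
          exact (symMinus_mul_norm_duhamelDeriv_le _ t _).trans (by gcongr)
      _ = _ := by ring

/-- Existence for the Cauchy problem, with the Fourier transform of the solution. -/
theorem exists_solvesCauchy {s ε : ℝ} (hε : 0 ≤ ε) {f g : 𝓢'(Space n, ℂ)} {b c : Space n → ℂ}
    (hb : Measurable b) (hc : Measurable c) (hf : IsFunction (𝓕 f) b) (hg : IsFunction (𝓕 g) c)
    (hfs : sobolevNorm s f < ∞) (hgs : sobolevNorm (s - 1) g < ∞)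
    {a : SpaceTime n → ℂ} (ha : Measurable a) (hs : weightedNorm (s - 1) (fiberMass a) < ∞)
    {F : 𝓢'(SpaceTime n, ℂ)} (hF : IsFunction (𝓕 F) (forcing ε a)) :
    ∃ u : ℝ → 𝓢'(Space n, ℂ), SolvesCauchy s f g F u ∧ ∀ t, IsFunction (𝓕 (u t)) (fun η ↦
      b η * (Real.cos (2 * Real.pi * ‖η‖ * t) : ℝ) + c η * (sinKer (2 * Real.pi * ‖η‖) t : ℝ) +
        ∫ τ, forcing ε a (point τ η) * duhamel (2 * Real.pi * τ) (2 * Real.pi * ‖η‖) t) := by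
  rw [sobolevNorm_eq hf] at hfs
  rw [sobolevNorm_eq hg] at hgs
  obtain ⟨u₁, u₁', p₁, q₁, d₁, i₁, j₁, w₁⟩ := exists_solution_cos hb hfs
  obtain ⟨u₂, u₂', p₂, q₂, d₂, i₂, j₂, w₂⟩ := exists_solution_sinKer hc hgs
  obtain ⟨u₃, u₃', p₃, q₃, d₃, i₃, j₃, w₃⟩ := exists_solution_duhamel hε ha hs hF
  have hi (t : ℝ) := ((i₁ t).fourier_add (i₂ t)).fourier_add (i₃ t)
  have hj (t : ℝ) := ((j₁ t).fourier_add (j₂ t)).fourier_add (j₃ t)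
  refine ⟨fun t ↦ u₁ t + u₂ t + u₃ t, ⟨(p₁.add p₂).add p₃, ⟨fun t ↦ u₁' t + u₂' t + u₃' t,
    (q₁.add q₂).add q₃, (d₁.add d₂).add d₃, ?_⟩, ?_, fun ψ hψ ↦ ?_⟩, hi⟩
  · refine (hj 0).fourier_ext hg (ae_of_all _ fun η ↦ ?_)
    simp [duhamelDeriv_zero]
  · refine (hi 0).fourier_ext hf (ae_of_all _ fun η ↦ ?_)
    simp [duhamel_zero]
  · have e (t : ℝ) : (u₁ t + u₂ t + u₃ t) (slice t (box ψ)) = u₁ t (slice t (box ψ)) +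
      u₂ t (slice t (box ψ)) + u₃ t (slice t (box ψ)) := rfl
    simp_rw [e]
    rw [integral_add (f := fun t ↦ u₁ t (slice t (box ψ)) + u₂ t (slice t (box ψ)))
      ((w₁ ψ hψ).1.add (w₂ ψ hψ).1) (w₃ ψ hψ).1, integral_add (w₁ ψ hψ).1 (w₂ ψ hψ).1,
      (w₁ ψ hψ).2, (w₂ ψ hψ).2, (w₃ ψ hψ).2]
    simp

end Existence

/-! ### Density of compactly supported test functions -/

section CompactSupportDense

variable {E : Type*} [NormedAddCommGroup E] [InnerProductSpace ℝ E] [FiniteDimensional ℝ E]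

/-- Derivatives of positive order carry a factor δ by the chain rule. At order zero the difference
vanishes unless δ‖x‖ ≥ 1, and the factor 1 + ‖x‖ makes up for the missing smallness. -/
theorem exists_norm_iteratedFDeriv_dilation_sub_one_le (χ : ContDiffBump (0 : E)) (hχ : χ.rIn = 1)
    (i : ℕ) : ∃ B : ℝ, 0 ≤ B ∧ ∀ δ : ℝ, 0 < δ → δ ≤ 1 → ∀ x : E,
      ‖iteratedFDeriv ℝ i (fun x ↦ χ (δ • x) - 1) x‖ ≤ B * δ * (1 + ‖x‖) := by
  let X : 𝓢(E, ℝ) := χ.hasCompactSupport.toSchwartzMap χ.contDiff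
  refine ⟨SchwartzMap.seminorm ℝ 0 i X + 1, by positivity, fun δ hδ hδ1 x ↦ ?_⟩
  rcases Nat.eq_zero_or_pos i with rfl | hi
  · rw [norm_iteratedFDeriv_zero]
    have hp : 0 ≤ SchwartzMap.seminorm ℝ 0 0 X := by positivity
    have h1 : ‖χ (δ • x) - 1‖ ≤ δ * ‖x‖ := by
      rcases le_total (δ * ‖x‖) 1 with h | h
      · rw [χ.one_of_mem_closedBall]
        · simp only [sub_self, norm_zero]
          positivity
        · rwa [mem_closedBall_zero_iff, norm_smul, Real.norm_of_nonneg hδ.le, hχ]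
      · refine le_trans ?_ h
        rw [Real.norm_eq_abs, abs_le]
        constructor <;> linarith [χ.nonneg (x := δ • x), χ.le_one (x := δ • x)]
    have h2 : 0 ≤ SchwartzMap.seminorm ℝ 0 0 X * δ * (1 + ‖x‖) := by positivity
    linarith [mul_nonneg hδ.le (norm_nonneg x)]
  · have hs : ContDiff ℝ i (fun x : E ↦ χ (δ • x)) := χ.contDiff.comp (contDiff_const_smul δ)
    have e : (fun x : E ↦ χ (δ • x) - 1) = (fun x : E ↦ χ (δ • x)) - fun _ ↦ (1 : ℝ) := rfl
    rw [e, iteratedFDeriv_sub_apply hs.contDiffAt contDiff_const.contDiffAt,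
      iteratedFDeriv_const_of_ne hi.ne']
    simp only [Pi.zero_apply, sub_zero]
    have h1 := (δ • ContinuousLinearMap.id ℝ E).iteratedFDeriv_comp_right
      (f := (χ : E → ℝ)) (n := i) (i := i) (χ.contDiff) x le_rfl
    have e2 : (χ : E → ℝ) ∘ (δ • ContinuousLinearMap.id ℝ E) = fun x : E ↦ χ (δ • x) := rfl
    rw [← e2, h1]
    have h2 : ‖δ • ContinuousLinearMap.id ℝ E‖ ≤ δ := by
      refine ContinuousLinearMap.opNorm_le_bound _ hδ.le fun y ↦ ?_
      simp [norm_smul, abs_of_pos hδ]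
    have h3 := SchwartzMap.le_seminorm ℝ 0 i X ((δ • ContinuousLinearMap.id ℝ E) x)
    rw [pow_zero, one_mul] at h3
    refine (ContinuousMultilinearMap.norm_compContinuousLinearMap_le _ _).trans ?_
    rw [Finset.prod_const, Finset.card_univ, Fintype.card_fin]
    have h4 : ‖δ • ContinuousLinearMap.id ℝ E‖ ^ i ≤ δ := by
      calc _ ≤ δ ^ i := by gcongr
        _ ≤ δ ^ 1 := pow_le_pow_of_le_one hδ.le hδ1 hi
        _ = δ := pow_one δ
    calc _ ≤ SchwartzMap.seminorm ℝ 0 i X * δ := mul_le_mul h3 h4 (by positivity) (by positivity)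
      _ ≤ (SchwartzMap.seminorm ℝ 0 i X + 1) * δ * (1 + 0) := by nlinarith
      _ ≤ _ := by gcongr; exact norm_nonneg x

/-- Compactly supported functions are dense in the Schwartz space. -/
theorem exists_compactSupport_tendsto (φ : 𝓢(E, ℂ)) : ∃ φs : ℕ → 𝓢(E, ℂ),
    (∀ k, HasCompactSupport (φs k)) ∧ Tendsto φs atTop (𝓝 φ) := by
  let χ : ContDiffBump (0 : E) := ⟨1, 2, one_pos, by norm_num⟩
  have hc (k : ℕ) : HasCompactSupport fun x : E ↦ χ ((1 / ((k : ℝ) + 1)) • x) := by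
    have hk : (1 / ((k : ℝ) + 1)) ≠ 0 := by positivity
    exact χ.hasCompactSupport.comp_homeomorph (Homeomorph.smulOfNeZero _ hk)
  have hcφ (k : ℕ) : HasCompactSupport fun x : E ↦ χ ((1 / ((k : ℝ) + 1)) • x) • φ x :=
    (hc k).smul_right
  have hs (k : ℕ) : ContDiff ℝ ((⊤ : ℕ∞) : WithTop ℕ∞) fun x : E ↦ χ ((1 / ((k : ℝ) + 1)) • x) • φ x :=
    (χ.contDiff.comp (contDiff_const_smul _)).smul (φ.smooth _)
  refine ⟨fun k ↦ (hcφ k).toSchwartzMap (hs k), hcφ, ?_⟩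
  rw [(schwartz_withSeminorms ℝ E ℂ).tendsto_nhds _ φ]
  rintro ⟨p, l⟩ ε hε
  choose B hB0 hB using exists_norm_iteratedFDeriv_dilation_sub_one_le χ rfl
  -- Leibniz' rule; the factor 1 + ‖x‖ costs one extra power of x, hence the seminorm with p + 1.
  set K : ℝ := ∑ i ∈ Finset.range (l + 1), (l.choose i : ℝ) * B i *
    (SchwartzMap.seminorm ℝ p (l - i) φ + SchwartzMap.seminorm ℝ (p + 1) (l - i) φ) with hK
  have hK0 : 0 ≤ K := Finset.sum_nonneg fun i _ ↦ by
    have := hB0 i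
    positivity
  refine Tendsto.eventually_lt_const (v := (0 : ℝ)) hε ?_
  refine squeeze_zero (fun k ↦ apply_nonneg _ _) (g := fun k : ℕ ↦ 1 / ((k : ℝ) + 1) * K) (fun k ↦ ?_) ?_
  · set δ : ℝ := 1 / ((k : ℝ) + 1)
    have hδ : 0 < δ := by positivity
    have hδ1 : δ ≤ 1 := by
      rw [div_le_one (by positivity)]
      linarith [k.cast_nonneg (α := ℝ)]
    refine SchwartzMap.seminorm_le_bound ℝ p l _ (by positivity) fun x ↦ ?_
    have e : (((hcφ k).toSchwartzMap (hs k) - φ : 𝓢(E, ℂ)) : E → ℂ) =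
        fun x ↦ (χ (δ • x) - 1) • φ x := by
      ext x
      change χ (δ • x) • φ x - φ x = _
      rw [sub_smul, one_smul]
    rw [e]
    have h1 := norm_iteratedFDeriv_smul_le (𝕜 := ℝ) (f := fun x ↦ χ (δ • x) - 1) (g := φ)
      ((χ.contDiff.comp (contDiff_const_smul _)).sub contDiff_const) (φ.smooth ⊤) x (n := l)
      (mod_cast le_top)
    refine (mul_le_mul_of_nonneg_left h1 (by positivity)).trans ?_
    rw [Finset.mul_sum, hK, Finset.mul_sum]
    refine Finset.sum_le_sum fun i _ ↦ ?_
    have h2 := hB i δ hδ hδ1 x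
    have h3 := SchwartzMap.le_seminorm ℝ p (l - i) φ x
    have h4 := SchwartzMap.le_seminorm ℝ (p + 1) (l - i) φ x
    have hBi := hB0 i
    calc _ ≤ ‖x‖ ^ p * ((l.choose i : ℝ) * (B i * δ * (1 + ‖x‖)) * ‖iteratedFDeriv ℝ (l - i) φ x‖) := by
          gcongr
      _ = δ * ((l.choose i : ℝ) * B i * (‖x‖ ^ p * ‖iteratedFDeriv ℝ (l - i) φ x‖ +
            ‖x‖ ^ (p + 1) * ‖iteratedFDeriv ℝ (l - i) φ x‖)) := by ring
      _ ≤ _ := by gcongr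
  · simpa using (tendsto_one_div_add_atTop_nhds_zero_nat (𝕜 := ℝ)).mul_const K

end CompactSupportDense

/-! ### Pairing Sobolev curves with test functions -/

section Pairing

/-- The norm of `H^{-s}` of a test function. -/
def testNorm (s : ℝ) (φ : 𝓢(Space n, ℂ)) : ℝ≥0∞ := weightedNorm (-s) (fun η ↦ ‖(𝓕⁻ φ) η‖ₑ)

theorem enorm_apply_le {s : ℝ} {f : 𝓢'(Space n, ℂ)} (hf : sobolevNorm s f < ∞)
    (φ : 𝓢(Space n, ℂ)) : ‖f φ‖ₑ ≤ testNorm s φ * sobolevNorm s f := by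
  obtain ⟨a, ha, hfa⟩ := exists_isFunction_of_sobolevNorm hf
  rw [hfa.apply_eq, sobolevNorm_eq hfa]
  refine (enorm_integral_le_lintegral_enorm _).trans ?_
  simp_rw [enorm_mul]
  exact lintegral_mul_le_weightedNorm s (𝓕⁻ φ).continuous.measurable.enorm.aemeasurable
    ha.measurable.enorm.aemeasurable

/-- Makes the dual Sobolev norm continuous on the Schwartz space, so that approximating test
functions in that topology is compatible with pairing with curves in H^s. -/
theorem exists_weightedNorm_schwartz_le (n : ℕ) (s : ℝ) : ∃ (C : ℝ≥0∞) (N : ℕ), C ≠ ∞ ∧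
    ∀ κ : 𝓢(Space n, ℂ), weightedNorm s (fun η ↦ ‖κ η‖ₑ) ≤ C * ENNReal.ofReal
      ((Finset.Iic (N, 0)).sup (fun m ↦ SchwartzMap.seminorm ℝ m.1 m.2) κ) := by
  obtain ⟨N, hN⟩ := exists_weightedNorm_inv_pow_lt_top n s
  refine ⟨weightedNorm (n := n) s (fun η ↦ ENNReal.ofReal (((1 + ‖η‖) ^ N)⁻¹)) *
    ENNReal.ofReal (2 ^ N), N, ENNReal.mul_ne_top hN.ne ENNReal.ofReal_ne_top, fun κ ↦ ?_⟩
  have h := SchwartzMap.one_add_le_sup_seminorm_apply (𝕜 := ℝ) (m := (N, 0)) (k := N) (n := 0)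
    le_rfl le_rfl κ
  set p := (Finset.Iic (N, 0)).sup (fun m ↦ SchwartzMap.seminorm ℝ m.1 m.2) κ
  rw [mul_assoc, ← ENNReal.ofReal_mul (by positivity), mul_comm,
    ← weightedNorm_const_mul s ENNReal.ofReal_ne_top]
  refine weightedNorm_mono (ae_of_all _ fun η ↦ ?_)
  have h1 := h η
  rw [norm_iteratedFDeriv_zero] at h1
  have h2 : 0 ≤ 2 ^ N * p := le_trans (by positivity) h1
  rw [← ofReal_norm, ← ENNReal.ofReal_mul h2]
  refine ENNReal.ofReal_le_ofReal ?_
  rw [← div_eq_mul_inv, le_div_iff₀ (by positivity), mul_comm]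
  exact h1

theorem testNorm_lt_top (s : ℝ) (φ : 𝓢(Space n, ℂ)) : testNorm s φ < ∞ := by
  obtain ⟨C, N, hC, h⟩ := exists_weightedNorm_schwartz_le n (-s)
  exact (h _).trans_lt (ENNReal.mul_lt_top hC.lt_top ENNReal.ofReal_lt_top)

theorem tendsto_testNorm_sub {s : ℝ} {φs : ℕ → 𝓢(Space n, ℂ)} {φ : 𝓢(Space n, ℂ)}
    (h : Tendsto φs atTop (𝓝 φ)) : Tendsto (fun k ↦ testNorm s (φs k - φ)) atTop (𝓝 0) := by
  obtain ⟨C, N, hC, hb⟩ := exists_weightedNorm_schwartz_le n (-s)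
  have h1 : Tendsto (fun k ↦ 𝓕⁻ (φs k - φ)) atTop (𝓝 (0 : 𝓢(Space n, ℂ))) := by
    have h2 := ((FourierTransform.fourierInvCLM ℂ 𝓢(Space n, ℂ)).continuous.tendsto _).comp
      (h.sub_const φ)
    simpa [Function.comp_def] using h2
  have h3 : Tendsto (fun k ↦ (Finset.Iic (N, 0)).sup (fun m ↦ SchwartzMap.seminorm ℝ m.1 m.2)
      (𝓕⁻ (φs k - φ))) atTop (𝓝 0) := by
    rw [Metric.tendsto_nhds]
    intro ε hε
    filter_upwards [((schwartz_withSeminorms ℝ (Space n) ℂ).tendsto_nhds' _ 0).1 h1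
      (Finset.Iic (N, 0)) ε hε] with k hk
    rw [sub_zero] at hk
    rw [Real.dist_eq, sub_zero, abs_of_nonneg (apply_nonneg _ _)]
    exact hk
  have h4 := ENNReal.Tendsto.const_mul (a := C) (ENNReal.tendsto_ofReal h3) (Or.inr hC)
  rw [ENNReal.ofReal_zero, mul_zero] at h4
  exact tendsto_of_tendsto_of_tendsto_of_le_of_le tendsto_const_nhds h4 (fun _ ↦ zero_le)
    fun k ↦ hb _

/-- Continuity gives a bound near each time, and compactness of the interval a common one. -/
theorem ContinuousSobolev.exists_bound {s : ℝ} {u : ℝ → 𝓢'(Space n, ℂ)}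
    (hu : ContinuousSobolev s u) (R : ℝ) :
    ∃ M : ℝ≥0, ∀ t, |t| ≤ R → sobolevNorm s (u t) ≤ M := by
  have h := (isCompact_closedBall (0 : ℝ) R).induction_on
    (p := fun S ↦ ∃ M : ℝ≥0, ∀ t ∈ S, sobolevNorm s (u t) ≤ M) ⟨0, by simp⟩
    (fun S S' hS ⟨M, hM⟩ ↦ ⟨M, fun t ht ↦ hM t (hS ht)⟩)
    (fun S S' ⟨M, hM⟩ ⟨M', hM'⟩ ↦ ⟨max M M', fun t ht ↦ ?_⟩) (fun t₀ _ ↦ ?_)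
  · obtain ⟨M, hM⟩ := h
    exact ⟨M, fun t ht ↦ hM t (by simpa using ht)⟩
  · rcases ht with ht | ht
    · exact (hM t ht).trans (by simp)
    · exact (hM' t ht).trans (by simp)
  · refine ⟨_, mem_nhdsWithin_of_mem_nhds ((hu.2 t₀).eventually_lt_const one_pos),
      (1 + (sobolevNorm s (u t₀)).toNNReal), fun t ht ↦ ?_⟩
    have h1 := sobolevNorm_add_le s (u t - u t₀) (u t₀)
    rw [sub_add_cancel] at h1
    refine h1.trans ?_
    push_cast
    rw [ENNReal.coe_toNNReal (hu.1 t₀).ne]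
    exact add_le_add (le_of_lt ht) le_rfl

theorem tendsto_apply_of_sobolevNorm {s : ℝ} {l : Filter ℝ} {v : ℝ → 𝓢'(Space n, ℂ)}
    (h : Tendsto (fun t ↦ sobolevNorm s (v t)) l (𝓝 0)) (φ : 𝓢(Space n, ℂ)) :
    Tendsto (fun t ↦ v t φ) l (𝓝 0) := by
  rw [tendsto_zero_iff_enorm_tendsto_zero]
  have h1 := ENNReal.Tendsto.const_mul (a := testNorm s φ) h (Or.inr (testNorm_lt_top s φ).ne)
  rw [mul_zero] at h1
  refine tendsto_of_tendsto_of_tendsto_of_le_of_le' tendsto_const_nhds h1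
    (Eventually.of_forall fun _ ↦ zero_le) ?_
  filter_upwards [h.eventually_lt_const one_pos] with t ht
  exact enorm_apply_le (ht.trans ENNReal.one_lt_top) φ

theorem ContinuousSobolev.continuous_apply {s : ℝ} {u : ℝ → 𝓢'(Space n, ℂ)}
    (hu : ContinuousSobolev s u) (φ : 𝓢(Space n, ℂ)) : Continuous fun t ↦ u t φ := by
  refine continuous_iff_continuousAt.2 fun t₀ ↦ ?_
  have h1 := (tendsto_apply_of_sobolevNorm (hu.2 t₀) φ).add_const (u t₀ φ)
  rw [zero_add] at h1
  refine h1.congr fun t ↦ ?_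
  change u t φ - u t₀ φ + u t₀ φ = u t φ
  ring

theorem HasSobolevDeriv.hasDerivAt_apply {s : ℝ} {u u' : ℝ → 𝓢'(Space n, ℂ)}
    (hu : HasSobolevDeriv s u u') (φ : 𝓢(Space n, ℂ)) (t₀ : ℝ) :
    HasDerivAt (fun t ↦ u t φ) (u' t₀ φ) t₀ := by
  rw [hasDerivAt_iff_tendsto_slope]
  have h1 := (tendsto_apply_of_sobolevNorm (hu t₀) φ).add_const (u' t₀ φ)
  rw [zero_add] at h1
  refine h1.congr fun t ↦ ?_
  rw [slope_def_module, Complex.real_smul]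
  change ((t - t₀ : ℝ) : ℂ)⁻¹ * (u t φ - u t₀ φ) - u' t₀ φ + u' t₀ φ = _
  push_cast
  ring

/-- On the support of ρ the curve is bounded in H^s, so convergence in H^{-s} passes through the
integral. It extends the weak equation to test functions without compact support in x, such as those
of bounded frequency. -/
theorem tendsto_integral_apply {s : ℝ} {u : ℝ → 𝓢'(Space n, ℂ)} (hu : ContinuousSobolev s u)
    {ρ : ℝ → ℂ} (hρ : Continuous ρ) (hρc : HasCompactSupport ρ) {φs : ℕ → 𝓢(Space n, ℂ)}
    {φ : 𝓢(Space n, ℂ)} (h : Tendsto φs atTop (𝓝 φ)) :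
    Tendsto (fun k ↦ ∫ t, ρ t * u t (φs k)) atTop (𝓝 (∫ t, ρ t * u t φ)) := by
  obtain ⟨R, hR0, hR⟩ := hρc.isCompact.isBounded.subset_closedBall_lt 0 (0 : ℝ)
  obtain ⟨M, hM⟩ := hu.exists_bound R
  have hi (φ : 𝓢(Space n, ℂ)) : Integrable fun t ↦ ρ t * u t φ :=
    (hρ.mul (hu.continuous_apply φ)).integrable_of_hasCompactSupport hρc.mul_right
  rw [← tendsto_sub_nhds_zero_iff, tendsto_zero_iff_enorm_tendsto_zero]
  have e (k : ℕ) : (∫ t, ρ t * u t (φs k)) - ∫ t, ρ t * u t φ = ∫ t, ρ t * u t (φs k - φ) := by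
    rw [← integral_sub (hi _) (hi _)]
    simp_rw [map_sub, mul_sub]
  have hbd (k : ℕ) : ‖(∫ t, ρ t * u t (φs k)) - ∫ t, ρ t * u t φ‖ₑ ≤
      (M * ∫⁻ t, ‖ρ t‖ₑ) * testNorm s (φs k - φ) := by
    rw [e]
    calc _ ≤ ∫⁻ t, ‖ρ t * u t (φs k - φ)‖ₑ := enorm_integral_le_lintegral_enorm _
      _ ≤ ∫⁻ t, (M * testNorm s (φs k - φ)) * ‖ρ t‖ₑ := by
          refine lintegral_mono fun t ↦ ?_
          rw [enorm_mul, mul_comm]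
          by_cases ht : |t| ≤ R
          · gcongr
            rw [mul_comm]
            exact (enorm_apply_le (hu.1 t) _).trans (by gcongr; exact hM t ht)
          · have : ρ t = 0 := image_eq_zero_of_notMem_tsupport fun h ↦ ht (by simpa using hR h)
            simp [this]
      _ = _ := by
          rw [lintegral_const_mul' _ _ (ENNReal.mul_ne_top (by simp) (testNorm_lt_top _ _).ne)]
          ring
  have h1 := ENNReal.Tendsto.const_mul (a := M * ∫⁻ t, ‖ρ t‖ₑ) (tendsto_testNorm_sub (s := s) h)
    (Or.inr (ENNReal.mul_ne_top (by simp) (hρ.integrable_of_hasCompactSupport hρc).2.ne))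
  rw [mul_zero] at h1
  exact tendsto_of_tendsto_of_tendsto_of_le_of_le tendsto_const_nhds h1 (fun _ ↦ zero_le) hbd

end Pairing

/-! ### Test functions with separated variables -/

section Tensor

theorem hasCompactSupport_tensor {ρ : ℝ → ℂ} {φ : Space n → ℂ} (hρ : HasCompactSupport ρ)
    (hφ : HasCompactSupport φ) : HasCompactSupport fun ζ : SpaceTime n ↦ ρ ζ.fst * φ ζ.snd := by
  refine HasCompactSupport.intro ((hρ.isCompact.prod hφ.isCompact).image
    (WithLp.prod_continuous_toLp 2 ℝ (Space n))) fun ζ hζ ↦ ?_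
  by_contra h
  obtain ⟨h1, h2⟩ := mul_ne_zero_iff.1 h
  exact hζ ⟨(ζ.fst, ζ.snd), ⟨subset_tsupport _ h1, subset_tsupport _ h2⟩, rfl⟩

theorem contDiff_tensor (ρ : 𝓢(ℝ, ℂ)) (φ : 𝓢(Space n, ℂ)) :
    ContDiff ℝ ((⊤ : ℕ∞) : WithTop ℕ∞) fun ζ : SpaceTime n ↦ ρ ζ.fst * φ ζ.snd :=
  ((ρ.smooth _).comp (WithLp.fstL 2 ℝ ℝ (Space n)).contDiff).mul
    ((φ.smooth _).comp (WithLp.sndL 2 ℝ ℝ (Space n)).contDiff)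

/-- The test function `ρ(t) φ(x)`. -/
def tensor (ρ : 𝓢(ℝ, ℂ)) (φ : 𝓢(Space n, ℂ)) (hρ : HasCompactSupport ρ)
    (hφ : HasCompactSupport φ) : 𝓢(SpaceTime n, ℂ) :=
  (hasCompactSupport_tensor hρ hφ).toSchwartzMap (contDiff_tensor ρ φ)

theorem tensor_apply (ρ : 𝓢(ℝ, ℂ)) (φ : 𝓢(Space n, ℂ)) (hρ : HasCompactSupport ρ)
    (hφ : HasCompactSupport φ) (ζ : SpaceTime n) : tensor ρ φ hρ hφ ζ = ρ ζ.fst * φ ζ.snd := rfl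

theorem lineDerivOp_time_tensor (ρ : 𝓢(ℝ, ℂ)) (φ : 𝓢(Space n, ℂ)) (hρ : HasCompactSupport ρ)
    (hφ : HasCompactSupport φ) : ∂_{point (n := n) 1 0} (tensor ρ φ hρ hφ) =
      tensor (∂_{(1 : ℝ)} ρ) φ (hasCompactSupport_lineDerivOp hρ 1) hφ := by
  ext ζ
  rw [SchwartzMap.lineDerivOp_apply, lineDeriv, tensor_apply, SchwartzMap.lineDerivOp_apply, lineDeriv]
  simp only [tensor_apply]
  rw [← deriv_mul_const_field]
  simp [point]

theorem lineDerivOp_space_tensor (ρ : 𝓢(ℝ, ℂ)) (φ : 𝓢(Space n, ℂ)) (hρ : HasCompactSupport ρ)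
    (hφ : HasCompactSupport φ) (e : Space n) : ∂_{point 0 e} (tensor ρ φ hρ hφ) =
      tensor ρ (∂_{e} φ) hρ (hasCompactSupport_lineDerivOp hφ e) := by
  ext ζ
  rw [SchwartzMap.lineDerivOp_apply, lineDeriv, tensor_apply, SchwartzMap.lineDerivOp_apply, lineDeriv]
  simp only [tensor_apply]
  rw [← deriv_const_mul_field]
  simp [point]

/-- The Laplacian of a Schwartz function. -/
def lap (φ : 𝓢(Space n, ℂ)) : 𝓢(Space n, ℂ) :=
  ∑ i : Fin n, ∂_{EuclideanSpace.single i (1 : ℝ)} (∂_{EuclideanSpace.single i (1 : ℝ)} φ)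

theorem continuous_lap : Continuous (lap : 𝓢(Space n, ℂ) → 𝓢(Space n, ℂ)) := by
  unfold lap
  fun_prop

theorem slice_box_tensor (ρ : 𝓢(ℝ, ℂ)) (φ : 𝓢(Space n, ℂ)) (hρ : HasCompactSupport ρ)
    (hφ : HasCompactSupport φ) (t : ℝ) : slice t (box (tensor ρ φ hρ hφ)) =
      ρ t • lap φ - (∂_{(1 : ℝ)} (∂_{(1 : ℝ)} ρ) : 𝓢(ℝ, ℂ)) t • φ := by
  simp only [box, lineDerivOp_time_tensor, lineDerivOp_space_tensor]
  ext x
  simp only [slice_apply, add_apply, neg_apply, sum_apply, tensor_apply, sub_apply, smul_apply, lap,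
    point_fst, point_snd, smul_eq_mul, Finset.mul_sum]
  ring

theorem fourierInv_lap (φ : 𝓢(Space n, ℂ)) (η : Space n) :
    (𝓕⁻ (lap φ)) η = -(((2 * Real.pi * ‖η‖) ^ 2 : ℝ) : ℂ) * (𝓕⁻ φ) η := by
  rw [lap, FourierTransform.fourierInv_sum, sum_apply]
  simp_rw [fourierInv_lineDerivOp_twice]
  have e2 (i : Fin n) : inner ℝ η (EuclideanSpace.single i (1 : ℝ)) = η i := by
    simp [EuclideanSpace.inner_single_right]
  simp_rw [e2]
  rw [← Finset.sum_mul, mul_pow _ ‖η‖, EuclideanSpace.norm_sq_eq]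
  simp only [Real.norm_eq_abs, sq_abs, mul_pow, Finset.mul_sum]
  push_cast
  simp only [Finset.sum_neg_distrib]

end Tensor

/-! ### Uniqueness for the Cauchy problem -/

section Uniqueness

/-- The lemma of du Bois-Reymond. -/
theorem eq_of_forall_integral_deriv_mul_eq_zero {Y : ℝ → ℂ} (hY : Continuous Y)
    (h : ∀ ρ : 𝓢(ℝ, ℂ), HasCompactSupport ρ → ∫ t, (∂_{(1 : ℝ)} ρ : 𝓢(ℝ, ℂ)) t * Y t = 0)
    (t : ℝ) : Y t = Y 0 := by
  let b : ContDiffBump (0 : ℝ) := ⟨1, 2, one_pos, by norm_num⟩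
  set β : ℝ → ℝ := b.normed volume with hβ
  have hβi : ∫ x, β x = 1 := b.integral_normed
  have hβs : ContDiff ℝ ((⊤ : ℕ∞) : WithTop ℕ∞) β := b.contDiff_normed
  have hβc : HasCompactSupport β := b.hasCompactSupport_normed
  have key : ∀ᵐ x, Y x - (∫ x, β x • Y x) = 0 := by
    refine ae_eq_zero_of_integral_contDiff_smul_eq_zero
      (hY.sub continuous_const).locallyIntegrable fun g hg hgc ↦ ?_
    -- Subtracting the right multiple of the normalized bump gives integral zero, so the primitive
    -- of d has compact support and is an admissible test function.
    set d : ℝ → ℝ := fun x ↦ g x - (∫ x, g x) * β x with hd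
    have hds : ContDiff ℝ ((⊤ : ℕ∞) : WithTop ℕ∞) d := hg.sub (contDiff_const.mul hβs)
    have hdc : HasCompactSupport d := hgc.sub hβc.mul_left
    have hgi := hg.continuous.integrable_of_hasCompactSupport (μ := volume) hgc
    have hβii := hβs.continuous.integrable_of_hasCompactSupport (μ := volume) hβc
    have hdi : ∫ x, d x = 0 := by
      rw [integral_sub hgi (hβii.const_mul _), integral_const_mul, hβi]
      ring
    obtain ⟨R, hR0, hR⟩ := hdc.isCompact.isBounded.subset_closedBall_lt 0 (0 : ℝ)
    have hd0 (x : ℝ) (hx : R < |x|) : d x = 0 :=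
      image_eq_zero_of_notMem_tsupport fun h ↦ not_le.2 hx (by simpa using hR h)
    set P : ℝ → ℝ := fun x ↦ ∫ y in (-(R + 1))..x, d y with hP
    have hPd (x : ℝ) : HasDerivAt P (d x) x :=
      (hds.continuous.integral_hasStrictDerivAt (-(R + 1)) x).hasDerivAt
    have hPs : ContDiff ℝ ((⊤ : ℕ∞) : WithTop ℕ∞) P := by
      rw [contDiff_infty_iff_deriv]
      exact ⟨fun x ↦ (hPd x).differentiableAt, by
        rwa [show deriv P = d from funext fun x ↦ (hPd x).deriv]⟩
    have hPc : HasCompactSupport P := by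
      refine HasCompactSupport.intro (isCompact_closedBall (0 : ℝ) (R + 1)) fun x hx ↦ ?_
      have hx' : R + 1 < |x| := by simpa using hx
      rcases lt_abs.1 hx' with h1 | h1
      · rw [hP, ← hdi]
        refine intervalIntegral.integral_eq_integral_of_support_subset fun y hy ↦ ?_
        have h2 : |y| ≤ R := not_lt.1 fun h ↦ hy (hd0 y h)
        rw [abs_le] at h2
        constructor <;> linarith
      · rw [hP]
        dsimp only
        rw [intervalIntegral.integral_congr (g := fun _ ↦ (0 : ℝ)),
          intervalIntegral.integral_zero]
        intro y hy
        rw [Set.uIcc_of_ge (by linarith)] at hy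
        exact hd0 y (lt_abs.2 (Or.inr (by linarith [hy.2])))
    have hc : HasCompactSupport (Complex.ofRealCLM ∘ P) := hPc.comp_left rfl
    have hs : ContDiff ℝ ((⊤ : ℕ∞) : WithTop ℕ∞) (Complex.ofRealCLM ∘ P) :=
      Complex.ofRealCLM.contDiff.comp hPs
    have h1 := h (hc.toSchwartzMap hs) hc
    have e (x : ℝ) : (∂_{(1 : ℝ)} (hc.toSchwartzMap hs) : 𝓢(ℝ, ℂ)) x = (d x : ℂ) :=
      (hasDerivAt_schwartz (hc.toSchwartzMap hs) x).unique (hPd x).ofReal_comp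
    simp_rw [e, hd] at h1
    have hgY : Integrable fun x ↦ g x • Y x :=
      (hg.continuous.smul hY).integrable_of_hasCompactSupport hgc.smul_right
    have hβY : Integrable fun x ↦ β x • Y x :=
      (hβs.continuous.smul hY).integrable_of_hasCompactSupport hβc.smul_right
    have e2 : (fun x ↦ ((g x - (∫ x, g x) * β x : ℝ) : ℂ) * Y x) =
        fun x ↦ g x • Y x - (∫ x, g x) • (β x • Y x) := by
      ext x
      simp only [Complex.real_smul]
      push_cast
      ring
    rw [e2, integral_sub (g := fun x ↦ (∫ x, g x) • (β x • Y x)) hgY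
      (hβY.smul (∫ x, g x)), integral_smul] at h1
    simp_rw [smul_sub]
    rw [integral_sub hgY (hgi.smul_const _), integral_smul_const]
    exact h1
  have e : Y = fun _ ↦ ∫ x, β x • Y x := by
    refine (hY.ae_eq_iff_eq volume continuous_const).1 ?_
    filter_upwards [key] with x hx
    exact sub_eq_zero.1 hx
  rw [congrFun e t, congrFun e 0]

theorem apply_slice_box_tensor (f : 𝓢'(Space n, ℂ)) (ρ : 𝓢(ℝ, ℂ)) (φ : 𝓢(Space n, ℂ))
    (hρ : HasCompactSupport ρ) (hφ : HasCompactSupport φ) (t : ℝ) :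
    f (slice t (box (tensor ρ φ hρ hφ))) =
      ρ t * f (lap φ) - (∂_{(1 : ℝ)} (∂_{(1 : ℝ)} ρ) : 𝓢(ℝ, ℂ)) t * f φ := by
  rw [slice_box_tensor, map_sub, map_smul, map_smul, smul_eq_mul, smul_eq_mul]

theorem ContinuousSobolev.integrable_mul_apply {s : ℝ} {v : ℝ → 𝓢'(Space n, ℂ)}
    (hv : ContinuousSobolev s v) {ρ : 𝓢(ℝ, ℂ)} (hρ : HasCompactSupport ρ) (φ : 𝓢(Space n, ℂ)) :
    Integrable fun t ↦ ρ t * v t φ :=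
  (ρ.continuous.mul (hv.continuous_apply φ)).integrable_of_hasCompactSupport hρ.mul_right

/-- The weak equation tested on ρ ⊗ φ, first for compactly supported φ and then for every Schwartz φ
by density. -/
theorem integral_mul_apply_lap {s : ℝ} {v : ℝ → 𝓢'(Space n, ℂ)} (hv : ContinuousSobolev s v)
    (hw : ∀ ρ φ hρ hφ, ∫ t, v t (slice t (box (tensor ρ φ hρ hφ))) = 0) (φ : 𝓢(Space n, ℂ)) {ρ : 𝓢(ℝ, ℂ)} (hρ : HasCompactSupport ρ) :
    ∫ t, ρ t * v t (lap φ) = ∫ t, (∂_{(1 : ℝ)} (∂_{(1 : ℝ)} ρ) : 𝓢(ℝ, ℂ)) t * v t φ := by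
  have hρ2 := hasCompactSupport_lineDerivOp (hasCompactSupport_lineDerivOp hρ 1) 1
  obtain ⟨φs, hc, hφ⟩ := exists_compactSupport_tendsto φ
  have h1 (k : ℕ) : ∫ t, ρ t * v t (lap (φs k)) =
      ∫ t, (∂_{(1 : ℝ)} (∂_{(1 : ℝ)} ρ) : 𝓢(ℝ, ℂ)) t * v t (φs k) := by
    have h2 := hw ρ (φs k) hρ (hc k)
    simp_rw [apply_slice_box_tensor] at h2
    rw [integral_sub (hv.integrable_mul_apply hρ _) (hv.integrable_mul_apply hρ2 _)] at h2
    exact sub_eq_zero.1 h2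
  have l1 := tendsto_integral_apply hv ρ.continuous hρ ((continuous_lap.tendsto φ).comp hφ)
  have l2 := tendsto_integral_apply hv (SchwartzMap.continuous _) hρ2 hφ
  exact tendsto_nhds_unique (l1.congr h1) l2

/-- The difference of the two sides has vanishing weak derivative in t by the equation, so it is
constant by du Bois-Reymond, and it vanishes at 0. -/
theorem apply_deriv_eq_integral {s : ℝ} {v v' : ℝ → 𝓢'(Space n, ℂ)} (hv : ContinuousSobolev s v)
    (hv' : ContinuousSobolev (s - 1) v') (hd : HasSobolevDeriv (s - 1) v v') (h0 : v' 0 = 0)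
    (hw : ∀ ρ φ hρ hφ, ∫ t, v t (slice t (box (tensor ρ φ hρ hφ))) = 0) (φ : 𝓢(Space n, ℂ)) (t : ℝ) :
    v' t φ = ∫ x in (0 : ℝ)..t, v x (lap φ) := by
  have cZ := hv.continuous_apply (lap φ)
  have cQ := hv.continuous_apply φ
  have cQ' := hv'.continuous_apply φ
  have dI (t : ℝ) := (cZ.integral_hasStrictDerivAt 0 t).hasDerivAt
  have cI : Continuous fun t ↦ ∫ x in (0 : ℝ)..t, v x (lap φ) :=
    continuous_iff_continuousAt.2 fun t ↦ (dI t).continuousAt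
  have key := eq_of_forall_integral_deriv_mul_eq_zero
    (Y := fun t ↦ v' t φ - ∫ x in (0 : ℝ)..t, v x (lap φ)) (cQ'.sub cI) (fun ρ hρ ↦ ?_) t
  · have e : v' 0 φ = 0 := by rw [h0]; rfl
    simp only [e, intervalIntegral.integral_same, sub_zero] at key
    exact sub_eq_zero.1 key
  · have hρ1 := hasCompactSupport_lineDerivOp hρ 1
    have hρ2 := hasCompactSupport_lineDerivOp hρ1 1
    have hi {g : ℝ → ℂ} (hg : Continuous g) {f : 𝓢(ℝ, ℂ)} (hf : HasCompactSupport f) :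
        Integrable fun t ↦ g t * f t :=
      (hg.mul f.continuous).integrable_of_hasCompactSupport hf.mul_left
    have i1 : ∫ t, v t φ * (∂_{(1 : ℝ)} (∂_{(1 : ℝ)} ρ) : 𝓢(ℝ, ℂ)) t =
        -∫ t, v' t φ * (∂_{(1 : ℝ)} ρ : 𝓢(ℝ, ℂ)) t :=
      integral_mul_deriv_eq_deriv_mul_of_integrable (fun t _ ↦ hd.hasDerivAt_apply φ t)
        (fun t _ ↦ hasDerivAt_schwartz _ t) (hi cQ hρ2) (hi cQ' hρ1) (hi cQ hρ1)
    have i2 : ∫ t, (∫ x in (0 : ℝ)..t, v x (lap φ)) * (∂_{(1 : ℝ)} ρ : 𝓢(ℝ, ℂ)) t =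
        -∫ t, v t (lap φ) * ρ t :=
      integral_mul_deriv_eq_deriv_mul_of_integrable (fun t _ ↦ dI t)
        (fun t _ ↦ hasDerivAt_schwartz _ t) (hi cI hρ1) (hi cZ hρ) (hi cI hρ)
    have i3 := integral_mul_apply_lap hv hw φ hρ
    have e (t : ℝ) : (∂_{(1 : ℝ)} ρ : 𝓢(ℝ, ℂ)) t * (v' t φ - ∫ x in (0 : ℝ)..t, v x (lap φ)) =
        v' t φ * (∂_{(1 : ℝ)} ρ : 𝓢(ℝ, ℂ)) t -
          (∫ x in (0 : ℝ)..t, v x (lap φ)) * (∂_{(1 : ℝ)} ρ : 𝓢(ℝ, ℂ)) t := by ring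
    simp_rw [e]
    have e2 (t : ℝ) : ρ t * v t (lap φ) = v t (lap φ) * ρ t := mul_comm _ _
    have e3 (t : ℝ) : (∂_{(1 : ℝ)} (∂_{(1 : ℝ)} ρ) : 𝓢(ℝ, ℂ)) t * v t φ =
        v t φ * (∂_{(1 : ℝ)} (∂_{(1 : ℝ)} ρ) : 𝓢(ℝ, ℂ)) t := mul_comm _ _
    simp_rw [e2, e3] at i3
    rw [integral_sub (hi cQ' hρ1) (hi cI hρ1), i2, i3, i1]
    ring

theorem norm_integral_le_of_norm_le_pow {Z : ℝ → ℂ} {c T : ℝ} {j : ℕ}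
    (h : ∀ x, |x| ≤ T → ‖Z x‖ ≤ c * |x| ^ j) {t : ℝ} (ht : |t| ≤ T) :
    ‖∫ x in (0 : ℝ)..t, Z x‖ ≤ c * (|t| ^ (j + 1) / (j + 1)) := by
  have pos {Z : ℝ → ℂ} (h : ∀ x, |x| ≤ T → ‖Z x‖ ≤ c * |x| ^ j) {t : ℝ} (ht : |t| ≤ T)
      (ht0 : 0 ≤ t) : ‖∫ x in (0 : ℝ)..t, Z x‖ ≤ c * (|t| ^ (j + 1) / (j + 1)) := by
    have h1 := intervalIntegral.norm_integral_le_of_norm_le (f := Z) (g := fun x ↦ c * x ^ j)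
      (μ := volume) ht0 (ae_of_all _ fun x hx ↦ ?_)
      ((by fun_prop : Continuous fun x : ℝ ↦ c * x ^ j).intervalIntegrable 0 t)
    · refine h1.trans (le_of_eq ?_)
      rw [intervalIntegral.integral_const_mul, integral_pow, abs_of_nonneg ht0]
      simp
    · have hx0 : 0 ≤ x := hx.1.le
      rw [abs_of_nonneg ht0] at ht
      have := h x (by rw [abs_of_nonneg hx0]; linarith [hx.2])
      rwa [abs_of_nonneg hx0] at this
  rcases le_total 0 t with h0 | h0
  · exact pos h ht h0
  · have h1 := pos (Z := fun x ↦ Z (-x)) (fun x hx ↦ by simpa using h (-x) (by simpa using hx))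
      (t := -t) (by simpa using ht) (by linarith)
    rw [intervalIntegral.integral_comp_neg, neg_neg, neg_zero, intervalIntegral.integral_symm,
      norm_neg, abs_neg] at h1
    exact h1

/-- Uniqueness for the homogeneous wave equation. -/
theorem eq_zero_of_solvesWave {s : ℝ} {v v' : ℝ → 𝓢'(Space n, ℂ)} (hv : ContinuousSobolev s v)
    (hv' : ContinuousSobolev (s - 1) v') (hd : HasSobolevDeriv (s - 1) v v') (h0 : v 0 = 0)
    (h0' : v' 0 = 0) (hw : ∀ ρ φ hρ hφ, ∫ t, v t (slice t (box (tensor ρ φ hρ hφ))) = 0) (t : ℝ) : v t = 0 := by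
  obtain ⟨M, hM⟩ := hv.exists_bound |t|
  set N : 𝓢(Space n, ℂ) → ℝ := fun φ ↦ (testNorm s φ).toReal with hN
  have hN0 (φ) : 0 ≤ N φ := ENNReal.toReal_nonneg
  have base (φ : 𝓢(Space n, ℂ)) (x : ℝ) (hx : |x| ≤ |t|) : ‖v x φ‖ ≤ M * N φ := by
    have h1 : ‖v x φ‖ₑ ≤ M * testNorm s φ := by
      refine (enorm_apply_le (hv.1 x) φ).trans ?_
      rw [mul_comm]
      gcongr
      exact hM x hx
    have h2 := ENNReal.toReal_mono (ENNReal.mul_ne_top (by simp) (testNorm_lt_top s φ).ne) h1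
    simpa [hN] using h2
  -- On frequencies at most R the Laplacian multiplies by at most (2πR)² and preserves the frequency
  -- support, so it can be iterated.
  have hlap (φ : 𝓢(Space n, ℂ)) (R : ℝ) (hφ : ∀ η, R < ‖η‖ → (𝓕⁻ φ) η = 0) :
      N (lap φ) ≤ (2 * Real.pi * R) ^ 2 * N φ ∧ ∀ η, R < ‖η‖ → (𝓕⁻ (lap φ)) η = 0 := by
    constructor
    · have h1 : testNorm s (lap φ) ≤ ENNReal.ofReal ((2 * Real.pi * R) ^ 2) * testNorm s φ := by
        rw [testNorm, testNorm, ← weightedNorm_const_mul _ ENNReal.ofReal_ne_top]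
        refine weightedNorm_mono (ae_of_all _ fun η ↦ ?_)
        by_cases hη : R < ‖η‖
        · rw [fourierInv_lap, hφ η hη]
          simp
        · rw [fourierInv_lap, enorm_mul, enorm_neg]
          gcongr
          rw [← ofReal_norm, Complex.norm_real, Real.norm_of_nonneg (by positivity)]
          have := norm_nonneg η
          gcongr
          linarith
      have h2 := ENNReal.toReal_mono
        (ENNReal.mul_ne_top ENNReal.ofReal_ne_top (testNorm_lt_top s φ).ne) h1
      rwa [ENNReal.toReal_mul, ENNReal.toReal_ofReal (by positivity)] at h2
    · intro η hη
      rw [fourierInv_lap, hφ η hη, mul_zero]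
  -- Each round integrates twice. The first integration produces the factorial; the second is
  -- bounded crudely by the factor |t|.
  have iter (R : ℝ) (j : ℕ) : ∀ φ : 𝓢(Space n, ℂ), (∀ η, R < ‖η‖ → (𝓕⁻ φ) η = 0) →
      ∀ x, |x| ≤ |t| → ‖v x φ‖ ≤ M * N φ * (((2 * Real.pi * R) ^ 2 * |t|) ^ j / j.factorial) * |x| ^ j := by
    induction j with
    | zero =>
      intro φ _ x hx
      simpa using base φ x hx
    | succ j ih =>
      intro φ hφ x hx
      obtain ⟨h1, h2⟩ := hlap φ R hφ
      set c : ℝ := M * N (lap φ) * (((2 * Real.pi * R) ^ 2 * |t|) ^ j / j.factorial) with hc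
      have hc0 : 0 ≤ c := by
        have := hN0 (lap φ)
        positivity
      have h3 (y : ℝ) (hy : |y| ≤ |t|) : ‖v' y φ‖ ≤ c * (|y| ^ (j + 1) / (j + 1)) := by
        rw [apply_deriv_eq_integral hv hv' hd h0' hw]
        exact norm_integral_le_of_norm_le_pow (ih (lap φ) h2) hy
      have h4 : ‖v x φ - v 0 φ‖ ≤ c * (|x| ^ (j + 1) / (j + 1)) * ‖x - 0‖ := by
        refine (convex_closedBall (0 : ℝ) |x|).norm_image_sub_le_of_norm_hasDerivWithin_le
          (f := fun t ↦ v t φ) (f' := fun t ↦ v' t φ)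
          (fun y _ ↦ (hd.hasDerivAt_apply φ y).hasDerivWithinAt) (fun y hy ↦ ?_)
          (by simp) (by simp)
        have hy' : |y| ≤ |x| := by simpa using hy
        refine (h3 y (hy'.trans hx)).trans ?_
        gcongr
      rw [h0, sub_zero, Real.norm_eq_abs] at h4
      have h5 : v x φ - (0 : 𝓢'(Space n, ℂ)) φ = v x φ := sub_zero _
      rw [h5] at h4
      refine h4.trans ?_
      have hN1 := hN0 φ
      calc c * (|x| ^ (j + 1) / (j + 1)) * |x| ≤ c * (|x| ^ (j + 1) / (j + 1)) * |t| := by gcongr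
        _ ≤ M * ((2 * Real.pi * R) ^ 2 * N φ) *
            (((2 * Real.pi * R) ^ 2 * |t|) ^ j / j.factorial) * (|x| ^ (j + 1) / (j + 1)) * |t| := by
            rw [hc]
            gcongr
        _ = _ := by
            rw [Nat.factorial_succ]
            push_cast
            field_simp
            ring
  have hzero (φ : 𝓢(Space n, ℂ)) (R : ℝ) (hφ : ∀ η, R < ‖η‖ → (𝓕⁻ φ) η = 0) : v t φ = 0 := by
    have h1 : Tendsto (fun j : ℕ ↦ M * N φ * (((2 * Real.pi * R) ^ 2 * |t| * |t|) ^ j / j.factorial))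
        atTop (𝓝 (M * N φ * 0)) :=
      (FloorSemiring.tendsto_pow_div_factorial_atTop _).const_mul _
    rw [mul_zero] at h1
    refine norm_le_zero_iff.1 (ge_of_tendsto' h1 fun j ↦ ?_)
    refine (iter R j φ hφ t le_rfl).trans (le_of_eq ?_)
    rw [mul_pow _ |t|]
    ring
  obtain ⟨a, -, ha⟩ := exists_isFunction_of_sobolevNorm (hv.1 t)
  -- Fourier transforms of smooth compactly supported functions are admissible φ, so the transform
  -- of v(t) vanishes against all smooth compactly supported functions.
  have ha0 : ∀ᵐ η, a η = 0 := by
    refine ae_eq_zero_of_integral_contDiff_smul_eq_zero ha.locallyIntegrable fun g hg hgc ↦ ?_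
    have hc : HasCompactSupport (Complex.ofRealCLM ∘ g) := hgc.comp_left rfl
    have hs : ContDiff ℝ ((⊤ : ℕ∞) : WithTop ℕ∞) (Complex.ofRealCLM ∘ g) :=
      Complex.ofRealCLM.contDiff.comp hg
    obtain ⟨R, hR0, hR⟩ := hc.isCompact.isBounded.subset_closedBall_lt 0 (0 : Space n)
    have h1 := (ha.2 (hc.toSchwartzMap hs)).2
    rw [TemperedDistribution.fourier_apply, hzero _ R fun η hη ↦ ?_] at h1
    · exact h1.symm
    · rw [FourierTransform.fourierInv_fourier_eq]
      exact image_eq_zero_of_notMem_tsupport fun h ↦ not_le.2 hη (by simpa using hR h)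
  have hF : 𝓕 (v t) = 0 := by
    ext φ
    rw [(ha.2 φ).2, integral_eq_zero_of_ae]
    · rfl
    · filter_upwards [ha0] with η hη
      simp [hη]
  have h2 : 𝓕⁻ (𝓕 (v t)) = 0 := by rw [hF, FourierTransform.fourierInv_zero]
  simpa using h2

/-- Uniqueness for the Cauchy problem. -/
theorem SolvesCauchy.unique {s : ℝ} {f g : 𝓢'(Space n, ℂ)} {F : 𝓢'(SpaceTime n, ℂ)}
    {u v : ℝ → 𝓢'(Space n, ℂ)} (hu : SolvesCauchy s f g F u) (hv : SolvesCauchy s f g F v) :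
    u = v := by
  obtain ⟨cu, ⟨u', cu', du, iu'⟩, iu, wu⟩ := hu
  obtain ⟨cv, ⟨v', cv', dv, iv'⟩, iv, wv⟩ := hv
  ext1 t
  have h := eq_zero_of_solvesWave (cu.add cv.neg) (cu'.add cv'.neg) (du.add dv.neg)
    (by rw [iu, iv, add_neg_cancel]) (by rw [iu', iv', add_neg_cancel]) (fun ρ φ hρ hφ ↦ ?_) t
  · exact eq_of_sub_eq_zero (by rw [sub_eq_add_neg]; exact h)
  · have hρ2 := hasCompactSupport_lineDerivOp (hasCompactSupport_lineDerivOp hρ 1) 1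
    have h1 := wu (tensor ρ φ hρ hφ) (hasCompactSupport_tensor hρ hφ)
    have h2 := wv (tensor ρ φ hρ hφ) (hasCompactSupport_tensor hρ hφ)
    have i1 (w : ℝ → 𝓢'(Space n, ℂ)) (cw : ContinuousSobolev s w) :
        Integrable fun t ↦ w t (slice t (box (tensor ρ φ hρ hφ))) := by
      simp_rw [apply_slice_box_tensor]
      exact (cw.integrable_mul_apply hρ _).sub (cw.integrable_mul_apply hρ2 _)
    have e (t : ℝ) : (u t + -v t) (slice t (box (tensor ρ φ hρ hφ))) =
        u t (slice t (box (tensor ρ φ hρ hφ))) - v t (slice t (box (tensor ρ φ hρ hφ))) :=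
      (sub_eq_add_neg _ _).symm
    simp_rw [e]
    rw [integral_sub (i1 u cu) (i1 v cv), sub_eq_zero]
    exact h1.trans h2.symm

end Uniqueness

/-! ### The mixed norm and the sign of γ -/

section MixedNorm

variable {X : Type*} [NormedAddCommGroup X] [NormedSpace ℂ X] {ι : X →ₗ[ℂ] 𝓢'(SpaceTime n, ℂ)}

theorem spaceNorm_apply (hι : Function.Injective ι) (x : X) : spaceNorm ι (ι x) = ‖x‖ₑ := by
  refine le_antisymm ((iInf_le _ x).trans (iInf_le _ rfl)) (le_iInf₂ fun y hy ↦ ?_)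
  rw [hι hy]

theorem exists_of_spaceNorm_lt_top (hι : Function.Injective ι) {u : 𝓢'(SpaceTime n, ℂ)}
    (h : spaceNorm ι u < ∞) : ∃ x, ι x = u ∧ ‖x‖ₑ = spaceNorm ι u := by
  have h' := h
  simp only [spaceNorm, iInf_lt_iff] at h'
  obtain ⟨x, hx, -⟩ := h'
  exact ⟨x, hx, by rw [← hx, spaceNorm_apply hι]⟩

theorem exists_of_energyNorm_lt_top {s θ : ℝ} {a : SpaceTime n → ℂ} (ha : Measurable a)
    (h : energyNorm s θ a < ∞) : ∃ u : 𝓢'(SpaceTime n, ℂ), IsFunction (𝓕 u) a := by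
  have hm1 := measurable_fst_spaceTime (n := n)
  have hm2 := measurable_snd_spaceTime (n := n)
  refine exists_fourier_isFunction (m := fun ζ ↦ ((symLam (s - 1) ((2 * Real.pi) • ζ.snd) *
    symPlus 1 (2 * Real.pi * ζ.fst) ((2 * Real.pi) • ζ.snd) *
    symMinus θ (2 * Real.pi * ζ.fst) ((2 * Real.pi) • ζ.snd) : ℝ) : ℂ))
    (((hasTemperateGrowth_symLamX (-(s - 1))).mul (hasTemperateGrowth_symPlus (-1))).mul
      (hasTemperateGrowth_symMinus (-θ))) (fun ζ ↦ ?_) ⟨by fun_prop, ?_⟩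
  · simp only [Pi.mul_apply]
    rw [← Complex.ofReal_mul, ← Complex.ofReal_mul, ← Complex.ofReal_mul, mul_mul_mul_comm,
      mul_mul_mul_comm (symLam _ _), symLam_mul, symPlus_mul, symMinus_mul]
    simp
  · rw [eLpNorm_two_eq]
    simp_rw [enorm_ofReal_mul (mul_nonneg (mul_nonneg (symLam_pos _ _).le (symPlus_pos _ _ _).le)
      (symMinus_pos _ _ _).le)]
    exact h

/-- Functions of finite mixed norm are Fourier transforms of tempered distributions. -/
theorem exists_of_mixed_bound {s γ : ℝ} {h : SpaceTime n → ℂ} (hh : Measurable h)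
    {H : Space n → ℝ≥0∞} (hH : weightedNorm (s - 1) H < ∞)
    (hb : ∀ᵐ η : Space n, ∀ τ, ENNReal.ofReal (symPlus 1 (2 * Real.pi * τ) ((2 * Real.pi) • η) *
      symMinus γ (2 * Real.pi * τ) ((2 * Real.pi) • η)) * ‖h (point τ η)‖ₑ ≤ H η) :
    ∃ u : 𝓢'(SpaceTime n, ℂ), IsFunction (𝓕 u) h := by
  have hm1 := measurable_fst_spaceTime (n := n)
  have hm2 := measurable_snd_spaceTime (n := n)
  -- With Λ₊^{-1} in place of Λ₊ a factor Λ₊^{-2} is gained, square integrable in τ uniformly in ξ.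
  -- This turns L^∞ in τ into L².
  refine exists_fourier_isFunction (m := fun ζ ↦ ((symLam (s - 1) ((2 * Real.pi) • ζ.snd) *
    symPlus (-1) (2 * Real.pi * ζ.fst) ((2 * Real.pi) • ζ.snd) *
    symMinus γ (2 * Real.pi * ζ.fst) ((2 * Real.pi) • ζ.snd) : ℝ) : ℂ))
    (((hasTemperateGrowth_symLamX (-(s - 1))).mul (hasTemperateGrowth_symPlus 1)).mul
      (hasTemperateGrowth_symMinus (-γ))) (fun ζ ↦ ?_) ⟨by fun_prop, ?_⟩
  · simp only [Pi.mul_apply]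
    rw [← Complex.ofReal_mul, ← Complex.ofReal_mul, ← Complex.ofReal_mul, mul_mul_mul_comm,
      mul_mul_mul_comm (symLam _ _), symLam_mul, symPlus_mul, symMinus_mul]
    simp
  · rw [eLpNorm_two_eq]
    simp_rw [enorm_ofReal_mul (mul_nonneg (mul_nonneg (symLam_pos _ _).le (symPlus_pos _ _ _).le)
      (symMinus_pos _ _ _).le)]
    refine ENNReal.rpow_lt_top_of_nonneg (by norm_num) (ne_of_lt ?_)
    rw [lintegral_spaceTime (by fun_prop)]
    have hp : ∫⁻ τ : ℝ, ENNReal.ofReal ((1 + τ ^ 2)⁻¹) < ∞ :=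
      integrable_inv_one_add_sq.lintegral_lt_top
    have hw : ∫⁻ η : Space n, (ENNReal.ofReal (symLam (s - 1) ((2 * Real.pi) • η)) * H η) ^ (2 : ℝ)
        < ∞ := by
      rw [lt_top_iff_ne_top]
      intro h
      rw [weightedNorm, h, ENNReal.top_rpow_of_pos (by norm_num)] at hH
      exact lt_irrefl _ hH
    refine lt_of_le_of_lt (lintegral_mono_ae (g := fun η ↦ (∫⁻ τ : ℝ, ENNReal.ofReal ((1 + τ ^ 2)⁻¹)) *
      (ENNReal.ofReal (symLam (s - 1) ((2 * Real.pi) • η)) * H η) ^ (2 : ℝ)) ?_) ?_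
    · filter_upwards [hb] with η hη
      rw [← lintegral_mul_const _ (by fun_prop)]
      refine lintegral_mono fun τ ↦ ?_
      simp only [point_fst, point_snd]
      set ξ := (2 * Real.pi) • η
      set t := 2 * Real.pi * τ with ht
      have e : symPlus (-1) t ξ = symPlus (-2) t ξ * symPlus 1 t ξ := by
        rw [symPlus_mul]; norm_num
      have e2 : ENNReal.ofReal (symLam (s - 1) ξ * symPlus (-1) t ξ * symMinus γ t ξ) *
          ‖h (point τ η)‖ₑ = ENNReal.ofReal (symPlus (-2) t ξ) * (ENNReal.ofReal (symLam (s - 1) ξ) *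
          (ENNReal.ofReal (symPlus 1 t ξ * symMinus γ t ξ) * ‖h (point τ η)‖ₑ)) := by
        rw [← mul_assoc, ← mul_assoc, ← ENNReal.ofReal_mul (symPlus_pos _ _ _).le,
          ← ENNReal.ofReal_mul (mul_nonneg (symPlus_pos _ _ _).le (symLam_pos _ _).le), e]
        congr 2
        ring
      rw [e2, ENNReal.mul_rpow_of_nonneg _ _ (by norm_num)]
      gcongr
      · have h1 : symPlus (-2) t ξ ≤ (1 + τ ^ 2)⁻¹ := by
          have e3 : symPlus (-2) t ξ = (symPlus 2 t ξ)⁻¹ := by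
            exact eq_inv_of_mul_eq_one_left (by rw [symPlus_mul]; simp)
          rw [e3, symPlus_two]
          have : τ ^ 2 ≤ t ^ 2 := by
            rw [ht, mul_pow]
            exact le_mul_of_one_le_left (sq_nonneg τ) (by nlinarith [Real.pi_gt_three])
          exact inv_anti₀ (by positivity) (by nlinarith [sq_nonneg ‖ξ‖])
        have h2 : (1 + τ ^ 2)⁻¹ ≤ 1 := inv_le_one_of_one_le₀ (by nlinarith [sq_nonneg τ])
        rw [ENNReal.ofReal_rpow_of_nonneg (symPlus_pos _ _ _).le (by norm_num)]
        refine ENNReal.ofReal_le_ofReal ?_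
        rw [Real.rpow_two]
        have h0 := (symPlus_pos (-2) t ξ).le
        nlinarith
      · exact hη τ
    · rw [lintegral_const_mul' _ _ hp.ne]
      exact ENNReal.mul_lt_top hp hw

theorem mixedNorm_le {s γ : ℝ} {u : 𝓢'(SpaceTime n, ℂ)} {h : SpaceTime n → ℂ}
    (hu : IsFunction (𝓕 u) h) {H : Space n → ℝ≥0∞}
    (hb : ∀ᵐ η : Space n, ∀ τ, ENNReal.ofReal (symPlus 1 (2 * Real.pi * τ) ((2 * Real.pi) • η) *
      symMinus γ (2 * Real.pi * τ) ((2 * Real.pi) • η)) * ‖h (point τ η)‖ₑ ≤ H η) :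
    mixedNorm (𝓕 (lamX (s - 1) (lamPlus 1 (lamMinus γ u)))) ≤ weightedNorm (s - 1) H := by
  have h1 := ((hu.fourierMultiplier (hasTemperateGrowth_symMinus γ)).fourierMultiplier
    (hasTemperateGrowth_symPlus 1)).fourierMultiplier (hasTemperateGrowth_symLamX (s - 1))
  refine (iInf₂_le _ h1).trans ?_
  unfold weightedNorm
  refine ENNReal.rpow_le_rpow (lintegral_mono_ae ?_) (by norm_num)
  filter_upwards [hb] with η hη
  rw [← ENNReal.rpow_ofNat]
  gcongr
  rw [eLpNorm_exponent_top]
  refine eLpNormEssSup_le_of_ae_enorm_bound (ae_of_all _ fun τ ↦ ?_)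
  simp only [point_fst, point_snd]
  rw [enorm_ofReal_mul (symLam_pos _ _).le, enorm_ofReal_mul (symPlus_pos _ _ _).le,
    enorm_ofReal_mul (symMinus_pos _ _ _).le, ← mul_assoc (ENNReal.ofReal (symPlus _ _ _)),
    ← ENNReal.ofReal_mul (symPlus_pos _ _ _).le]
  gcongr
  exact hη τ

/-- An exponent for which the mixed norm controls a space embedded in `𝓗^{s,θ}` with `θ ≥ 0` is
nonnegative. -/
theorem nonneg_of_mixedNormBound (hι : Function.Injective ι) {s θ γ : ℝ} (hθ : 0 ≤ θ)
    (hembed : EmbedsInCalH ι s θ) (hmixed : MixedNormBound ι s γ) : 0 ≤ γ := by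
  by_contra! hγ
  have hm1 := measurable_fst_spaceTime (n := n)
  have hm2 := measurable_snd_spaceTime (n := n)
  set S : Set (Space n) := Metric.closedBall 0 1 with hS
  have hSm : MeasurableSet S := measurableSet_closedBall
  -- This function makes the mixed norm finite with equality of weights over the unit ball of η. If
  -- γ < 0, the energy integrand is Λ₋^{2(θ-γ)} ≥ 1 on an infinite cylinder, which contradicts the
  -- embedding.
  set h : SpaceTime n → ℂ := fun ζ ↦ S.indicator (fun _ ↦
    ((symLam (-(s - 1)) ((2 * Real.pi) • ζ.snd) *
    (symPlus (-1) (2 * Real.pi * ζ.fst) ((2 * Real.pi) • ζ.snd) *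
    symMinus (-γ) (2 * Real.pi * ζ.fst) ((2 * Real.pi) • ζ.snd)) : ℝ) : ℂ)) ζ.snd with hh
  have hhm : Measurable h := by
    have e : h = (WithLp.snd ⁻¹' S).indicator fun ζ : SpaceTime n ↦
      ((symLam (-(s - 1)) ((2 * Real.pi) • ζ.snd) *
      (symPlus (-1) (2 * Real.pi * ζ.fst) ((2 * Real.pi) • ζ.snd) *
      symMinus (-γ) (2 * Real.pi * ζ.fst) ((2 * Real.pi) • ζ.snd)) : ℝ) : ℂ) := by
      ext ζ
      simp only [hh, Set.indicator, Set.mem_preimage]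
      rfl
    rw [e]
    exact Measurable.indicator (by fun_prop) (hm2 hSm)
  set H : Space n → ℝ≥0∞ := S.indicator fun η ↦
    ENNReal.ofReal (symLam (-(s - 1)) ((2 * Real.pi) • η)) with hHdef
  have hnorm (τ : ℝ) (η : Space n) (hη : η ∈ S) : ‖h (point τ η)‖ₑ =
      ENNReal.ofReal (symLam (-(s - 1)) ((2 * Real.pi) • η) *
      (symPlus (-1) (2 * Real.pi * τ) ((2 * Real.pi) • η) *
      symMinus (-γ) (2 * Real.pi * τ) ((2 * Real.pi) • η))) := by
    rw [hh]
    simp only [point_snd, point_fst, Set.indicator_of_mem hη]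
    rw [← ofReal_norm, Complex.norm_real, Real.norm_of_nonneg]
    have := symLam_pos (-(s - 1)) ((2 * Real.pi) • η)
    have := symPlus_pos (-1) (2 * Real.pi * τ) ((2 * Real.pi) • η)
    have := symMinus_pos (-γ) (2 * Real.pi * τ) ((2 * Real.pi) • η)
    positivity
  have hb : ∀ᵐ η : Space n, ∀ τ, ENNReal.ofReal (symPlus 1 (2 * Real.pi * τ) ((2 * Real.pi) • η) *
      symMinus γ (2 * Real.pi * τ) ((2 * Real.pi) • η)) * ‖h (point τ η)‖ₑ ≤ H η := by
    refine ae_of_all _ fun η τ ↦ ?_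
    by_cases hη : η ∈ S
    · rw [hnorm τ η hη, hHdef, Set.indicator_of_mem hη, ← ENNReal.ofReal_mul
        (mul_nonneg (symPlus_pos _ _ _).le (symMinus_pos _ _ _).le), mul_left_comm,
        mul_mul_mul_comm, symPlus_mul, symMinus_mul]
      simp
    · simp [hh, hη]
  have hH : weightedNorm (s - 1) H < ∞ := by
    refine ENNReal.rpow_lt_top_of_nonneg (by norm_num) (ne_of_lt ?_)
    have e (η : Space n) : (ENNReal.ofReal (symLam (s - 1) ((2 * Real.pi) • η)) * H η) ^ (2 : ℝ) =
        S.indicator (fun _ ↦ 1) η := by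
      by_cases hη : η ∈ S
      · rw [hHdef, Set.indicator_of_mem hη, Set.indicator_of_mem hη,
          ← ENNReal.ofReal_mul (symLam_pos _ _).le, symLam_mul]
        simp
      · simp [hHdef, hη]
    simp_rw [e]
    rw [lintegral_indicator hSm, lintegral_const, one_mul, Measure.restrict_apply_univ]
    exact measure_closedBall_lt_top
  obtain ⟨u, hu⟩ := exists_of_mixed_bound hhm hH hb
  obtain ⟨B, hB⟩ := hmixed
  obtain ⟨A, hA⟩ := hembed
  have h1 : spaceNorm ι u < ∞ := ((hB u).trans (mul_le_mul_right (mixedNorm_le hu hb) _)).trans_lt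
    (ENNReal.mul_lt_top (by simp) hH)
  obtain ⟨x, rfl, -⟩ := exists_of_spaceNorm_lt_top hι h1
  have h2 : energyNorm s θ h < ∞ := (energyNorm_le_calHNorm hhm hu).trans_lt
    ((hA x).trans_lt (ENNReal.mul_lt_top (by simp) (by simp)))
  have h3 : ∫⁻ ζ : SpaceTime n, (ENNReal.ofReal (symLam (s - 1) ((2 * Real.pi) • ζ.snd) *
    symPlus 1 (2 * Real.pi * ζ.fst) ((2 * Real.pi) • ζ.snd) *
    symMinus θ (2 * Real.pi * ζ.fst) ((2 * Real.pi) • ζ.snd)) * ‖h ζ‖ₑ) ^ (2 : ℝ) ≠ ∞ := by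
    intro h
    rw [energyNorm, h, ENNReal.top_rpow_of_pos (by norm_num)] at h2
    exact lt_irrefl _ h2
  refine h3 ?_
  rw [lintegral_spaceTime (by fun_prop), eq_top_iff]
  have h4 : ∫⁻ η : Space n, S.indicator (fun _ ↦ (∞ : ℝ≥0∞)) η = ∞ := by
    rw [lintegral_indicator hSm, lintegral_const, Measure.restrict_apply_univ, ENNReal.top_mul]
    exact (Metric.measure_closedBall_pos volume _ one_pos).ne'
  rw [← h4]
  refine lintegral_mono fun η ↦ ?_
  by_cases hη : η ∈ S
  · rw [Set.indicator_of_mem hη]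
    have h5 : ∫⁻ _ : ℝ, (1 : ℝ≥0∞) = ∞ := by simp
    rw [← h5]
    refine lintegral_mono fun τ ↦ ?_
    simp only [point_fst, point_snd]
    rw [hnorm τ η hη, ← ENNReal.ofReal_mul (mul_nonneg (mul_nonneg (symLam_pos _ _).le
      (symPlus_pos _ _ _).le) (symMinus_pos _ _ _).le), ← mul_assoc (symLam _ _),
      mul_mul_mul_comm, mul_mul_mul_comm (symLam _ _), symLam_mul, symPlus_mul, symMinus_mul]
    refine ENNReal.one_le_rpow ?_ (by norm_num)
    simp only [add_neg_cancel, symLam_zero, symPlus_zero, one_mul]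
    rw [ENNReal.one_le_ofReal]
    exact one_le_symMinus (by linarith) _ _
  · simp [hη]

end MixedNorm

/-! ### Elements of the space that are localized in time -/

section TimeLocalized

variable {X : Type*} [NormedAddCommGroup X] [NormedSpace ℂ X] {ι : X →ₗ[ℂ] 𝓢'(SpaceTime n, ℂ)}

theorem EmbedsInCalH.exists_energyNorm_le {s θ : ℝ} (hembed : EmbedsInCalH ι s θ) :
    ∃ A : ℝ≥0, ∀ (x : X) (a : SpaceTime n → ℂ), Measurable a → IsFunction (𝓕 (ι x)) a →
      energyNorm s θ a ≤ A * ‖x‖ₑ := by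
  obtain ⟨A, hA⟩ := hembed
  exact ⟨A, fun x a ha h ↦ (energyNorm_le_calHNorm ha h).trans (hA x)⟩

theorem EmbedsInCalH.exists_fiberMass_le {s θ : ℝ} (hθ : 1 / 2 < θ) (hembed : EmbedsInCalH ι s θ) :
    ∃ A : ℝ≥0, ∀ (x : X) (a : SpaceTime n → ℂ), Measurable a → IsFunction (𝓕 (ι x)) a →
      weightedNorm (s - 1) (fiberMass a) ≤ A * ‖x‖ₑ := by
  obtain ⟨A, hA⟩ := hembed.exists_energyNorm_le
  obtain ⟨C, hC⟩ := exists_weightedNorm_fiberMass_le n hθ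
  refine ⟨C * A, fun x a ha h ↦ (hC s a ha).trans ?_⟩
  rw [ENNReal.coe_mul, mul_assoc]
  gcongr
  exact hA x a ha h

theorem EmbedsInCalH.fiberMass_lt_top {s θ : ℝ} (hθ : 1 / 2 < θ) (hembed : EmbedsInCalH ι s θ)
    {x : X} {a : SpaceTime n → ℂ} (ha : Measurable a) (h : IsFunction (𝓕 (ι x)) a) :
    weightedNorm (s - 1) (fiberMass a) < ∞ := by
  obtain ⟨A, hA⟩ := hembed.exists_fiberMass_le hθ
  exact (hA x a ha h).trans_lt (ENNReal.mul_lt_top (by simp) (by simp))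

theorem fiberInv_angFT {h : ℝ → Space n → ℂ} {η : Space n} (hc : Continuous fun t ↦ h t η)
    (hs : ∀ t, 2 < |t| → h t η = 0)
    (hi : Integrable fun τ : ℝ ↦ angFT (fun t ↦ h t η) (2 * Real.pi * τ)) (t : ℝ) :
    fiberInv (fun ζ ↦ angFT (fun t ↦ h t ζ.snd) (2 * Real.pi * ζ.fst)) t η = h t η := by
  have e : (fun τ : ℝ ↦ angFT (fun t ↦ h t η) (2 * Real.pi * τ)) = 𝓕 (fun t ↦ h t η) := by
    ext τ
    rw [fourier_eq_angFT]
  have h1 := hc.fourierInv_fourier_eq (integrable_of_support hc hs) (e ▸ hi)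
  have h2 := congrFun h1 t
  rw [fourierInv_eq_integral_wave, ← e] at h2
  exact h2

theorem measurable_angFT_fiber {h : ℝ → Space n → ℂ}
    (hm : Measurable fun p : ℝ × Space n ↦ h p.1 p.2) :
    Measurable fun ζ : SpaceTime n ↦ angFT (fun t ↦ h t ζ.snd) (2 * Real.pi * ζ.fst) := by
  have hm1 := measurable_fst_spaceTime (n := n)
  have hm2 := measurable_snd_spaceTime (n := n)
  refine StronglyMeasurable.measurable (StronglyMeasurable.integral_prod_right
    (ν := (volume : Measure ℝ)) (f := fun (ζ : SpaceTime n) (t : ℝ) ↦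
      wave (-(2 * Real.pi * ζ.fst)) t * h t ζ.snd) (Measurable.stronglyMeasurable ?_))
  refine Measurable.mul ?_ (hm.comp (measurable_snd.prodMk (hm2.comp measurable_fst)))
  exact continuous_wave.measurable.comp
    ((((hm1.comp measurable_fst).const_mul _).neg).prodMk measurable_snd)

/-- A function that is compactly supported in time and whose Fourier transform has a finite mixed
norm belongs to a space controlled by that norm. -/
theorem exists_of_timeLocalized (hι : Function.Injective ι) {s θ γ : ℝ} (hθ : 1 / 2 < θ)
    (hembed : EmbedsInCalH ι s θ) {B : ℝ≥0} (hB : ∀ u : 𝓢'(SpaceTime n, ℂ),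
      spaceNorm ι u ≤ B * mixedNorm (𝓕 (lamX (s - 1) (lamPlus 1 (lamMinus γ u)))))
    {h : ℝ → Space n → ℂ} (hm : Measurable fun p : ℝ × Space n ↦ h p.1 p.2)
    (hc : ∀ᵐ η, Continuous fun t ↦ h t η) (hs : ∀ t η, 2 < |t| → h t η = 0)
    {H : Space n → ℝ≥0∞} (hH : weightedNorm (s - 1) H < ∞)
    (hb : ∀ᵐ η : Space n, ∀ τ, ENNReal.ofReal (symPlus 1 (2 * Real.pi * τ) ((2 * Real.pi) • η) *
      symMinus γ (2 * Real.pi * τ) ((2 * Real.pi) • η)) *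
        ‖angFT (fun t ↦ h t η) (2 * Real.pi * τ)‖ₑ ≤ H η) :
    ∃ (x : X) (k : SpaceTime n → ℂ), Measurable k ∧ IsFunction (𝓕 (ι x)) k ∧
      ‖x‖ₑ ≤ B * weightedNorm (s - 1) H ∧ ∀ᵐ η, ∀ t, fiberInv k t η = h t η := by
  set k : SpaceTime n → ℂ := fun ζ ↦ angFT (fun t ↦ h t ζ.snd) (2 * Real.pi * ζ.fst)
  have hk : Measurable k := measurable_angFT_fiber hm
  obtain ⟨u, hu⟩ := exists_of_mixed_bound (h := k) hk hH hb
  have h1 : spaceNorm ι u ≤ B * weightedNorm (s - 1) H :=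
    (hB u).trans (mul_le_mul_right (mixedNorm_le hu hb) _)
  obtain ⟨x, rfl, hx⟩ := exists_of_spaceNorm_lt_top hι
    (h1.trans_lt (ENNReal.mul_lt_top (by simp) hH))
  refine ⟨x, k, hk, hu, hx.le.trans h1, ?_⟩
  -- Integrability in τ, needed for Fourier inversion in t, is provided by the embedding once
  -- membership in the space is known.
  filter_upwards [hc, ae_integrable_fiber hk (hembed.fiberMass_lt_top hθ hk hu)] with η h2 h3 t
  exact fiberInv_angFT h2 (fun t ↦ hs t η) h3 t

theorem fiberInv_add {k k' : SpaceTime n → ℂ} {η : Space n}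
    (h : Integrable fun τ ↦ k (point τ η)) (h' : Integrable fun τ ↦ k' (point τ η)) (t : ℝ) :
    fiberInv (fun ζ ↦ k ζ + k' ζ) t η = fiberInv k t η + fiberInv k' t η := by
  have i1 (ω : ℝ → ℝ) (hω : Continuous ω) {f : ℝ → ℂ} (hf : Integrable f) :
      Integrable fun τ ↦ wave (ω τ) t * f τ := by
    refine hf.bdd_mul (c := 1) (continuous_wave.comp
      (hω.prodMk continuous_const)).aestronglyMeasurable (ae_of_all _ fun τ ↦ (norm_wave _ _).le)
  unfold fiberInv
  simp_rw [mul_add]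
  exact integral_add (i1 _ (by fun_prop) h) (i1 _ (by fun_prop) h')

/-- The element is a continuous curve in H^s, and equality almost everywhere of the space Fourier
transforms at time t is equality of the curves at t. -/
theorem restrictionNorm_le {s θ T : ℝ} (hθ : 1 / 2 < θ) (hembed : EmbedsInCalH ι s θ)
    {x : X} {k : SpaceTime n → ℂ} (hk : Measurable k) (hx : IsFunction (𝓕 (ι x)) k)
    {u : ℝ → 𝓢'(Space n, ℂ)} {U : ℝ → Space n → ℂ} (hu : ∀ t, IsFunction (𝓕 (u t)) (U t))
    (h : ∀ t ∈ Set.Icc 0 T, ∀ᵐ η, fiberInv k t η = U t η) :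
    restrictionNorm ι s T u ≤ ‖x‖ₑ := by
  obtain ⟨v, hv, hvx, hvk⟩ := exists_curve_of_fiberMass hk (hembed.fiberMass_lt_top hθ hk hx) hx
  exact (iInf_le _ x).trans (iInf_le _ ⟨v, hv, hvx, fun t ht ↦ (hvk t).fourier_ext (hu t) (h t ht)⟩)

end TimeLocalized

/-! ### Free waves -/

section FreePart

variable {X : Type*} [NormedAddCommGroup X] [NormedSpace ℂ X] {ι : X →ₗ[ℂ] 𝓢'(SpaceTime n, ℂ)}

/-- One power of the distance replaces Λ₊ by 1 + |ξ|, two bound Λ₋^γ: exactly the decay available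
for the localized kernels. -/
theorem symPlus_mul_symMinus_le {γ : ℝ} (hγ : γ ≤ 2) (ω : ℝ) (ξ : Space n) :
    symPlus 1 ω ξ * symMinus γ ω ξ ≤ 4 * (1 + ‖ξ‖) * (1 + |(|ω| - ‖ξ‖)|) ^ 3 := by
  have h1 := (symPlus_one_le ω ξ).trans (one_add_add_le (norm_nonneg ξ) ω)
  have h2 := (symMinus_mono hγ ω ξ).trans (symMinus_two_le ω ξ)
  rw [← sq_abs (|ω| - ‖ξ‖)] at h2
  set d := |(|ω| - ‖ξ‖)|
  have hd : 0 ≤ d := abs_nonneg _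
  have h3 : symMinus γ ω ξ ≤ 2 * (1 + d) ^ 2 := by nlinarith
  calc _ ≤ 2 * (1 + ‖ξ‖) * (1 + d) * (2 * (1 + d) ^ 2) := by
        gcongr
        exact (symMinus_pos _ _ _).le
    _ = _ := by ring

/-- The Fourier transform in space of the free wave with data of Fourier transforms `b`, `c`,
localized in time. -/
def localizedFree (b c : Space n → ℂ) (t : ℝ) (η : Space n) : ℂ :=
  cutoff t * (b η * (Real.cos (2 * Real.pi * ‖η‖ * t) : ℝ) +
    c η * (sinKer (2 * Real.pi * ‖η‖) t : ℝ))

theorem exists_mul_norm_angFT_localizedFree_le : ∃ C : ℝ, 0 ≤ C ∧ ∀ (n : ℕ) (γ : ℝ), γ ≤ 2 →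
    ∀ (b c : Space n → ℂ) (η : Space n) (ω : ℝ),
    symPlus 1 ω ((2 * Real.pi) • η) * symMinus γ ω ((2 * Real.pi) • η) *
      ‖angFT (fun t ↦ localizedFree b c t η) ω‖ ≤
        C * (symLam 1 ((2 * Real.pi) • η) * ‖b η‖ + ‖c η‖) := by
  obtain ⟨C₁, hC₁, h₁⟩ := exists_angFT_cutoff_cos_le
  obtain ⟨C₂, hC₂, h₂⟩ := exists_angFT_cutoff_sinKer_le
  refine ⟨8 * C₁ + 4 * C₂, by positivity, fun n γ hγ b c η ω ↦ ?_⟩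
  set ξ := (2 * Real.pi) • η with hξ
  have hr : 2 * Real.pi * ‖η‖ = ‖ξ‖ := (norm_two_pi_smul η).symm
  have k1 := h₁ ‖ξ‖ (norm_nonneg ξ) ω
  have k2 := h₂ ‖ξ‖ (norm_nonneg ξ) ω
  have hcos : Continuous fun t : ℝ ↦ ((Real.cos (‖ξ‖ * t) : ℝ) : ℂ) := by fun_prop
  have hsin : Continuous fun t : ℝ ↦ ((sinKer ‖ξ‖ t : ℝ) : ℂ) :=
    Complex.continuous_ofReal.comp (continuous_sinKer_right _)
  have e : angFT (fun t ↦ localizedFree b c t η) ω =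
      b η * angFT (fun t ↦ cutoff t * (Real.cos (‖ξ‖ * t) : ℝ)) ω +
        c η * angFT (fun t ↦ cutoff t * (sinKer ‖ξ‖ t : ℝ)) ω := by
    rw [← angFT_const_mul, ← angFT_const_mul, ← angFT_add ((integrable_cutoff_mul hcos).const_mul _)
      ((integrable_cutoff_mul hsin).const_mul _)]
    congr 1 with t
    rw [localizedFree, hr]
    ring
  set A₁ := angFT (fun t ↦ cutoff t * (Real.cos (‖ξ‖ * t) : ℝ)) ω
  set A₂ := angFT (fun t ↦ cutoff t * (sinKer ‖ξ‖ t : ℝ)) ω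
  set d := |(|ω| - ‖ξ‖)|
  have hd : 0 ≤ d := abs_nonneg _
  have h0 := norm_nonneg ξ
  have h4 := one_le_symLam_one ξ
  have h5 := norm_le_symLam_one ξ
  calc _ ≤ 4 * (1 + ‖ξ‖) * (1 + d) ^ 3 * (‖b η‖ * ‖A₁‖ + ‖c η‖ * ‖A₂‖) := by
        refine mul_le_mul (symPlus_mul_symMinus_le hγ ω ξ) ?_ (norm_nonneg _) (by positivity)
        rw [e, ← norm_mul, ← norm_mul]
        exact norm_add_le _ _
    _ = 4 * (1 + ‖ξ‖) * ‖b η‖ * ((1 + d) ^ 3 * ‖A₁‖) +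
        4 * ‖c η‖ * ((1 + ‖ξ‖) * (1 + d) ^ 3 * ‖A₂‖) := by ring
    _ ≤ 4 * (2 * symLam 1 ξ) * ‖b η‖ * C₁ + 4 * ‖c η‖ * C₂ := by
        gcongr
        linarith
    _ ≤ _ := by
        have := mul_nonneg hC₂ (mul_nonneg (symLam_pos 1 ξ).le (norm_nonneg (b η)))
        have := mul_nonneg hC₁ (norm_nonneg (c η))
        linarith

/-- Free waves belong to the space, locally in time. -/
theorem exists_localizedFree (hι : Function.Injective ι) {s θ γ : ℝ} (hθ : 1 / 2 < θ) (hγ : γ ≤ 2)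
    (hembed : EmbedsInCalH ι s θ) (hmixed : MixedNormBound ι s γ) :
    ∃ C : ℝ≥0, ∀ b c : Space n → ℂ, Measurable b → Measurable c →
      weightedNorm s (fun η ↦ ‖b η‖ₑ) < ∞ → weightedNorm (s - 1) (fun η ↦ ‖c η‖ₑ) < ∞ →
      ∃ (x : X) (k : SpaceTime n → ℂ), Measurable k ∧ IsFunction (𝓕 (ι x)) k ∧
        ‖x‖ₑ ≤ C * (weightedNorm s (fun η ↦ ‖b η‖ₑ) + weightedNorm (s - 1) fun η ↦ ‖c η‖ₑ) ∧
        ∀ᵐ η, ∀ t, fiberInv k t η = localizedFree b c t η := by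
  obtain ⟨B, hB⟩ := hmixed
  obtain ⟨D, hD0, hD⟩ := exists_mul_norm_angFT_localizedFree_le
  refine ⟨B * D.toNNReal, fun b c hb hc hbs hcs ↦ ?_⟩
  set H : Space n → ℝ≥0∞ := fun η ↦ ENNReal.ofReal D *
    (ENNReal.ofReal (symLam 1 ((2 * Real.pi) • η)) * ‖b η‖ₑ + ‖c η‖ₑ) with hHdef
  have hH : weightedNorm (s - 1) H ≤ ENNReal.ofReal D *
      (weightedNorm s (fun η ↦ ‖b η‖ₑ) + weightedNorm (s - 1) fun η ↦ ‖c η‖ₑ) := by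
    rw [hHdef, weightedNorm_const_mul _ ENNReal.ofReal_ne_top]
    gcongr
    refine (weightedNorm_add_le _ (by fun_prop) (by fun_prop)).trans ?_
    rw [weightedNorm_symLam_mul, sub_add_cancel]
  obtain ⟨x, k, hk, hx, hxn, hkx⟩ : ∃ (x : X) (k : SpaceTime n → ℂ), Measurable k ∧
      IsFunction (𝓕 (ι x)) k ∧ ‖x‖ₑ ≤ B * weightedNorm (s - 1) H ∧
      ∀ᵐ η, ∀ t, fiberInv k t η = localizedFree b c t η := by
    refine exists_of_timeLocalized hι hθ hembed hB ?_ ?_ ?_ (hH.trans_lt ?_) ?_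
    · unfold localizedFree
      refine Measurable.mul (continuous_cutoff.measurable.comp measurable_fst) (Measurable.add ?_ ?_)
      · fun_prop
      · refine (hc.comp measurable_snd).mul ?_
        exact (Complex.continuous_ofReal.comp
          (continuous_sinKer_comp (by fun_prop) (by fun_prop))).measurable
    · refine ae_of_all _ fun η ↦ ?_
      unfold localizedFree
      refine continuous_cutoff.mul (Continuous.add (by fun_prop) (continuous_const.mul ?_))
      exact Complex.continuous_ofReal.comp (continuous_sinKer_comp (by fun_prop) (by fun_prop))
    · intro t η ht
      rw [localizedFree, cutoff_eq_zero ht.le, zero_mul]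
    · exact ENNReal.mul_lt_top (by simp) (ENNReal.add_lt_top.2 ⟨hbs, hcs⟩)
    · refine ae_of_all _ fun η τ ↦ ?_
      have h1 := ENNReal.ofReal_le_ofReal (hD n γ hγ b c η (2 * Real.pi * τ))
      rw [ENNReal.ofReal_mul (mul_nonneg (symPlus_pos _ _ _).le (symMinus_pos _ _ _).le),
        ofReal_norm, ENNReal.ofReal_mul hD0, ENNReal.ofReal_add
          (mul_nonneg (symLam_pos _ _).le (norm_nonneg _)) (norm_nonneg _),
        ENNReal.ofReal_mul (symLam_pos _ _).le, ofReal_norm, ofReal_norm] at h1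
      exact h1
  refine ⟨x, k, hk, hx, hxn.trans ?_, hkx⟩
  rw [ENNReal.coe_mul, mul_assoc]
  gcongr
  exact hH

end FreePart

/-! ### Forcing near the cone on short time intervals -/

section ForcedPart

variable {X : Type*} [NormedAddCommGroup X] [NormedSpace ℂ X] {ι : X →ₗ[ℂ] 𝓢'(SpaceTime n, ℂ)}

/-- Since T < 1, TΛ₋ is at most of the size of 1 + Td, with d the distance to the cone. Raising to
the power γ in [0, 2] gives the loss T^{-γ} and at most two powers. -/
theorem symMinus_le_rpow {γ T : ℝ} (hγ0 : 0 ≤ γ) (hγ : γ ≤ 2) (hT : 0 < T) (hT1 : T < 1) (ω : ℝ)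
    (ξ : Space n) :
    symMinus γ ω ξ ≤ 4 * T ^ (-γ) * (1 + T * |(|ω| - ‖ξ‖)|) ^ 2 := by
  have h2 := symMinus_two_le ω ξ
  rw [← sq_abs (|ω| - ‖ξ‖), ← one_add_one_eq_two, ← symMinus_mul] at h2
  set d := |(|ω| - ‖ξ‖)|
  have hd : 0 ≤ d := abs_nonneg _
  have hw := one_le_symMinus (a := 1) zero_le_one ω ξ
  set w := symMinus 1 ω ξ
  have h3 : w ≤ 1 + 2 * d := by nlinarith
  have h4 : T ^ γ * symMinus γ ω ξ ≤ 4 * (1 + T * d) ^ 2 := by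
    rw [symMinus_eq_rpow, ← Real.mul_rpow hT.le (by linarith)]
    calc (T * w) ^ γ ≤ (1 + T * w) ^ γ := by gcongr; linarith
      _ ≤ (1 + T * w) ^ (2 : ℝ) :=
          Real.rpow_le_rpow_of_exponent_le (by nlinarith) hγ
      _ = (1 + T * w) ^ 2 := Real.rpow_two _
      _ ≤ (2 * (1 + T * d)) ^ 2 := by gcongr; nlinarith
      _ = _ := by ring
  rw [Real.rpow_neg hT.le]
  have h5 : 0 < T ^ γ := by positivity
  have h6 : symMinus γ ω ξ = (T ^ γ)⁻¹ * (T ^ γ * symMinus γ ω ξ) := by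
    field_simp
  rw [h6]
  calc _ ≤ (T ^ γ)⁻¹ * (4 * (1 + T * d) ^ 2) := by gcongr
    _ = _ := by ring

/-- The Fourier transform in space of the solution of the wave equation with vanishing data and with
a right-hand side of Fourier transform `Φ`, localized to times of order `T`. -/
def localizedForced (T : ℝ) (Φ : SpaceTime n → ℂ) (t : ℝ) (η : Space n) : ℂ :=
  ∫ τ, Φ (point τ η) * (cutoff (t / T) * duhamel (2 * Real.pi * τ) (2 * Real.pi * ‖η‖) t)

theorem norm_cutoff_mul_duhamel_le {T : ℝ} (hT : 0 < T) (hT1 : T < 1) {r : ℝ} (hr : 0 ≤ r)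
    (lam t : ℝ) : ‖cutoff (t / T) * duhamel lam r t‖ ≤ (Set.Icc (-2) 2).indicator 12 t := by
  by_cases ht : |t| ≤ 2
  · rw [Set.indicator_of_mem (Set.mem_Icc.2 (abs_le.1 ht)), norm_mul]
    have h1 := norm_cutoff_le (t / T)
    have h2 := mul_norm_duhamel_le hr lam t
    have h3 : ‖duhamel lam r t‖ ≤ 12 := by
      nlinarith [norm_nonneg (duhamel lam r t), abs_nonneg t]
    calc _ ≤ 1 * (12 : ℝ) := by gcongr
      _ = _ := by simp
  · rw [cutoff_eq_zero, zero_mul, norm_zero]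
    · exact Set.indicator_nonneg (fun _ _ ↦ by simp) _
    · rw [abs_div, abs_of_pos hT, le_div_iff₀ hT]
      nlinarith

theorem continuous_cutoff_mul_duhamel (T : ℝ) : Continuous fun p : ℝ × ℝ × ℝ ↦
    cutoff (p.2.2 / T) * duhamel p.1 p.2.1 p.2.2 :=
  (continuous_cutoff.comp (by fun_prop)).mul continuous_duhamel

/-- Fubini, with the localized response bounded by 12 on [-2, 2] uniformly in τ. -/
theorem angFT_localizedForced {T : ℝ} (hT : 0 < T) (hT1 : T < 1) {Φ : SpaceTime n → ℂ}
    {η : Space n} (h : Integrable fun τ ↦ Φ (point τ η)) (ω : ℝ) :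
    angFT (fun t ↦ localizedForced T Φ t η) ω = ∫ τ, Φ (point τ η) *
      angFT (fun t ↦ cutoff (t / T) * duhamel (2 * Real.pi * τ) (2 * Real.pi * ‖η‖) t) ω := by
  unfold angFT localizedForced
  simp_rw [← integral_const_mul]
  rw [integral_integral_swap]
  · congr 1 with τ
    congr 1 with t
    ring
  · have hi : Integrable ((Set.Icc (-2 : ℝ) 2).indicator (12 : ℝ → ℝ)) :=
      (integrable_indicator_iff measurableSet_Icc).2
        (continuous_const (y := (12 : ℝ))).continuousOn.integrableOn_Icc
    refine (hi.mul_prod h.norm).mono' ?_ ?_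
    · refine AEStronglyMeasurable.mul ?_ (AEStronglyMeasurable.mul ?_ ?_)
      · exact (continuous_wave_comp (by fun_prop) (by fun_prop)).aestronglyMeasurable
      · exact h.1.comp_snd
      · exact ((continuous_cutoff_mul_duhamel T).comp (f := fun p : ℝ × ℝ ↦
          (2 * Real.pi * p.2, 2 * Real.pi * ‖η‖, p.1)) (by fun_prop)).aestronglyMeasurable
    · refine ae_of_all _ fun p ↦ ?_
      simp only [Function.uncurry]
      rw [norm_mul, norm_wave, one_mul, norm_mul, mul_comm]
      gcongr
      exact norm_cutoff_mul_duhamel_le hT hT1 (by positivity) _ _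

/-- For each forcing frequency near the cone the kernel has size T² against Λ₊ with two powers of
decay left; these absorb Λ₋^γ at the cost T^{-γ}. The bound is uniform in that frequency, so only
the L¹ norm of the forcing enters. -/
theorem exists_mul_norm_angFT_localizedForced_le : ∃ C : ℝ, 0 ≤ C ∧ ∀ (n : ℕ) (γ T : ℝ), 0 ≤ γ →
    γ ≤ 2 → 0 < T → T < 1 → ∀ (Φ : SpaceTime n → ℂ) (η : Space n),
    (∀ τ, 3 / T < |(|2 * Real.pi * τ| - 2 * Real.pi * ‖η‖)| → Φ (point τ η) = 0) →
    Integrable (fun τ ↦ Φ (point τ η)) → ∀ ω : ℝ,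
    symPlus 1 ω ((2 * Real.pi) • η) * symMinus γ ω ((2 * Real.pi) • η) *
      ‖angFT (fun t ↦ localizedForced T Φ t η) ω‖ ≤
        C * T ^ (2 - γ) * ∫ τ, ‖Φ (point τ η)‖ := by
  obtain ⟨C, hC, h⟩ := exists_angFT_cutoff_scale_duhamel_le
  refine ⟨4 * C, by positivity, fun n γ T hγ0 hγ hT hT1 Φ η hΦ hi ω ↦ ?_⟩
  set ξ := (2 * Real.pi) • η with hξ
  have hr : 2 * Real.pi * ‖η‖ = ‖ξ‖ := (norm_two_pi_smul η).symm
  rw [angFT_localizedForced hT hT1 hi, ← integral_const_mul]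
  set W := symPlus 1 ω ξ * symMinus γ ω ξ with hW
  have hW0 : 0 ≤ W := mul_nonneg (symPlus_pos _ _ _).le (symMinus_pos _ _ _).le
  have e : W = ‖(W : ℂ)‖ := by rw [Complex.norm_real, Real.norm_of_nonneg hW0]
  rw [e, ← norm_mul, ← integral_const_mul]
  refine norm_integral_le_of_norm_le (hi.norm.const_mul _) (ae_of_all _ fun τ ↦ ?_)
  by_cases hτ : Φ (point τ η) = 0
  · simp [hτ]
  have h1 := h T hT hT1 ‖ξ‖ (norm_nonneg ξ) (2 * Real.pi * τ) (by
    rw [← hr]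
    by_contra! hc
    exact hτ (hΦ τ hc)) ω
  rw [norm_mul, norm_mul, ← e, hr, mul_left_comm, mul_comm (4 * C * _)]
  refine mul_le_mul_of_nonneg_left ?_ (norm_nonneg _)
  have hp : T ^ (2 - γ) = T ^ (-γ) * T ^ 2 := by
    rw [← Real.rpow_two, ← Real.rpow_add hT]
    ring_nf
  set A := ‖angFT (fun t ↦ cutoff (t / T) * duhamel (2 * Real.pi * τ) ‖ξ‖ t) ω‖
  set d := T * |(|ω| - ‖ξ‖)|
  have hd : 0 ≤ d := by positivity
  calc W * A ≤ (1 + |ω| + ‖ξ‖) * (4 * T ^ (-γ) * (1 + d) ^ 2) * A := by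
        rw [hW]
        gcongr
        · exact (symMinus_pos _ _ _).le
        · exact symPlus_one_le ω ξ
        · exact symMinus_le_rpow hγ0 hγ hT hT1 ω ξ
    _ = 4 * T ^ (-γ) * ((1 + |ω| + ‖ξ‖) * (1 + d) ^ 2 * A) := by ring
    _ ≤ 4 * T ^ (-γ) * (C * T ^ 2) := by gcongr
    _ = _ := by rw [hp]; ring

/-- Solutions with a right-hand side of frequencies close to the cone belong to the space, locally in
time. -/
theorem exists_localizedForced (hι : Function.Injective ι) {s θ γ : ℝ} (hθ : 1 / 2 < θ)
    (hγ0 : 0 ≤ γ) (hγ : γ ≤ 2) (hembed : EmbedsInCalH ι s θ) (hmixed : MixedNormBound ι s γ) :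
    ∃ C : ℝ≥0, ∀ T, 0 < T → T < 1 → ∀ Φ : SpaceTime n → ℂ, Measurable Φ →
      (∀ τ η, 3 / T < |(|2 * Real.pi * τ| - 2 * Real.pi * ‖η‖)| → Φ (point τ η) = 0) →
      weightedNorm (s - 1) (fun η ↦ ∫⁻ τ, ‖Φ (point τ η)‖ₑ) < ∞ →
      ∃ (x : X) (k : SpaceTime n → ℂ), Measurable k ∧ IsFunction (𝓕 (ι x)) k ∧
        ‖x‖ₑ ≤ C * ENNReal.ofReal (T ^ (2 - γ)) *
          weightedNorm (s - 1) (fun η ↦ ∫⁻ τ, ‖Φ (point τ η)‖ₑ) ∧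
        ∀ᵐ η, ∀ t, fiberInv k t η = localizedForced T Φ t η := by
  obtain ⟨B, hB⟩ := hmixed
  obtain ⟨D, hD0, hD⟩ := exists_mul_norm_angFT_localizedForced_le
  refine ⟨B * D.toNNReal, fun T hT hT1 Φ hΦ hΦs hΦn ↦ ?_⟩
  have hTγ : 0 ≤ T ^ (2 - γ) := by positivity
  have hint : ∀ᵐ η : Space n, Integrable fun τ ↦ Φ (point τ η) := by
    filter_upwards [ae_lt_top_of_weightedNorm (measurable_lintegral_enorm hΦ).aemeasurable hΦn]
      with η hη
    exact ⟨(hΦ.comp (measurable_point_comp measurable_id measurable_const)).aestronglyMeasurable,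
      hη⟩
  set H : Space n → ℝ≥0∞ := fun η ↦ ENNReal.ofReal (D * T ^ (2 - γ)) *
    ∫⁻ τ, ‖Φ (point τ η)‖ₑ with hHdef
  have hH : weightedNorm (s - 1) H = ENNReal.ofReal (D * T ^ (2 - γ)) *
      weightedNorm (s - 1) (fun η ↦ ∫⁻ τ, ‖Φ (point τ η)‖ₑ) := by
    rw [hHdef, weightedNorm_const_mul _ ENNReal.ofReal_ne_top]
  obtain ⟨x, k, hk, hx, hxn, hkx⟩ : ∃ (x : X) (k : SpaceTime n → ℂ), Measurable k ∧
      IsFunction (𝓕 (ι x)) k ∧ ‖x‖ₑ ≤ B * weightedNorm (s - 1) H ∧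
      ∀ᵐ η, ∀ t, fiberInv k t η = localizedForced T Φ t η := by
    refine exists_of_timeLocalized hι hθ hembed hB ?_ ?_ ?_ (hH.trans_lt ?_) ?_
    · refine StronglyMeasurable.measurable (StronglyMeasurable.integral_prod_right
        (ν := (volume : Measure ℝ)) (f := fun (p : ℝ × Space n) (τ : ℝ) ↦ Φ (point τ p.2) *
          (cutoff (p.1 / T) * duhamel (2 * Real.pi * τ) (2 * Real.pi * ‖p.2‖) p.1))
        (Measurable.stronglyMeasurable (Measurable.mul ?_ ?_)))
      · exact hΦ.comp (measurable_point_comp measurable_snd (measurable_snd.comp measurable_fst))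
      · exact ((continuous_cutoff_mul_duhamel T).comp (f := fun p : (ℝ × Space n) × ℝ ↦
          (2 * Real.pi * p.2, 2 * Real.pi * ‖p.1.2‖, p.1.1)) (by fun_prop)).measurable
    · filter_upwards [hint] with η hη
      refine continuous_of_dominated (bound := fun τ ↦ ‖Φ (point τ η)‖ * 12) (fun t ↦ ?_)
        (fun t ↦ ae_of_all _ fun τ ↦ ?_) (hη.norm.mul_const _) (ae_of_all _ fun τ ↦ ?_)
      · exact hη.1.mul ((continuous_cutoff_mul_duhamel T).comp (f := fun τ : ℝ ↦
          (2 * Real.pi * τ, 2 * Real.pi * ‖η‖, t)) (by fun_prop)).aestronglyMeasurable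
      · rw [norm_mul]
        gcongr
        exact (norm_cutoff_mul_duhamel_le hT hT1 (by positivity) _ _).trans
          (Set.indicator_le_self' (fun _ _ ↦ by simp) _)
      · exact continuous_const.mul ((continuous_cutoff_mul_duhamel T).comp (f := fun t : ℝ ↦
          (2 * Real.pi * τ, 2 * Real.pi * ‖η‖, t)) (by fun_prop))
    · intro t η ht
      rw [localizedForced]
      refine integral_eq_zero_of_ae (ae_of_all _ fun τ ↦ ?_)
      have : cutoff (t / T) = 0 := cutoff_eq_zero (by
        rw [abs_div, abs_of_pos hT, le_div_iff₀ hT]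
        nlinarith)
      simp [this]
    · exact ENNReal.mul_lt_top (by simp) hΦn
    · filter_upwards [hint] with η hη τ
      have h1 := ENNReal.ofReal_le_ofReal (hD n γ T hγ0 hγ hT hT1 Φ η (fun τ ↦ hΦs τ η) hη
        (2 * Real.pi * τ))
      rw [ENNReal.ofReal_mul (mul_nonneg (symPlus_pos _ _ _).le (symMinus_pos _ _ _).le),
        ofReal_norm, ENNReal.ofReal_mul (mul_nonneg hD0 hTγ),
        ofReal_integral_norm_eq_lintegral_enorm hη] at h1
      exact h1
  refine ⟨x, k, hk, hx, hxn.trans (le_of_eq ?_), hkx⟩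
  rw [hH, ENNReal.coe_mul, ENNReal.ofReal_mul hD0, mul_assoc, mul_assoc, mul_assoc]
  rfl

end ForcedPart

/-! ### Splitting the forcing by the distance to the cone -/

section FrequencySplitting

/-- The frequencies at distance greater than `p` from the cone. -/
def farSet (p : ℝ) : Set (SpaceTime n) :=
  {ζ | p < symMinus 1 (2 * Real.pi * ζ.fst) ((2 * Real.pi) • ζ.snd)}

/-- The part of `forcing ε a` with frequencies close to the cone. -/
def nearPart (p ε : ℝ) (a : SpaceTime n → ℂ) : SpaceTime n → ℂ := (farSet p)ᶜ.indicator (forcing ε a)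

/-- The quotient of `forcing ε a` by the symbol of the wave operator, far from the cone. -/
def farPart (p ε : ℝ) (a : SpaceTime n → ℂ) : SpaceTime n → ℂ := (farSet p).indicator fun ζ ↦
  forcing ε a ζ / (((2 * Real.pi * ζ.fst) ^ 2 - (2 * Real.pi * ‖ζ.snd‖) ^ 2 : ℝ) : ℂ)

theorem measurableSet_farSet (p : ℝ) : MeasurableSet (farSet (n := n) p) := by
  have hm1 := measurable_fst_spaceTime (n := n)
  have hm2 := measurable_snd_spaceTime (n := n)
  exact measurableSet_lt measurable_const (by fun_prop)

theorem measurable_nearPart (p ε : ℝ) {a : SpaceTime n → ℂ} (ha : Measurable a) :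
    Measurable (nearPart p ε a) :=
  (measurable_forcing ε ha).indicator (measurableSet_farSet p).compl

theorem measurable_farPart (p ε : ℝ) {a : SpaceTime n → ℂ} (ha : Measurable a) :
    Measurable (farPart p ε a) := by
  have hm1 := measurable_fst_spaceTime (n := n)
  have hm2 := measurable_snd_spaceTime (n := n)
  have hm3 := measurable_forcing ε ha
  exact Measurable.indicator (by fun_prop) (measurableSet_farSet p)

/-- The ratio of □̃ to □ is at most 2 there, and Λ₋^{-ε} ≤ q^{-ε} because Λ₋ exceeds 2q. -/
theorem norm_farPart_le {q ε : ℝ} (hq : 1 ≤ q) (hε : 0 ≤ ε) (a : SpaceTime n → ℂ)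
    (ζ : SpaceTime n) : ‖farPart (2 * q) ε a ζ‖ ≤ 2 * q ^ (-ε) * ‖a ζ‖ := by
  by_cases hζ : ζ ∈ farSet (2 * q)
  · rw [farPart, Set.indicator_of_mem hζ, norm_div, ← point_fst_snd ζ, norm_forcing,
      Complex.norm_real, Real.norm_eq_abs]
    simp only [point_fst, point_snd]
    simp only [farSet, Set.mem_ofPred_eq] at hζ
    rw [← norm_two_pi_smul]
    set ω := 2 * Real.pi * ζ.fst
    set ξ := (2 * Real.pi) • ζ.snd
    have h1 : symPlus 1 ω ξ * symMinus 1 ω ξ ≤ 2 * |ω ^ 2 - ‖ξ‖ ^ 2| :=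
      mul_le_abs_sq_sub_sq (by linarith)
    have hP := symPlus_pos 1 ω ξ
    have hM := symMinus_pos 1 ω ξ
    have h2 : 0 < |ω ^ 2 - ‖ξ‖ ^ 2| := by nlinarith [mul_pos hP hM]
    have h3 : symMinus (1 - ε) ω ξ ≤ symMinus 1 ω ξ * q ^ (-ε) := by
      rw [sub_eq_add_neg, ← symMinus_mul, symMinus_eq_rpow (-ε)]
      gcongr ?_ * ?_
      exact Real.rpow_le_rpow_of_nonpos (by linarith) (by linarith) (by linarith)
    rw [div_le_iff₀ h2]
    calc symPlus 1 ω ξ * symMinus (1 - ε) ω ξ * ‖a (point ζ.fst ζ.snd)‖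
        ≤ symPlus 1 ω ξ * (symMinus 1 ω ξ * q ^ (-ε)) * ‖a (point ζ.fst ζ.snd)‖ := by gcongr
      _ = (symPlus 1 ω ξ * symMinus 1 ω ξ) * (q ^ (-ε) * ‖a (point ζ.fst ζ.snd)‖) := by ring
      _ ≤ (2 * |ω ^ 2 - ‖ξ‖ ^ 2|) * (q ^ (-ε) * ‖a (point ζ.fst ζ.snd)‖) := by gcongr
      _ = _ := by ring
  · rw [farPart, Set.indicator_of_notMem hζ, norm_zero]
    positivity

/-- The 3 is the product of the constant 3/2 in the comparison of Λ₋ with the distance and the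
threshold factor 2. -/
theorem nearPart_eq_zero {q ε : ℝ} (a : SpaceTime n → ℂ) {τ : ℝ} {η : Space n}
    (h : 3 * q < |(|2 * Real.pi * τ| - 2 * Real.pi * ‖η‖)|) : nearPart (2 * q) ε a (point τ η) = 0 := by
  refine Set.indicator_of_notMem ?_ _
  rw [Set.mem_compl_iff, not_not, farSet, Set.mem_ofPred_eq, point_fst, point_snd]
  have := abs_sub_le_symMinus_one (2 * Real.pi * τ) ((2 * Real.pi) • η)
  rw [norm_two_pi_smul] at this
  linarith

/-- Write Λ₋^{1-ε} as Λ₋^{1-ε-θ}Λ₋^θ. The first power is at most 1 or at most (2q)^{1-ε-θ}; its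
exponent is below 1, so the 2 contributes at most 2. -/
theorem norm_nearPart_le {q ε θ : ℝ} (hq : 1 ≤ q) (hε : 0 ≤ ε) (hθ : 1 / 2 < θ)
    (a : SpaceTime n → ℂ) (τ : ℝ) (η : Space n) : ‖nearPart (2 * q) ε a (point τ η)‖ ≤
      2 * q ^ max 0 (1 - ε - θ) * (symPlus 1 (2 * Real.pi * τ) ((2 * Real.pi) • η) *
        symMinus θ (2 * Real.pi * τ) ((2 * Real.pi) • η) * ‖a (point τ η)‖) := by
  have hP := symPlus_pos 1 (2 * Real.pi * τ) ((2 * Real.pi) • η)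
  have hM := symMinus_pos θ (2 * Real.pi * τ) ((2 * Real.pi) • η)
  by_cases hζ : point τ η ∈ (farSet (2 * q))ᶜ
  · rw [nearPart, Set.indicator_of_mem hζ, norm_forcing]
    rw [Set.mem_compl_iff, farSet, Set.mem_ofPred_eq, point_fst, point_snd, not_lt] at hζ
    set ω := 2 * Real.pi * τ
    set ξ := (2 * Real.pi) • η
    have h1 : symMinus (1 - ε - θ) ω ξ ≤ 2 * q ^ max 0 (1 - ε - θ) := by
      calc symMinus (1 - ε - θ) ω ξ ≤ symMinus (max 0 (1 - ε - θ)) ω ξ :=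
            symMinus_mono (le_max_right _ _) _ _
        _ = symMinus 1 ω ξ ^ max 0 (1 - ε - θ) := symMinus_eq_rpow _ _ _
        _ ≤ (2 * q) ^ max 0 (1 - ε - θ) :=
            Real.rpow_le_rpow (symMinus_pos _ _ _).le hζ (le_max_left _ _)
        _ = 2 ^ max 0 (1 - ε - θ) * q ^ max 0 (1 - ε - θ) :=
            Real.mul_rpow (by norm_num) (by linarith)
        _ ≤ 2 ^ (1 : ℝ) * q ^ max 0 (1 - ε - θ) := by
            gcongr
            · norm_num
            · exact max_le (by norm_num) (by linarith)
        _ = _ := by rw [Real.rpow_one]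
    have h2 : symMinus (1 - ε) ω ξ = symMinus (1 - ε - θ) ω ξ * symMinus θ ω ξ := by
      rw [symMinus_mul]; ring_nf
    rw [h2]
    calc _ = symMinus (1 - ε - θ) ω ξ * (symPlus 1 ω ξ * symMinus θ ω ξ * ‖a (point τ η)‖) := by ring
      _ ≤ _ := by gcongr
  · rw [nearPart, Set.indicator_of_notMem hζ, norm_zero]
    positivity

/-- On far frequencies λ² - r² does not vanish, and `mul_duhamel` may be divided by it. -/
theorem forcing_mul_duhamel {q ε : ℝ} (hq : 1 ≤ q) (a : SpaceTime n → ℂ) (τ t : ℝ) (η : Space n) :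
    forcing ε a (point τ η) * duhamel (2 * Real.pi * τ) (2 * Real.pi * ‖η‖) t =
      nearPart (2 * q) ε a (point τ η) * duhamel (2 * Real.pi * τ) (2 * Real.pi * ‖η‖) t +
      farPart (2 * q) ε a (point τ η) * (wave (2 * Real.pi * τ) t -
        (Real.cos (2 * Real.pi * ‖η‖ * t) : ℝ) -
        Complex.I * (2 * Real.pi * τ : ℝ) * (sinKer (2 * Real.pi * ‖η‖) t : ℝ)) := by
  by_cases hζ : point τ η ∈ farSet (2 * q)
  · rw [nearPart, farPart, Set.indicator_of_notMem (by simpa using hζ), Set.indicator_of_mem hζ,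
      zero_mul, zero_add, ← mul_duhamel, point_fst, point_snd]
    have hq0 : (((2 * Real.pi * τ) ^ 2 - (2 * Real.pi * ‖η‖) ^ 2 : ℝ) : ℂ) ≠ 0 := by
      rw [Complex.ofReal_ne_zero]
      rw [farSet, Set.mem_ofPred_eq, point_fst, point_snd] at hζ
      have h1 := mul_le_abs_sq_sub_sq (by linarith :
        2 ≤ symMinus 1 (2 * Real.pi * τ) ((2 * Real.pi) • η))
      have h2 := mul_pos (symPlus_pos 1 (2 * Real.pi * τ) ((2 * Real.pi) • η))
        (symMinus_pos 1 (2 * Real.pi * τ) ((2 * Real.pi) • η))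
      rw [norm_two_pi_smul] at h1
      exact abs_pos.1 (by linarith)
    rw [div_mul_eq_mul_div, eq_div_iff hq0]
    push_cast
    ring
  · rw [nearPart, farPart, Set.indicator_of_mem (by simpa using hζ), Set.indicator_of_notMem hζ,
      zero_mul, add_zero]

theorem volume_setOf_abs_abs_sub_le {ρ δ : ℝ} :
    volume {τ : ℝ | |(|τ| - ρ)| ≤ δ} ≤ ENNReal.ofReal (4 * δ) := by
  rcases lt_or_ge δ 0 with hδ | hδ
  · have : {τ : ℝ | |(|τ| - ρ)| ≤ δ} = ∅ := by
      ext τ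
      simpa using hδ.trans_le (abs_nonneg _)
    simp [this]
  have h : {τ : ℝ | |(|τ| - ρ)| ≤ δ} ⊆ Set.Icc (ρ - δ) (ρ + δ) ∪ Set.Icc (-ρ - δ) (-ρ + δ) := by
    intro τ hτ
    rw [Set.mem_ofPred_eq, abs_le] at hτ
    rcases abs_cases τ with h | h
    · left; constructor <;> linarith
    · right; constructor <;> linarith
  refine (measure_mono h).trans ((measure_union_le _ _).trans (le_of_eq ?_))
  rw [Real.volume_Icc, Real.volume_Icc, ← ENNReal.ofReal_add (by linarith) (by linarith)]
  ring_nf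

/-- For fixed η the near frequencies lie in two intervals of total length 4q, so Cauchy–Schwarz in τ
costs q^{1/2}. This is the source of the loss α/2 in the rate. -/
theorem lintegral_nearPart_le {q ε θ : ℝ} (hq : 1 ≤ q) (hε : 0 ≤ ε) (hθ : 1 / 2 < θ)
    {a : SpaceTime n → ℂ} (ha : Measurable a) (η : Space n) :
    ∫⁻ τ, ‖nearPart (2 * q) ε a (point τ η)‖ₑ ≤
      ENNReal.ofReal (8 * q ^ (1 / 2 + max 0 (1 - ε - θ))) *
        (∫⁻ τ, (ENNReal.ofReal (symPlus 1 (2 * Real.pi * τ) ((2 * Real.pi) • η) *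
          symMinus θ (2 * Real.pi * τ) ((2 * Real.pi) • η)) * ‖a (point τ η)‖ₑ) ^ (2 : ℝ)) ^
            (1 / 2 : ℝ) := by
  have hq0 : 0 < q := by linarith
  set m := max 0 (1 - ε - θ)
  -- Radius q suffices in place of 3q because τ and η are not angular frequencies: 2πq > 3q.
  set S : Set ℝ := {τ | |(|τ| - ‖η‖)| ≤ q}
  have hS : MeasurableSet S := measurableSet_le (by fun_prop) measurable_const
  set W : ℝ → ℝ≥0∞ := fun τ ↦ ENNReal.ofReal (symPlus 1 (2 * Real.pi * τ) ((2 * Real.pi) • η) *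
    symMinus θ (2 * Real.pi * τ) ((2 * Real.pi) • η)) * ‖a (point τ η)‖ₑ with hW
  have hWm : Measurable W := by
    have := ha.comp (measurable_point_comp measurable_id (measurable_const (a := η)))
    have h2 : Measurable fun τ ↦ ‖a (point τ η)‖ₑ := this.enorm
    fun_prop
  have h1 (τ : ℝ) : ‖nearPart (2 * q) ε a (point τ η)‖ₑ ≤
      ENNReal.ofReal (2 * q ^ m) * (S.indicator 1 τ * W τ) := by
    by_cases hτ : τ ∈ S
    · rw [Set.indicator_of_mem hτ, Pi.one_apply, one_mul, hW]
      have := ENNReal.ofReal_le_ofReal (norm_nearPart_le hq hε hθ a τ η)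
      rwa [ofReal_norm, ENNReal.ofReal_mul (by positivity), ENNReal.ofReal_mul
        (mul_nonneg (symPlus_pos _ _ _).le (symMinus_pos _ _ _).le), ofReal_norm] at this
    · rw [nearPart_eq_zero, enorm_zero]
      · exact zero_le
      · rw [Set.mem_ofPred_eq, not_le] at hτ
        rw [abs_mul, abs_of_pos Real.two_pi_pos, ← mul_sub, abs_mul, abs_of_pos Real.two_pi_pos]
        nlinarith [Real.pi_gt_three]
  have h2 : ∫⁻ τ, S.indicator 1 τ * W τ ≤ ENNReal.ofReal (4 * q ^ (1 / 2 : ℝ)) *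
      (∫⁻ τ, W τ ^ (2 : ℝ)) ^ (1 / 2 : ℝ) := by
    refine (ENNReal.lintegral_mul_le_Lp_mul_Lq volume Real.HolderConjugate.two_two
      ((measurable_one.indicator hS).aemeasurable) hWm.aemeasurable).trans ?_
    gcongr
    have e (τ : ℝ) : (S.indicator (1 : ℝ → ℝ≥0∞) τ) ^ (2 : ℝ) = S.indicator 1 τ := by
      by_cases hτ : τ ∈ S <;> simp [hτ]
    simp_rw [e]
    rw [lintegral_indicator_one hS]
    calc volume S ^ (1 / 2 : ℝ) ≤ ENNReal.ofReal (4 * q) ^ (1 / 2 : ℝ) :=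
          ENNReal.rpow_le_rpow volume_setOf_abs_abs_sub_le (by norm_num)
      _ = ENNReal.ofReal ((4 * q) ^ (1 / 2 : ℝ)) :=
          ENNReal.ofReal_rpow_of_nonneg (by positivity) (by norm_num)
      _ ≤ _ := by
          refine ENNReal.ofReal_le_ofReal ?_
          rw [Real.mul_rpow (by norm_num) hq0.le]
          gcongr
          calc (4 : ℝ) ^ (1 / 2 : ℝ) ≤ 4 ^ (1 : ℝ) :=
                Real.rpow_le_rpow_of_exponent_le (by norm_num) (by norm_num)
            _ = 4 := Real.rpow_one _
  calc _ ≤ ∫⁻ τ, ENNReal.ofReal (2 * q ^ m) * (S.indicator 1 τ * W τ) := lintegral_mono h1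
    _ = ENNReal.ofReal (2 * q ^ m) * ∫⁻ τ, S.indicator 1 τ * W τ :=
        lintegral_const_mul' _ _ ENNReal.ofReal_ne_top
    _ ≤ ENNReal.ofReal (2 * q ^ m) * (ENNReal.ofReal (4 * q ^ (1 / 2 : ℝ)) *
      (∫⁻ τ, W τ ^ (2 : ℝ)) ^ (1 / 2 : ℝ)) := by gcongr
    _ = _ := by
        rw [← mul_assoc, ← ENNReal.ofReal_mul (by positivity), Real.rpow_add hq0]
        congr 2
        ring

theorem weightedNorm_nearPart_le {q ε θ : ℝ} (hq : 1 ≤ q) (hε : 0 ≤ ε) (hθ : 1 / 2 < θ) (s : ℝ)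
    {a : SpaceTime n → ℂ} (ha : Measurable a) :
    weightedNorm (s - 1) (fun η ↦ ∫⁻ τ, ‖nearPart (2 * q) ε a (point τ η)‖ₑ) ≤
      ENNReal.ofReal (8 * q ^ (1 / 2 + max 0 (1 - ε - θ))) * energyNorm s θ a := by
  refine (weightedNorm_mono (ae_of_all _ fun η ↦ lintegral_nearPart_le hq hε hθ ha η)).trans ?_
  rw [weightedNorm_const_mul _ ENNReal.ofReal_ne_top]
  gcongr
  have hm1 := measurable_fst_spaceTime (n := n)
  have hm2 := measurable_snd_spaceTime (n := n)
  rw [weightedNorm, energyNorm, lintegral_spaceTime (by fun_prop)]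
  gcongr with η
  rw [ENNReal.mul_rpow_of_nonneg _ _ (by norm_num), ← ENNReal.rpow_mul]
  norm_num only [ENNReal.rpow_one]
  rw [← lintegral_const_mul' _ _ (by finiteness)]
  gcongr with τ
  rw [← ENNReal.mul_rpow_of_nonneg _ _ (by norm_num), ← mul_assoc,
    ← ENNReal.ofReal_mul (symLam_pos _ _).le, ← mul_assoc]
  rfl

end FrequencySplitting

/-! ### The estimate in the space of restrictions -/

section Estimate

variable {X : Type*} [NormedAddCommGroup X] [NormedSpace ℂ X] {ι : X →ₗ[ℂ] 𝓢'(SpaceTime n, ℂ)}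

theorem energyNorm_le_const_mul {s θ c : ℝ} {a a' : SpaceTime n → ℂ}
    (h : ∀ ζ, ‖a ζ‖ ≤ c * ‖a' ζ‖) (hc : 0 ≤ c) :
    energyNorm s θ a ≤ ENNReal.ofReal c * energyNorm s θ a' := by
  have e : ENNReal.ofReal c = (ENNReal.ofReal c ^ (2 : ℝ)) ^ (1 / 2 : ℝ) :=
    (lintegral_sq_rpow_half _).symm
  rw [energyNorm, energyNorm, e, ← ENNReal.mul_rpow_of_nonneg _ _ (by norm_num),
    ← lintegral_const_mul' _ _ (by finiteness)]
  gcongr with ζ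
  rw [← ENNReal.mul_rpow_of_nonneg _ _ (by norm_num), mul_left_comm]
  gcongr
  rw [← ofReal_norm, ← ofReal_norm, ← ENNReal.ofReal_mul hc]
  exact ENNReal.ofReal_le_ofReal (h ζ)

theorem fiberMass_le_const_mul {c : ℝ} {a a' : SpaceTime n → ℂ} (h : ∀ ζ, ‖a ζ‖ ≤ c * ‖a' ζ‖)
    (hc : 0 ≤ c) (η : Space n) : fiberMass a η ≤ ENNReal.ofReal c * fiberMass a' η := by
  rw [fiberMass, fiberMass, ← lintegral_const_mul' _ _ ENNReal.ofReal_ne_top]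
  refine lintegral_mono fun τ ↦ ?_
  rw [mul_left_comm]
  gcongr
  rw [← ofReal_norm, ← ofReal_norm, ← ENNReal.ofReal_mul hc]
  exact ENNReal.ofReal_le_ofReal (h _)

theorem lintegral_mul_enorm_le_fiberMass (a : SpaceTime n → ℂ) (η : Space n) :
    ∫⁻ τ : ℝ, ‖Complex.I * (2 * Real.pi * τ : ℝ) * a (point τ η)‖ₑ ≤ fiberMass a η := by
  rw [fiberMass]
  gcongr with τ
  rw [enorm_mul]
  gcongr
  rw [← ofReal_norm, norm_mul, Complex.norm_I, one_mul, Complex.norm_real, Real.norm_eq_abs]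
  exact ENNReal.ofReal_le_ofReal (abs_le_symPlus_one _ _)

/-- A function dominated by the Fourier transform of an element of a Fourier monotone space. -/
theorem FourierMonotone.exists_of_le (hι : Function.Injective ι) {s θ : ℝ}
    (hembed : EmbedsInCalH ι s θ) (hmono : FourierMonotone ι) {x : X} {a k : SpaceTime n → ℂ}
    (ha : Measurable a) (hx : IsFunction (𝓕 (ι x)) a) (hk : Measurable k) {c : ℝ} (hc : 0 ≤ c)
    (h : ∀ ζ, ‖k ζ‖ ≤ c * ‖a ζ‖) :
    ∃ y : X, IsFunction (𝓕 (ι y)) k ∧ ‖y‖ₑ ≤ ENNReal.ofReal c * ‖x‖ₑ := by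
  obtain ⟨A, hA⟩ := hembed.exists_energyNorm_le
  obtain ⟨u, hu⟩ := exists_of_energyNorm_lt_top (s := s) (θ := θ) hk
    ((energyNorm_le_const_mul h hc).trans_lt (ENNReal.mul_lt_top (by simp)
      ((hA x a ha hx).trans_lt (ENNReal.mul_lt_top (by simp) (by simp)))))
  have h1 : IsFunction (𝓕 (ι ((c : ℂ) • x))) (fun ζ ↦ (c : ℂ) * a ζ) := by
    rw [map_smul]
    exact hx.fourier_smul c
  have h2 : spaceNorm ι u ≤ ENNReal.ofReal c * ‖x‖ₑ := by
    refine (hmono u _ k _ hu h1 (ae_of_all _ fun ζ ↦ ?_)).trans (le_of_eq ?_)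
    · rw [norm_mul, Complex.norm_real, Real.norm_of_nonneg hc]
      exact h ζ
    · rw [spaceNorm_apply hι, enorm_smul, ← ofReal_norm, Complex.norm_real, Real.norm_of_nonneg hc]
  obtain ⟨y, rfl, hy⟩ := exists_of_spaceNorm_lt_top hι
    (h2.trans_lt (ENNReal.mul_lt_top (by simp) (by simp)))
  exact ⟨y, hu, hy.le.trans h2⟩

theorem weightedNorm_sub_integral_le (s : ℝ) {b : Space n → ℂ} (hb : Measurable b)
    {k : Space n → ℝ → ℂ} (hk : Measurable (Function.uncurry k)) :
    weightedNorm s (fun η ↦ ‖b η - ∫ τ, k η τ‖ₑ) ≤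
      weightedNorm s (fun η ↦ ‖b η‖ₑ) + weightedNorm s (fun η ↦ ∫⁻ τ, ‖k η τ‖ₑ) := by
  refine (weightedNorm_mono (H' := fun η ↦ ‖b η‖ₑ + ∫⁻ τ, ‖k η τ‖ₑ)
    (ae_of_all _ fun η ↦ ?_)).trans (weightedNorm_add_le s (by fun_prop) ?_)
  · exact enorm_sub_le.trans (add_le_add le_rfl (enorm_integral_le_lintegral_enorm _))
  · exact (Measurable.lintegral_prod_right' hk.enorm).aemeasurable

/-- The splitting of a solution, at times `t` with `cutoff t = cutoff (t / T) = 1`, into a free wave,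
a solution forced near the cone, and a multiple of the inverse symbol far from the cone. -/
theorem localized_add_eq {q ε T t : ℝ} (hq : 1 ≤ q) (hT : 0 < T) (hT1 : T < 1)
    (ht : t ∈ Set.Icc 0 T) {a : SpaceTime n → ℂ} {b c : Space n → ℂ} {η : Space n}
    (hnear : Integrable fun τ ↦ nearPart (2 * q) ε a (point τ η))
    (hfar : Integrable fun τ ↦ farPart (2 * q) ε a (point τ η))
    (hfar' : Integrable fun τ : ℝ ↦ Complex.I * (2 * Real.pi * τ : ℝ) *
      farPart (2 * q) ε a (point τ η)) :
    localizedFree (fun η ↦ b η - ∫ τ, farPart (2 * q) ε a (point τ η))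
        (fun η ↦ c η - ∫ τ : ℝ, Complex.I * (2 * Real.pi * τ : ℝ) *
          farPart (2 * q) ε a (point τ η)) t η +
      localizedForced T (nearPart (2 * q) ε a) t η + fiberInv (farPart (2 * q) ε a) t η =
    b η * (Real.cos (2 * Real.pi * ‖η‖ * t) : ℝ) + c η * (sinKer (2 * Real.pi * ‖η‖) t : ℝ) +
      ∫ τ, forcing ε a (point τ η) * duhamel (2 * Real.pi * τ) (2 * Real.pi * ‖η‖) t := by
  have hc1 : cutoff t = 1 := cutoff_eq_one (by rw [abs_of_nonneg ht.1]; linarith [ht.2])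
  have hc2 : cutoff (t / T) = 1 := cutoff_eq_one (by
    rw [abs_of_nonneg (div_nonneg ht.1 hT.le), div_le_one hT]
    exact ht.2)
  rw [localizedFree, localizedForced, fiberInv, hc1, hc2]
  simp_rw [forcing_mul_duhamel hq, one_mul]
  have i1 : Integrable fun τ ↦ nearPart (2 * q) ε a (point τ η) *
      duhamel (2 * Real.pi * τ) (2 * Real.pi * ‖η‖) t := by
    refine hnear.mul_bdd (c := 2 * (1 + |t|) * |t|) (continuous_duhamel.comp (f := fun τ : ℝ ↦
      (2 * Real.pi * τ, 2 * Real.pi * ‖η‖, t)) (by fun_prop)).aestronglyMeasurable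
      (ae_of_all _ fun τ ↦ ?_)
    have h0 : 0 ≤ 2 * Real.pi * ‖η‖ := by positivity
    have h1 := mul_norm_duhamel_le h0 (2 * Real.pi * τ) t
    have h2 := norm_nonneg (duhamel (2 * Real.pi * τ) (2 * Real.pi * ‖η‖) t)
    nlinarith [mul_nonneg h0 h2]
  have i2 : Integrable fun τ ↦ wave (2 * Real.pi * τ) t * farPart (2 * q) ε a (point τ η) :=
    hfar.bdd_mul (c := 1) (continuous_wave_comp (by fun_prop)
      (by fun_prop)).aestronglyMeasurable (ae_of_all _ fun τ ↦ (norm_wave _ _).le)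
  have e (τ : ℝ) : farPart (2 * q) ε a (point τ η) * (wave (2 * Real.pi * τ) t -
        (Real.cos (2 * Real.pi * ‖η‖ * t) : ℝ) -
        Complex.I * (2 * Real.pi * τ : ℝ) * (sinKer (2 * Real.pi * ‖η‖) t : ℝ)) =
      wave (2 * Real.pi * τ) t * farPart (2 * q) ε a (point τ η) -
      (farPart (2 * q) ε a (point τ η) * (Real.cos (2 * Real.pi * ‖η‖ * t) : ℝ) +
        Complex.I * (2 * Real.pi * τ : ℝ) * farPart (2 * q) ε a (point τ η) *
          (sinKer (2 * Real.pi * ‖η‖) t : ℝ)) := by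
    ring
  simp_rw [e]
  have i3 := hfar.mul_const ((Real.cos (2 * Real.pi * ‖η‖ * t) : ℝ) : ℂ)
  have i4 := hfar'.mul_const ((sinKer (2 * Real.pi * ‖η‖) t : ℝ) : ℂ)
  have i5 : Integrable fun τ : ℝ ↦
      farPart (2 * q) ε a (point τ η) * (Real.cos (2 * Real.pi * ‖η‖ * t) : ℝ) +
        Complex.I * (2 * Real.pi * τ : ℝ) * farPart (2 * q) ε a (point τ η) *
          (sinKer (2 * Real.pi * ‖η‖) t : ℝ) := i3.add i4
  rw [integral_add i1 (by exact i2.sub i5), integral_sub i2 i5, integral_add i3 i4,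
    integral_mul_const, integral_mul_const]
  ring

theorem rpow_neg_rpow_neg {T : ℝ} (hT : 0 < T) (α ε : ℝ) : (T ^ (-α)) ^ (-ε) = T ^ (α * ε) := by
  rw [← Real.rpow_mul hT.le]
  ring_nf

/-- Since α ≥ 0, it may be moved inside the maximum, and a maximum with 0 is minus a minimum with 0.
-/
theorem rpow_mul_rpow_eq_rateExponent {θ γ ε α T : ℝ} (hα : 0 ≤ α) (hT : 0 < T) :
    T ^ (2 - γ) * (T ^ (-α)) ^ (1 / 2 + max 0 (1 - ε - θ)) = T ^ rateExponent θ γ ε α := by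
  rw [← Real.rpow_mul hT.le, ← Real.rpow_add hT, rateExponent]
  congr 1
  have : min 0 (α * (θ + ε - 1)) = -(α * max 0 (1 - ε - θ)) := by
    rw [mul_max_of_nonneg _ _ hα, mul_zero, ← min_neg_neg, neg_zero]
    congr 1
    ring
  rw [this]
  ring

/-- The estimate of the solution in the space of restrictions to `[0, T]`. -/
theorem exists_restrictionNorm_le (hι : Function.Injective ι) {s θ γ : ℝ} (hθ : 1 / 2 < θ)
    (hγ0 : 0 ≤ γ) (hγ : γ ≤ 2) (hembed : EmbedsInCalH ι s θ) (hmono : FourierMonotone ι)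
    (hmixed : MixedNormBound ι s γ) :
    ∃ C₀ C₁ : ℝ≥0, ∀ ε α T : ℝ, 0 ≤ ε → 0 ≤ α → α ≤ 1 → 0 < T → T < 1 →
      ∀ (b c : Space n → ℂ) (a : SpaceTime n → ℂ) (x : X) (u : ℝ → 𝓢'(Space n, ℂ)),
      Measurable b → Measurable c → Measurable a →
      weightedNorm s (fun η ↦ ‖b η‖ₑ) < ∞ → weightedNorm (s - 1) (fun η ↦ ‖c η‖ₑ) < ∞ →
      IsFunction (𝓕 (ι x)) a →
      (∀ t, IsFunction (𝓕 (u t)) (fun η ↦ b η * (Real.cos (2 * Real.pi * ‖η‖ * t) : ℝ) +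
        c η * (sinKer (2 * Real.pi * ‖η‖) t : ℝ) +
        ∫ τ, forcing ε a (point τ η) * duhamel (2 * Real.pi * τ) (2 * Real.pi * ‖η‖) t)) →
      restrictionNorm ι s T u ≤
        C₀ * (weightedNorm s (fun η ↦ ‖b η‖ₑ) + weightedNorm (s - 1) (fun η ↦ ‖c η‖ₑ)) +
        C₁ * (ENNReal.ofReal (T ^ (α * ε)) + ENNReal.ofReal (T ^ rateExponent θ γ ε α)) * ‖x‖ₑ := by
  obtain ⟨D₁, hD₁⟩ := exists_localizedFree hι hθ hγ hembed hmixed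
  obtain ⟨D₂, hD₂⟩ := exists_localizedForced hι hθ hγ0 hγ hembed hmixed
  obtain ⟨A₁, hA₁⟩ := hembed.exists_fiberMass_le hθ
  obtain ⟨A₂, hA₂⟩ := hembed.exists_energyNorm_le
  refine ⟨D₁, 4 * D₁ * A₁ + 8 * D₂ * A₂ + 2, fun ε α T hε hα hα1 hT hT1 b c a x u hb hc ha hbs hcs
    hx hu ↦ ?_⟩
  -- The far part gains q^{-ε} = T^{αε} and the near part loses powers of q. The condition α ≤ 1
  -- keeps near frequencies within 3/T of the cone, as the rescaled kernel estimate requires.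
  set q := T ^ (-α) with hqdef
  have hq : 1 ≤ q := Real.one_le_rpow_of_pos_of_le_one_of_nonpos hT hT1.le (by linarith)
  have hqT : 3 * q ≤ 3 / T := by
    have : q ≤ T ^ (-1 : ℝ) := Real.rpow_le_rpow_of_exponent_ge hT hT1.le (by linarith)
    rw [Real.rpow_neg_one] at this
    rw [div_eq_mul_inv]
    linarith
  set k₃ := farPart (2 * q) ε a with hk₃def
  have hk₃ : Measurable k₃ := measurable_farPart _ _ ha
  have hle (ζ : SpaceTime n) : ‖k₃ ζ‖ ≤ 2 * T ^ (α * ε) * ‖a ζ‖ := by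
    rw [← rpow_neg_rpow_neg hT]
    exact norm_farPart_le hq hε a ζ
  have hc0 : 0 ≤ 2 * T ^ (α * ε) := by positivity
  obtain ⟨x₃, hx₃, hn₃⟩ := hmono.exists_of_le hι hembed ha hx hk₃ hc0 hle
  have hmass : weightedNorm (s - 1) (fiberMass k₃) ≤
      ENNReal.ofReal (2 * T ^ (α * ε)) * (A₁ * ‖x‖ₑ) := by
    refine (weightedNorm_mono (ae_of_all _ (fiberMass_le_const_mul hle hc0))).trans ?_
    rw [weightedNorm_const_mul _ ENNReal.ofReal_ne_top]
    gcongr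
    exact hA₁ x a ha hx
  have hmass_top : weightedNorm (s - 1) (fiberMass k₃) < ∞ :=
    hmass.trans_lt (ENNReal.mul_lt_top ENNReal.ofReal_lt_top (ENNReal.mul_lt_top (by simp) (by simp)))
  have hk₃' : Measurable (Function.uncurry fun (η : Space n) (τ : ℝ) ↦ k₃ (point τ η)) :=
    hk₃.comp (measurable_point_comp measurable_snd measurable_fst)
  have hk₃'' : Measurable (Function.uncurry fun (η : Space n) (τ : ℝ) ↦
      Complex.I * (2 * Real.pi * τ : ℝ) * k₃ (point τ η)) :=
    (by fun_prop : Measurable fun p : Space n × ℝ ↦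
      Complex.I * (2 * Real.pi * p.2 : ℝ)).mul hk₃'
  -- The far part solves the equation with the far forcing; its position and velocity at t = 0 are
  -- removed from the data of the free wave.
  set b' : Space n → ℂ := fun η ↦ b η - ∫ τ, k₃ (point τ η)
  set c' : Space n → ℂ := fun η ↦ c η - ∫ τ : ℝ, Complex.I * (2 * Real.pi * τ : ℝ) * k₃ (point τ η)
  have hb' : Measurable b' :=
    hb.sub (hk₃'.stronglyMeasurable.integral_prod_right (ν := (volume : Measure ℝ))).measurable
  have hc' : Measurable c' :=
    hc.sub (hk₃''.stronglyMeasurable.integral_prod_right (ν := (volume : Measure ℝ))).measurable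
  have hbn : weightedNorm s (fun η ↦ ‖b' η‖ₑ) ≤ weightedNorm s (fun η ↦ ‖b η‖ₑ) +
      weightedNorm (s - 1) (fiberMass k₃) :=
    (weightedNorm_sub_integral_le s hb hk₃').trans
      (add_le_add le_rfl (weightedNorm_lintegral_enorm_le s k₃))
  have hcn : weightedNorm (s - 1) (fun η ↦ ‖c' η‖ₑ) ≤ weightedNorm (s - 1) (fun η ↦ ‖c η‖ₑ) +
      weightedNorm (s - 1) (fiberMass k₃) :=
    (weightedNorm_sub_integral_le (s - 1) hc hk₃'').trans (add_le_add le_rfl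
      (weightedNorm_mono (ae_of_all _ (lintegral_mul_enorm_le_fiberMass k₃))))
  obtain ⟨x₁, k₁, hk₁, hx₁, hn₁, hf₁⟩ := hD₁ b' c' hb' hc'
    (hbn.trans_lt (ENNReal.add_lt_top.2 ⟨hbs, hmass_top⟩))
    (hcn.trans_lt (ENNReal.add_lt_top.2 ⟨hcs, hmass_top⟩))
  have hnear := (weightedNorm_nearPart_le hq hε hθ s ha).trans
    (mul_le_mul_right (hA₂ x a ha hx) _)
  have hnear_top := hnear.trans_lt
    (ENNReal.mul_lt_top ENNReal.ofReal_lt_top (ENNReal.mul_lt_top (by simp) (by simp)))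
  have hnm := measurable_nearPart (2 * q) ε ha
  obtain ⟨x₂, k₂, hk₂, hx₂, hn₂, hf₂⟩ := hD₂ T hT hT1 (nearPart (2 * q) ε a) hnm
    (fun τ η h ↦ nearPart_eq_zero a (hqT.trans_lt h)) hnear_top
  have hxs : IsFunction (𝓕 (ι (x₁ + x₂ + x₃))) (fun ζ ↦ k₁ ζ + k₂ ζ + k₃ ζ) := by
    rw [map_add, map_add]
    exact (hx₁.fourier_add hx₂).fourier_add hx₃
  -- On [0, T] both cutoffs are 1, so the three elements of the space add up to the solution.
  have hres : restrictionNorm ι s T u ≤ ‖x₁ + x₂ + x₃‖ₑ := by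
    refine restrictionNorm_le hθ hembed (k := fun ζ ↦ k₁ ζ + k₂ ζ + k₃ ζ)
      ((hk₁.add hk₂).add hk₃) hxs hu fun t ht ↦ ?_
    filter_upwards [hf₁, hf₂, ae_integrable_fiber hk₁ (hembed.fiberMass_lt_top hθ hk₁ hx₁),
      ae_integrable_fiber hk₂ (hembed.fiberMass_lt_top hθ hk₂ hx₂),
      ae_integrable_fiber hk₃ hmass_top,
      ae_lt_top_of_weightedNorm (measurable_fiberMass hk₃).aemeasurable hmass_top,
      ae_lt_top_of_weightedNorm (measurable_lintegral_enorm hnm).aemeasurable hnear_top]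
      with η e₁ e₂ i₁ i₂ i₃ m₃ m₂
    have j₂ : Integrable fun τ ↦ nearPart (2 * q) ε a (point τ η) :=
      ⟨(hnm.comp (measurable_point_comp measurable_id measurable_const)).aestronglyMeasurable, m₂⟩
    have j₃ : Integrable fun τ : ℝ ↦ Complex.I * (2 * Real.pi * τ : ℝ) * k₃ (point τ η) :=
      ⟨(hk₃''.comp (measurable_const.prodMk measurable_id)).aestronglyMeasurable,
        (lintegral_mul_enorm_le_fiberMass k₃ η).trans_lt m₃⟩
    rw [fiberInv_add (k := fun ζ ↦ k₁ ζ + k₂ ζ) (i₁.add i₂) i₃, fiberInv_add i₁ i₂, e₁, e₂]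
    exact localized_add_eq hq hT hT1 ht j₂ i₃ j₃
  refine hres.trans ((enorm_add_le _ _).trans (add_le_add_left (enorm_add_le _ _) _) |>.trans ?_)
  set β := weightedNorm s (fun η ↦ ‖b η‖ₑ)
  set κ := weightedNorm (s - 1) (fun η ↦ ‖c η‖ₑ)
  set R := ENNReal.ofReal (T ^ (α * ε)) with hR
  set Q := ENNReal.ofReal (T ^ rateExponent θ γ ε α) with hQ
  have eR : ENNReal.ofReal (2 * T ^ (α * ε)) = 2 * R := by
    rw [ENNReal.ofReal_mul (by norm_num)]
    simp [hR]
  have b₁ : ‖x₁‖ₑ ≤ D₁ * (β + κ) + 4 * D₁ * A₁ * R * ‖x‖ₑ := by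
    calc ‖x₁‖ₑ ≤ D₁ * ((β + 2 * R * (A₁ * ‖x‖ₑ)) + (κ + 2 * R * (A₁ * ‖x‖ₑ))) := by
          rw [← eR]
          refine hn₁.trans ?_
          gcongr
          · exact hbn.trans (add_le_add le_rfl hmass)
          · exact hcn.trans (add_le_add le_rfl hmass)
      _ = _ := by ring
  have b₂ : ‖x₂‖ₑ ≤ 8 * D₂ * A₂ * Q * ‖x‖ₑ := by
    calc ‖x₂‖ₑ ≤ D₂ * ENNReal.ofReal (T ^ (2 - γ)) *
          (ENNReal.ofReal (8 * q ^ (1 / 2 + max 0 (1 - ε - θ))) * (A₂ * ‖x‖ₑ)) := by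
          refine hn₂.trans ?_
          gcongr
      _ = 8 * D₂ * A₂ * (ENNReal.ofReal (T ^ (2 - γ)) *
          ENNReal.ofReal (q ^ (1 / 2 + max 0 (1 - ε - θ)))) * ‖x‖ₑ := by
          rw [ENNReal.ofReal_mul (by norm_num)]
          simp only [ENNReal.ofReal_ofNat]
          ring
      _ = _ := by
          rw [← ENNReal.ofReal_mul (by positivity), hqdef, rpow_mul_rpow_eq_rateExponent hα hT]
  have b₃ : ‖x₃‖ₑ ≤ 2 * R * ‖x‖ₑ := eR ▸ hn₃
  calc ‖x₁‖ₑ + ‖x₂‖ₑ + ‖x₃‖ₑ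
      ≤ D₁ * (β + κ) + 4 * D₁ * A₁ * R * ‖x‖ₑ + 8 * D₂ * A₂ * Q * ‖x‖ₑ + 2 * R * ‖x‖ₑ := by gcongr
    _ ≤ D₁ * (β + κ) + 4 * D₁ * A₁ * (R + Q) * ‖x‖ₑ + 8 * D₂ * A₂ * (R + Q) * ‖x‖ₑ +
        2 * (R + Q) * ‖x‖ₑ := by
        gcongr
        · exact le_self_add
        · exact le_add_self
        · exact le_self_add
    _ = _ := by
        push_cast
        ring

end Estimate

/-! ### Inverting the multipliers and choosing the exponent -/

theorem boxTildeInv_lamMinus_boxTilde {w : 𝓢'(SpaceTime n, ℂ)} {a : SpaceTime n → ℂ}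
    (h : IsFunction (𝓕 w) a) (ε : ℝ) :
    boxTildeInv (lamMinus ε (boxTilde (lamMinus (-ε) w))) = w := by
  have h1 := (((isFunction_forcing ε h).fourierMultiplier
    (hasTemperateGrowth_symMinus ε)).fourierMultiplier
    (hasTemperateGrowth_symPlus (-1))).fourierMultiplier (hasTemperateGrowth_symMinus (-1))
  refine h1.fourier_ext h (ae_of_all _ fun ζ ↦ ?_)
  dsimp only
  rw [forcing]
  set ω := 2 * Real.pi * ζ.fst
  set ξ := (2 * Real.pi) • ζ.snd
  have e1 : symPlus (-1) ω ξ * symPlus 1 ω ξ = 1 := by rw [symPlus_mul]; simp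
  have e2 : symMinus (-1) ω ξ * symMinus ε ω ξ * symMinus (1 - ε) ω ξ = 1 := by
    rw [symMinus_mul, symMinus_mul]; simp
  have e3 : (symMinus (-1) ω ξ : ℂ) * ((symPlus (-1) ω ξ : ℂ) * ((symMinus ε ω ξ : ℂ) *
      (((symPlus 1 ω ξ * symMinus (1 - ε) ω ξ : ℝ) : ℂ) * a ζ))) =
      ((symPlus (-1) ω ξ * symPlus 1 ω ξ * (symMinus (-1) ω ξ * symMinus ε ω ξ *
        symMinus (1 - ε) ω ξ) : ℝ) : ℂ) * a ζ := by
    push_cast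
    ring
  rw [e3, e1, e2]
  simp

/-- The constant may depend on T and ε but has to satisfy the bound for every α. Compactness of [0,
1] provides one exponent α that is best for all T at once. -/
theorem exists_isMax_exponent (θ γ ε : ℝ) : ∃ α ∈ Set.Icc (0 : ℝ) 1, ∀ α' ∈ Set.Icc (0 : ℝ) 1,
    min (α' * ε) (rateExponent θ γ ε α') ≤ min (α * ε) (rateExponent θ γ ε α) := by
  obtain ⟨α, hα, h⟩ := isCompact_Icc.exists_isMaxOn (s := Set.Icc (0 : ℝ) 1) ⟨0, by simp⟩
    (f := fun α ↦ min (α * ε) (rateExponent θ γ ε α))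
    (by unfold rateExponent; fun_prop)
  exact ⟨α, hα, fun α' hα' ↦ h hα'⟩

/-- As θ + ε - 1 > -1/2, the rate is at least 2 - γ - α, which is positive for α ≤ (2 - γ)/2. -/
theorem exists_exponent_pos {θ γ ε : ℝ} (hθ : 1 / 2 < θ) (hγ : γ < 2) (hε : 0 < ε) :
    ∃ α ∈ Set.Icc (0 : ℝ) 1, 0 < min (α * ε) (rateExponent θ γ ε α) := by
  set α := min 1 ((2 - γ) / 2) with hα
  have h0 : 0 < α := lt_min one_pos (by linarith)
  have h1 : α ≤ (2 - γ) / 2 := min_le_right _ _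
  refine ⟨α, ⟨h0.le, min_le_left _ _⟩, lt_min (by positivity) ?_⟩
  have h2 : -(α / 2) ≤ min 0 (α * (θ + ε - 1)) := le_min (by linarith) (by nlinarith)
  rw [rateExponent]
  linarith

end WaveEstimate

end

/-! ### The main theorem -/

open WaveEstimate in
theorem mainTheorem1 (n : ℕ) (s θ γ : ℝ) (hθ : 1 / 2 < θ) (hγ : γ < 2)
    {X : Type*} [NormedAddCommGroup X] [NormedSpace ℂ X] [CompleteSpace X]
    (ι : X →ₗ[ℂ] 𝓢'(SpaceTime n, ℂ)) (hι : Function.Injective ι)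
    (hembed : EmbedsInCalH ι s θ)
    (hmono : FourierMonotone ι)
    (hmixed : MixedNormBound ι s γ) :
    ∃ (C : ℝ≥0) (K : ℝ → ℝ → ℝ≥0),
      (∀ ε : ℝ, 0 ≤ ε →
        ∀ (f g : 𝓢'(Space n, ℂ)) (F : 𝓢'(SpaceTime n, ℂ)),
          sobolevNorm s f < ∞ → sobolevNorm (s - 1) g < ∞ →
          (∃ x : X, F = boxTilde (lamMinus (-ε) (ι x))) →
            (∃! u : ℝ → 𝓢'(Space n, ℂ), SolvesCauchy s f g F u) ∧
            ∀ u : ℝ → 𝓢'(Space n, ℂ), SolvesCauchy s f g F u →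
              ∀ T : ℝ, 0 < T → T < 1 →
                restrictionNorm ι s T u ≤
                  C * (sobolevNorm s f + sobolevNorm (s - 1) g) +
                    K T ε * spaceNorm ι (boxTildeInv (lamMinus ε F))) ∧
      (∀ ε : ℝ, 0 < ε → Tendsto (fun T ↦ K T ε) (𝓝[>] 0) (𝓝 0)) ∧
      (∃ C' : ℝ, ∀ ε : ℝ, 0 ≤ ε → ∀ α : ℝ, 0 ≤ α → α ≤ 1 → ∀ T : ℝ, 0 < T → T < 1 →
        (K T ε : ℝ) ≤ C' * T ^ min (α * ε) (rateExponent θ γ ε α)) := by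
  have hγ0 : 0 ≤ γ := nonneg_of_mixedNormBound hι (by linarith) hembed hmixed
  obtain ⟨C₀, C₁, hC⟩ := exists_restrictionNorm_le hι hθ hγ0 hγ.le hembed hmono hmixed
  choose A hA hmax using exists_isMax_exponent θ γ
  set σ : ℝ → ℝ := fun ε ↦ min (A ε * ε) (rateExponent θ γ ε (A ε)) with hσ
  -- Two powers of T occur in the estimate, and for T < 1 each is at most the one with the smaller
  -- exponent; this accounts for the factor 2.
  refine ⟨C₀, fun T ε ↦ 2 * C₁ * (T ^ σ ε).toNNReal, fun ε hε f g F hf hg ⟨x, hF⟩ ↦ ?_,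
    fun ε hε ↦ ?_, 2 * C₁, fun ε hε α hα hα1 T hT hT1 ↦ ?_⟩
  · obtain ⟨b, hb, hfb⟩ := exists_isFunction_of_sobolevNorm hf
    obtain ⟨c, hc, hgc⟩ := exists_isFunction_of_sobolevNorm hg
    obtain ⟨A₀, hA₀⟩ := id hembed
    obtain ⟨a, ha, hxa⟩ := exists_isFunction_of_calHNorm
      ((hA₀ x).trans_lt (ENNReal.mul_lt_top (by simp) (by simp)))
    subst hF
    obtain ⟨u₀, hu₀, hu₀'⟩ := exists_solvesCauchy hε hb.measurable hc.measurable hfb hgc hf hg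
      ha.measurable (hembed.fiberMass_lt_top hθ ha.measurable hxa) (isFunction_forcing ε hxa)
    refine ⟨⟨u₀, hu₀, fun v hv ↦ hv.unique hu₀⟩, fun u hu T hT hT1 ↦ ?_⟩
    obtain rfl : u = u₀ := hu.unique hu₀
    rw [boxTildeInv_lamMinus_boxTilde hxa, spaceNorm_apply hι]
    have hf' := hf
    have hg' := hg
    rw [sobolevNorm_eq hfb] at hf' ⊢
    rw [sobolevNorm_eq hgc] at hg' ⊢
    refine (hC ε (A ε) T hε (hA ε).1 (hA ε).2 hT hT1 b c a x u hb.measurable hc.measurable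
      ha.measurable hf' hg' hxa hu₀').trans ?_
    gcongr
    have e : ENNReal.ofReal (T ^ σ ε) = ((T ^ σ ε).toNNReal : ℝ≥0∞) := rfl
    push_cast
    rw [← e, mul_comm (2 : ℝ≥0∞), mul_assoc, two_mul]
    refine mul_le_mul_right (add_le_add (ENNReal.ofReal_le_ofReal ?_)
      (ENNReal.ofReal_le_ofReal ?_)) _
    · exact Real.rpow_le_rpow_of_exponent_ge hT hT1.le (min_le_left _ _)
    · exact Real.rpow_le_rpow_of_exponent_ge hT hT1.le (min_le_right _ _)
  -- The optimal exponent is at least the one for this particular α, hence positive.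
  · obtain ⟨α, hα, hpos⟩ := exists_exponent_pos hθ hγ hε
    have hσ0 : 0 < σ ε := hpos.trans_le (hmax ε α hα)
    have h1 : Tendsto (fun T : ℝ ↦ T ^ σ ε) (𝓝[>] 0) (𝓝 0) := by
      have := (Real.continuousAt_rpow_const 0 (σ ε) (Or.inr hσ0.le)).tendsto
      rw [Real.zero_rpow hσ0.ne'] at this
      exact this.mono_left nhdsWithin_le_nhds
    have h2 := (tendsto_real_toNNReal h1).const_mul (2 * C₁)
    simpa using h2
  · push_cast
    rw [Real.coe_toNNReal _ (by positivity)]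
    exact mul_le_mul_of_nonneg_left (Real.rpow_le_rpow_of_exponent_ge hT hT1.le
      (hmax ε α ⟨hα, hα1⟩)) (by positivity)
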